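/- **Conventions.** A function on a convex set $U\subseteq\mathbb R^n$ is *difference-convex* ($DC$) if it is the difference of two continuous convex functions on $U$; it is *locally $DC$* if each point of its domain has a convex neighborhood on which it is $DC$. $W^{2,1}$ is the Sobolev space of integrable functions with integrable weak derivatives up to order two, and $W^{2,1}_{\mathrm{loc}}$ is its local version. A vector- or matrix-valued map belongs to one of these classes if all its real components do. Let $\operatorname{Herm}(d)$ be the real vector space of complex $d\times d$ Hermitian matrices. A *system of the eigenvalues* of a map $A$ with values in $\operatorname{Herm}(d)$ is a map $\lambda=(\lambda_1,\dots,\lambda_d)$ on the same domain with values in $\mathbb R^d$ such that, at each point $t$, $\lambda_1(t),\dots,\lambda_d(t)$ are the eigenvalues of $A(t)$ with multiplicities, in some order. **Theorem.** Let $A:\mathbb R\to\operatorname{Herm}(d)$ be a curve of Hermitian matrices of class $DC\cap W^{2,1}_{\mathrm{loc}}$ on $\mathbb R$. 1. Any differentiable system $\lambda=(\lambda_1,\dots,\lambda_d)$ of the eigenvalues of $A$ is actually of class $$\lambda\in C^1(\mathbb R,\mathbb R^d)\cap DC(\mathbb R,\mathbb R^d)\cap W^{2,1}_{\mathrm{loc}}(\mathbb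 R,\mathbb R^d).$$ 2. If $A$ is additionally of class $C^1$, then there exists a differentiable (thus $C^1$) system $\lambda=(\lambda_1,\dots,\lambda_d)$ of the eigenvalues of $A$. 3. The result is uniform in the following sense. Let $I\subseteq\mathbb R$ be a nonempty bounded open interval, let $k\ge 0$, and let $U$ be an open neighborhood of the closure of $I^{1+k}$ in $\mathbb R^{1+k}$. Suppose that $A:U\to\operatorname{Herm}(d)$ is such that - $A$ is locally $DC$ on $U$, - $A(\cdot,r)\in C^1(\overline I,\operatorname{Herm}(d))\cap W^{2,1}(I,\operatorname{Herm}(d))$ for all $r\in\overline I^{\,k}$. Assume that, for each $r\in\overline I^{\,k}$, a $C^1$-system $\lambda(\cdot,r)$ on $\overline I$ of the eigenvalues of $A(\cdot,r)$ is fixed. Then the family $\lambda(\cdot,r)$, $r\in\overline I^{\,k}$, is bounded in $C^1(\overline I,\mathbb R^d)$, and there is a non-negative $L^1$-function $m:I^k\to\mathbb R_{\ge 0}$ such that $$\|\lambda(\cdot,r)\|_{W^{2,1}(I,\mathbb R^d)}\le m(r)\quad\text{for a.e. } r\in I^k.$$ -/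

import Mathlib

open scoped ContDiff

/-- `f` is difference-convex (DC) on the convex set `U`: on `U` it is the difference of two
continuous convex functions (`ConvexOn` contains the convexity of `U`). -/
def DCOn {E : Type*} [AddCommGroup E] [Module ℝ E] [TopologicalSpace E]
    (U : Set E) (f : E → ℝ) : Prop :=
  ∃ g h : E → ℝ, ContinuousOn g U ∧ ConvexOn ℝ U g ∧ ContinuousOn h U ∧ ConvexOn ℝ U h ∧
    ∀ x ∈ U, f x = g x - h x

/-- `f` is locally difference-convex on `U`: each point of `U` has a convex neighborhood (in `U`)
on which `f` is difference-convex. -/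
def LocallyDCOn {E : Type*} [AddCommGroup E] [Module ℝ E] [TopologicalSpace E]
    (U : Set E) (f : E → ℝ) : Prop :=
  ∀ x ∈ U, ∃ V ∈ nhdsWithin x U, V ⊆ U ∧ Convex ℝ V ∧ DCOn V f

/-- On the open set `Ω ⊆ ℝ`, the locally integrable function `v` is the weak (distributional)
derivative of order `n` of the locally integrable function `u`. -/
def HasWeakDeriv (n : ℕ) (Ω : Set ℝ) (u v : ℝ → ℝ) : Prop :=
  MeasureTheory.LocallyIntegrableOn u Ω ∧ MeasureTheory.LocallyIntegrableOn v Ω ∧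
    ∀ φ : ℝ → ℝ, ContDiff ℝ ∞ φ → HasCompactSupport φ → tsupport φ ⊆ Ω →
      ∫ x in Ω, u x * iteratedDeriv n φ x = (-1) ^ n * ∫ x in Ω, v x * φ x

/-- The Sobolev class `W^{2,1}(Ω)` on an open set `Ω ⊆ ℝ`. -/
def MemW21 (Ω : Set ℝ) (u : ℝ → ℝ) : Prop :=
  ∃ v w : ℝ → ℝ, HasWeakDeriv 1 Ω u v ∧ HasWeakDeriv 2 Ω u w ∧
    MeasureTheory.IntegrableOn u Ω ∧ MeasureTheory.IntegrableOn v Ω ∧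
      MeasureTheory.IntegrableOn w Ω

/-- The local Sobolev class `W^{2,1}_loc(Ω)` on an open set `Ω ⊆ ℝ`: the function and its weak
derivatives up to order two are locally integrable (which `HasWeakDeriv` contains). -/
def MemW21Loc (Ω : Set ℝ) (u : ℝ → ℝ) : Prop :=
  ∃ v w : ℝ → ℝ, HasWeakDeriv 1 Ω u v ∧ HasWeakDeriv 2 Ω u w

/-- The Sobolev norm `‖u‖_{L¹(Ω)} + ‖u'‖_{L¹(Ω)} + ‖u''‖_{L¹(Ω)}` on an open set `Ω ⊆ ℝ`, with values
in `[0, ∞]`. Weak derivatives are unique up to null sets, so the infimum is over equal values; it is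
`∞` if the weak derivatives do not exist, so that the norm is finite exactly on `W^{2,1}(Ω)`. -/
noncomputable def W21norm (Ω : Set ℝ) (u : ℝ → ℝ) : ENNReal :=
  ⨅ (v : ℝ → ℝ) (w : ℝ → ℝ) (_ : HasWeakDeriv 1 Ω u v ∧ HasWeakDeriv 2 Ω u w),
    (∫⁻ x in Ω, ‖u x‖ₑ) + (∫⁻ x in Ω, ‖v x‖ₑ) + ∫⁻ x in Ω, ‖w x‖ₑ

/-- A matrix-valued map belongs to a class `P` of real functions if all its components, that is, the
real and imaginary parts of its entries, do. -/
def Componentwise {X : Type*} {d : ℕ} (P : (X → ℝ) → Prop)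
    (A : X → Matrix (Fin d) (Fin d) ℂ) : Prop :=
  ∀ i j, P (fun x => (A x i j).re) ∧ P (fun x => (A x i j).im)

/-- `v` lists the eigenvalues of `M`, with multiplicities and in some order. -/
def IsEigenvalueTuple {d : ℕ} (M : Matrix (Fin d) (Fin d) ℂ) (v : Fin d → ℝ) : Prop :=
  M.charpoly = ∏ j, (Polynomial.X - Polynomial.C (v j : ℂ))

/-! At a multiple eigenvalue, the derivatives of the eigenvalues are the eigenvalues of the
compression of `A'` to the eigenspace of `A`; hence they do not depend on the system.

For the difference-convexity, let `W` bound the sum of the norms of the entries of `A''`. For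
weights ordered as the eigenvalues at `t`, the weighted sum of the eigenvalues at `t` dominates
the one of the diagonal entries of `A t` in an eigenbasis at `t₀`, and the latter are the first
order Taylor polynomials of the eigenvalues at `t₀` up to the Taylor remainder of the second
primitive of `W`. Therefore the spread `∑ |λ i - λ j|`, a combination of the `λ i` with such
weights, becomes convex when a multiple of this second primitive is added, and it stays convex
after adding any `± λ j`. Thus `λ j` is difference-convex, and the variation of its derivative is
controlled by the right derivative of a single convex function.

For the Sobolev regularity it remains to exclude a singular part of `λ j'`, which is continuous
and of bounded variation. By the Banach–Zarecki theorem it suffices that `λ j'` maps null sets to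
null sets. Near `t₀`, the mean of the eigenvalues which coincide at `t₀` has an absolutely
continuous derivative, because off-diagonal perturbations contribute to second order only. At the
accumulation points of the set where these eigenvalues coincide, their derivatives agree with the
one of the mean.

The unordered tuple of the pairs `(λ j, λ j')` depends continuously on `t` if `A` is `C¹`.
Matching it optimally along finer and finer grids lifts it to a continuous curve, which is a `C¹`
system.

Finally, the bounds on the eigenvalues only depend on bounds on the values, the first derivatives
and the `L¹` norms of the second derivatives of the entries. For the slices of a locally
difference-convex function these are uniform, since convex functions are locally Lipschitz.
-/

open Filter Matrix Topology

section Diagonalization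

variable {𝕜 n : Type*} [RCLike 𝕜] [Fintype n] [DecidableEq n] {U V A A' B : Matrix n n 𝕜}
  {v v' w w' : n → ℝ}

/-- The matrix `U` is unitary and diagonalizes `A`: its column `j` is an eigenvector of `A` for the
eigenvalue `v j`. -/
structure Diagonalizes (U A : Matrix n n 𝕜) (v : n → ℝ) : Prop where
  conjTranspose_mul_self : Uᴴ * U = 1
  mul_eq : A * U = U * diagonal fun j => (v j : 𝕜)

/-- First order perturbation data: the unitary matrix `U` diagonalizes `A`, and it also diagonalizes
the compressions of `A'` to the eigenspaces of `A`, with the eigenvalues `v'`. These are the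
derivatives at `0` of the eigenvalues of a curve with value `A` and derivative `A'` at `0`. -/
structure DiagonalizesJet (U A A' : Matrix n n 𝕜) (v v' : n → ℝ) : Prop
    extends Diagonalizes U A v where
  conjTranspose_mul_mul_apply : ∀ i j, v i = v j →
    (Uᴴ * A' * U) i j = diagonal (fun j => (v' j : 𝕜)) i j

namespace Diagonalizes

theorem mul_conjTranspose_self (h : Diagonalizes U A v) : U * Uᴴ = 1 :=
  mul_eq_one_comm.mp h.conjTranspose_mul_self

theorem conjTranspose_mul_mul (h : Diagonalizes U A v) :
    Uᴴ * A * U = diagonal fun j => (v j : 𝕜) := by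
  rw [Matrix.mul_assoc, h.mul_eq, ← Matrix.mul_assoc, h.conjTranspose_mul_self, Matrix.one_mul]

theorem conjTranspose_mul (h : Diagonalizes U A v) :
    Uᴴ * A = diagonal (fun j => (v j : 𝕜)) * Uᴴ := by
  rw [← h.conjTranspose_mul_mul, Matrix.mul_assoc, h.mul_conjTranspose_self, Matrix.mul_one]

theorem re_conjTranspose_mul_mul_apply_self (h : Diagonalizes U A v) (j : n) :
    RCLike.re ((Uᴴ * A * U) j j) = v j := by
  rw [h.conjTranspose_mul_mul, diagonal_apply_eq, RCLike.ofReal_re]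

theorem comp_perm (h : Diagonalizes U A v) (σ : Equiv.Perm n) :
    Diagonalizes (U.submatrix id σ) A (v ∘ σ) where
  conjTranspose_mul_self := by
    rw [conjTranspose_submatrix, ← submatrix_mul _ _ _ _ _ Function.bijective_id,
      h.conjTranspose_mul_self, submatrix_one_equiv]
  mul_eq := by
    ext i j
    have hij := congr_fun₂ h.mul_eq i (σ j)
    rw [mul_diagonal] at hij
    rwa [mul_diagonal]

theorem conjTranspose_mul_sub_mul_apply (hU : Diagonalizes U A v) (hV : Diagonalizes V B w)
    (i j : n) :
    (Uᴴ * (B - A) * V) i j = ((w j - v i : ℝ) : 𝕜) * (Uᴴ * V) i j := by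
  rw [Matrix.mul_sub, Matrix.sub_mul, hU.conjTranspose_mul, Matrix.mul_assoc, hV.mul_eq,
    Matrix.mul_assoc, ← Matrix.mul_assoc Uᴴ, Matrix.sub_apply, mul_diagonal, diagonal_mul]
  push_cast
  ring

theorem eq_of_conjTranspose_mul_apply_ne_zero (hU : Diagonalizes U A v) (hV : Diagonalizes V A w)
    {i j : n} (hij : (Uᴴ * V) i j ≠ 0) : v i = w j := by
  have h := hU.conjTranspose_mul_sub_mul_apply hV i j
  rw [sub_self, Matrix.mul_zero, Matrix.zero_mul, Matrix.zero_apply, eq_comm, mul_eq_zero,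
    or_iff_left hij, RCLike.ofReal_eq_zero, sub_eq_zero] at h
  exact h.symm

theorem conjTranspose_mul_mul_mul_conjTranspose_mul (hU : Diagonalizes U A v)
    (hV : Diagonalizes V B w) (M : Matrix n n 𝕜) :
    Uᴴ * M * U * (Uᴴ * V) = Uᴴ * V * (Vᴴ * M * V) :=
  calc Uᴴ * M * U * (Uᴴ * V) = Uᴴ * M * (U * Uᴴ) * V := by simp only [Matrix.mul_assoc]
    _ = Uᴴ * (V * Vᴴ) * M * V := by
      rw [hU.mul_conjTranspose_self, hV.mul_conjTranspose_self, Matrix.mul_one, Matrix.mul_one]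
    _ = Uᴴ * V * (Vᴴ * M * V) := by simp only [Matrix.mul_assoc]

theorem det_conjTranspose_mul_ne_zero (hU : Diagonalizes U A v) (hV : Diagonalizes V B w) :
    (Uᴴ * V).det ≠ 0 := by
  have h : Uᴴ * V * (Vᴴ * U) = 1 := by
    rw [Matrix.mul_assoc, ← Matrix.mul_assoc V, hV.mul_conjTranspose_self, Matrix.one_mul,
      hU.conjTranspose_mul_self]
  exact ((isUnit_iff_isUnit_det _).mp (IsUnit.of_mul_eq_one _ h)).ne_zero

end Diagonalizes

theorem exists_diagonalizes_eigenvalues (hA : A.IsHermitian) :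
    ∃ U, Diagonalizes U A hA.eigenvalues := by
  have hU := Unitary.coe_star_mul_self hA.eigenvectorUnitary
  have hspec := hA.spectral_theorem
  rw [Unitary.conjStarAlgAut_apply] at hspec
  set U := (hA.eigenvectorUnitary : Matrix n n 𝕜)
  refine ⟨U, hU, ?_⟩
  calc A * U = U * diagonal (RCLike.ofReal ∘ hA.eigenvalues) * star U * U :=
        congrArg (· * U) hspec
    _ = U * diagonal fun j => (hA.eigenvalues j : 𝕜) := by
      rw [Matrix.mul_assoc, hU, Matrix.mul_one]
      rfl

theorem exists_perm_apply_ne_zero_of_det_ne_zero {R : Type*} [CommRing R]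
    {M : Matrix n n R} (hM : M.det ≠ 0) : ∃ σ : Equiv.Perm n, ∀ j, M (σ j) j ≠ 0 := by
  rw [det_apply] at hM
  obtain ⟨σ, -, hσ⟩ := Finset.exists_ne_zero_of_sum_ne_zero hM
  refine ⟨σ, fun j hj => hσ ?_⟩
  rw [Finset.prod_eq_zero (f := fun i => M (σ i) i) (Finset.mem_univ j) hj, smul_zero]

namespace DiagonalizesJet

theorem re_conjTranspose_mul_mul_apply_self (h : DiagonalizesJet U A A' v v') (j : n) :
    RCLike.re ((Uᴴ * A' * U) j j) = v' j := by
  rw [h.conjTranspose_mul_mul_apply j j rfl, diagonal_apply_eq, RCLike.ofReal_re]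

theorem derivative_eq_of_conjTranspose_mul_apply_ne_zero (hU : DiagonalizesJet U A A' v v')
    (hV : DiagonalizesJet V A A' w w') {i j : n} (hij : (Uᴴ * V) i j ≠ 0) : v' i = w' j := by
  have hvw : v i = w j := hU.toDiagonalizes.eq_of_conjTranspose_mul_apply_ne_zero hV.1 hij
  have hleft (k : n) : (Uᴴ * A' * U) i k * (Uᴴ * V) k j =
      diagonal (fun j => (v' j : 𝕜)) i k * (Uᴴ * V) k j := by
    rcases eq_or_ne ((Uᴴ * V) k j) 0 with h0 | h0
    · rw [h0, mul_zero, mul_zero]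
    · rw [hU.conjTranspose_mul_mul_apply i k
        (hvw.trans (hU.1.eq_of_conjTranspose_mul_apply_ne_zero hV.1 h0).symm)]
  have hright (k : n) : (Uᴴ * V) i k * (Vᴴ * A' * V) k j =
      (Uᴴ * V) i k * diagonal (fun j => (w' j : 𝕜)) k j := by
    rcases eq_or_ne ((Uᴴ * V) i k) 0 with h0 | h0
    · rw [h0, zero_mul, zero_mul]
    · rw [hV.conjTranspose_mul_mul_apply k j
        ((hU.1.eq_of_conjTranspose_mul_apply_ne_zero hV.1 h0).symm.trans hvw)]
  have h := congr_fun₂ (hU.1.conjTranspose_mul_mul_mul_conjTranspose_mul hV.1 A') i j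
  rw [Matrix.mul_apply, Matrix.mul_apply, Finset.sum_congr rfl fun k _ => hleft k,
    Finset.sum_congr rfl fun k _ => hright k, ← Matrix.mul_apply, ← Matrix.mul_apply,
    diagonal_mul, mul_diagonal, mul_comm] at h
  exact_mod_cast mul_left_cancel₀ hij h

theorem exists_perm (hU : DiagonalizesJet U A A' v v') (hV : DiagonalizesJet V A A' w w') :
    ∃ σ : Equiv.Perm n, w = v ∘ σ ∧ w' = v' ∘ σ := by
  obtain ⟨σ, hσ⟩ :=
    exists_perm_apply_ne_zero_of_det_ne_zero (hU.1.det_conjTranspose_mul_ne_zero hV.1)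
  exact ⟨σ, funext fun j => (hU.1.eq_of_conjTranspose_mul_apply_ne_zero hV.1 (hσ j)).symm,
    funext fun j => (hU.derivative_eq_of_conjTranspose_mul_apply_ne_zero hV (hσ j)).symm⟩

theorem comp_perm (h : DiagonalizesJet U A A' v v') (σ : Equiv.Perm n) :
    DiagonalizesJet (U.submatrix id σ) A A' (v ∘ σ) (v' ∘ σ) where
  toDiagonalizes := h.toDiagonalizes.comp_perm σ
  conjTranspose_mul_mul_apply i j hij := by
    have hdiag := congr_fun₂ (submatrix_diagonal_equiv (fun j => (v' j : 𝕜)) σ) i j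
    exact (h.conjTranspose_mul_mul_apply (σ i) (σ j) hij).trans hdiag

end DiagonalizesJet

end Diagonalization

section EigenvalueTuples

variable {d : ℕ} {U A : Matrix (Fin d) (Fin d) ℂ} {v w : Fin d → ℝ}

theorem Diagonalizes.isEigenvalueTuple (h : Diagonalizes U A v) : IsEigenvalueTuple A v := by
  have hA : A = U * (diagonal (fun j => (v j : ℂ)) * Uᴴ) :=
    calc A = U * Uᴴ * A := by rw [h.mul_conjTranspose_self, Matrix.one_mul]
      _ = _ := by rw [Matrix.mul_assoc, h.conjTranspose_mul]; rfl
  rw [IsEigenvalueTuple, hA, charpoly_mul_comm, Matrix.mul_assoc, h.conjTranspose_mul_self,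
    Matrix.mul_one, charpoly_diagonal]

theorem exists_eq_comp_perm_of_map_eq {α β : Type*} [Fintype α] {f g : α → β}
    (h : Finset.univ.val.map f = Finset.univ.val.map g) : ∃ σ : Equiv.Perm α, f = g ∘ σ := by
  classical
  have hfiber (c : β) : Nonempty ({a // f a = c} ≃ {a // g a = c}) := by
    refine ⟨Fintype.equivOfCardEq ?_⟩
    have hcount := congrArg (Multiset.count c) h
    rw [Multiset.count_map, Multiset.count_map] at hcount
    simpa [Fintype.card_subtype, eq_comm, Finset.card_def] using hcount
  have e := fun c => (hfiber c).some
  exact ⟨Equiv.ofFiberEquiv e, funext fun a => (Equiv.ofFiberEquiv_map e a).symm⟩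

theorem IsEigenvalueTuple.roots_charpoly (hv : IsEigenvalueTuple A v) :
    A.charpoly.roots = Finset.univ.val.map fun j => (v j : ℂ) := by
  have h := Polynomial.roots_multiset_prod_X_sub_C (Finset.univ.val.map fun j => (v j : ℂ))
  rw [Multiset.map_map] at h
  rw [show A.charpoly = _ from hv]
  exact h

theorem IsEigenvalueTuple.exists_eq_comp_perm (hv : IsEigenvalueTuple A v)
    (hw : IsEigenvalueTuple A w) : ∃ σ : Equiv.Perm (Fin d), v = w ∘ σ := by
  obtain ⟨σ, hσ⟩ :=
    exists_eq_comp_perm_of_map_eq (hv.roots_charpoly.symm.trans hw.roots_charpoly)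
  exact ⟨σ, funext fun j => Complex.ofReal_injective (congrFun hσ j)⟩

theorem IsEigenvalueTuple.exists_diagonalizes (hA : A.IsHermitian) (hv : IsEigenvalueTuple A v) :
    ∃ U, Diagonalizes U A v := by
  obtain ⟨U, hU⟩ := exists_diagonalizes_eigenvalues hA
  obtain ⟨σ, rfl⟩ := hv.exists_eq_comp_perm hU.isEigenvalueTuple
  exact ⟨_, hU.comp_perm σ⟩

end EigenvalueTuples

section MatrixDerivatives

variable {𝕜 m n : Type*} [RCLike 𝕜] [Finite m] [Finite n] {A : ℝ → Matrix m n 𝕜}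
  {B : Matrix m n 𝕜} {t₀ : ℝ}

theorem hasDerivAt_matrix :
    HasDerivAt A B t₀ ↔ ∀ i j, HasDerivAt (fun t => A t i j) (B i j) t₀ := by
  cases nonempty_fintype m
  cases nonempty_fintype n
  exact hasDerivAt_pi.trans (forall_congr' fun i => hasDerivAt_pi)

theorem tendsto_slope_of_hasDerivAt (hA : HasDerivAt A B t₀) :
    Tendsto (slope A t₀) (𝓝[≠] t₀) (𝓝 B) :=
  tendsto_pi_nhds.mpr fun i => tendsto_pi_nhds.mpr fun j =>
    (hasDerivAt_matrix.mp hA i j).tendsto_slope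

theorem tendsto_of_hasDerivAt (hA : HasDerivAt A B t₀) : Tendsto A (𝓝 t₀) (𝓝 (A t₀)) :=
  tendsto_pi_nhds.mpr fun i => tendsto_pi_nhds.mpr fun j =>
    (hasDerivAt_matrix.mp hA i j).continuousAt

theorem isHermitian_of_hasDerivAt {A : ℝ → Matrix n n 𝕜} {B : Matrix n n 𝕜}
    (hH : ∀ᶠ t in 𝓝 t₀, (A t).IsHermitian) (hA : HasDerivAt A B t₀) : B.IsHermitian := by
  refine IsHermitian.ext fun i j => ?_
  refine ((hasDerivAt_matrix.mp hA j i).star.congr_of_eventuallyEq ?_).unique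
    (hasDerivAt_matrix.mp hA i j)
  filter_upwards [hH] with t ht using (ht.apply i j).symm

end MatrixDerivatives

section LimitsOfEigenbases

variable {𝕜 n ι : Type*} [RCLike 𝕜] [Fintype n] [DecidableEq n] {l : Filter ι}
  {U₀ A₀ A₀' : Matrix n n 𝕜} {v₀ v₀' : n → ℝ}

theorem isCompact_setOf_conjTranspose_mul_self_eq_one :
    IsCompact {U : Matrix n n 𝕜 | Uᴴ * U = 1} := by
  have hbounded : IsCompact (Set.univ.pi fun _ : n => Set.univ.pi fun _ : n =>
      Metric.closedBall (0 : 𝕜) 1) :=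
    isCompact_univ_pi fun _ => isCompact_univ_pi fun _ => isCompact_closedBall _ _
  refine IsCompact.of_isClosed_subset hbounded (isClosed_eq
    (continuous_id.matrix_conjTranspose.matrix_mul continuous_id) continuous_const)
    fun U hU i _ j _ => ?_
  simpa using entry_norm_bound_of_unitary (mem_unitaryGroup_iff'.mpr hU) i j

omit [DecidableEq n] in
theorem tendsto_re_conjTranspose_mul_mul_apply_self {U A : ι → Matrix n n 𝕜}
    (hU : Tendsto U l (𝓝 U₀)) (hA : Tendsto A l (𝓝 A₀)) :
    Tendsto (fun t j => RCLike.re (((U t)ᴴ * A t * U t) j j)) l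
      (𝓝 fun j => RCLike.re ((U₀ᴴ * A₀ * U₀) j j)) :=
  tendsto_pi_nhds.mpr fun j => (RCLike.continuous_re.tendsto _).comp
    (tendsto_pi_nhds.mp (tendsto_pi_nhds.mp ((hU.star.mul hA).mul hU) j) j)

theorem Diagonalizes.tendsto_eigenvalue {U A : ι → Matrix n n 𝕜} {v : ι → n → ℝ}
    (h : ∀ᶠ t in l, Diagonalizes (U t) (A t) (v t)) (hU : Tendsto U l (𝓝 U₀))
    (hA : Tendsto A l (𝓝 A₀)) :
    Tendsto v l (𝓝 fun j => RCLike.re ((U₀ᴴ * A₀ * U₀) j j)) :=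
  (tendsto_re_conjTranspose_mul_mul_apply_self hU hA).congr' <| h.mono fun _ ht =>
    funext ht.re_conjTranspose_mul_mul_apply_self

theorem DiagonalizesJet.tendsto_derivative {U A A' : ι → Matrix n n 𝕜} {v v' : ι → n → ℝ}
    (h : ∀ᶠ t in l, DiagonalizesJet (U t) (A t) (A' t) (v t) (v' t))
    (h₀ : DiagonalizesJet U₀ A₀ A₀' v₀ v₀') (hU : Tendsto U l (𝓝 U₀))
    (hA' : Tendsto A' l (𝓝 A₀')) : Tendsto v' l (𝓝 v₀') := by
  rw [show v₀' = _ from funext fun j => (h₀.re_conjTranspose_mul_mul_apply_self j).symm]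
  exact (tendsto_re_conjTranspose_mul_mul_apply_self hU hA').congr' <| h.mono fun _ ht =>
    funext ht.re_conjTranspose_mul_mul_apply_self

theorem Diagonalizes.of_tendsto [l.NeBot] {U A : ι → Matrix n n 𝕜} {v : ι → n → ℝ}
    (h : ∀ᶠ t in l, Diagonalizes (U t) (A t) (v t)) (hU : Tendsto U l (𝓝 U₀))
    (hA : Tendsto A l (𝓝 A₀)) (hv : Tendsto v l (𝓝 v₀)) : Diagonalizes U₀ A₀ v₀ where
  conjTranspose_mul_self := by
    refine tendsto_nhds_unique (hU.star.mul hU) (tendsto_const_nhds.congr' ?_)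
    exact h.mono fun t ht => ht.conjTranspose_mul_self.symm
  mul_eq := by
    have hdiag : Tendsto (fun t => diagonal fun j => (v t j : 𝕜)) l
        (𝓝 (diagonal fun j => (v₀ j : 𝕜))) :=
      ((continuous_id.matrix_diagonal.comp (continuous_pi fun j =>
        RCLike.continuous_ofReal.comp (continuous_apply j))).tendsto v₀).comp hv
    exact tendsto_nhds_unique ((hA.mul hU).congr' (h.mono fun t ht => ht.mul_eq))
      (hU.mul hdiag)

end LimitsOfEigenbases

section LimitsOfDividedDifferences

variable {𝕜 n : Type*} [RCLike 𝕜] [Fintype n] [DecidableEq n] {l : Filter ℝ} {t₀ : ℝ}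
  {A A' U : ℝ → Matrix n n 𝕜} {A₀' U₀ : Matrix n n 𝕜} {v v' : ℝ → n → ℝ} {v₀ v₀' : n → ℝ}



theorem Diagonalizes.tendsto_dividedDifference_mul (hl : l ≤ 𝓝[≠] t₀) (hA : HasDerivAt A A₀' t₀)
    (h : ∀ᶠ t in l, Diagonalizes (U t) (A t) (v t)) (hU : Tendsto U l (𝓝 U₀))
    (h₀ : Diagonalizes U₀ (A t₀) v₀) (i j : n) :
    Tendsto (fun t => (((v t j - v₀ i) / (t - t₀) : ℝ) : 𝕜) * (U₀ᴴ * U t) i j) l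
      (𝓝 ((U₀ᴴ * A₀' * U₀) i j)) := by
  have hslope : Tendsto (fun t => U₀ᴴ * slope A t₀ t * U t) l (𝓝 (U₀ᴴ * A₀' * U₀)) :=
    (((tendsto_slope_of_hasDerivAt hA).mono_left hl).const_mul U₀ᴴ).mul hU
  refine (tendsto_pi_nhds.mp (tendsto_pi_nhds.mp hslope i) j).congr' ?_
  filter_upwards [h] with t ht
  rw [slope_def_module, Matrix.mul_smul, Matrix.smul_mul, Matrix.smul_apply,
    h₀.conjTranspose_mul_sub_mul_apply ht, RCLike.real_smul_eq_coe_mul]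
  push_cast
  ring

theorem Diagonalizes.tendsto_overlap (h₀ : Diagonalizes U₀ (A t₀) v₀)
    (hU : Tendsto U l (𝓝 U₀)) (i j : n) :
    Tendsto (fun t => (U₀ᴴ * U t) i j) l (𝓝 ((1 : Matrix n n 𝕜) i j)) := by
  rw [← h₀.conjTranspose_mul_self]
  exact tendsto_pi_nhds.mp (tendsto_pi_nhds.mp (hU.const_mul U₀ᴴ) i) j

theorem Diagonalizes.tendsto_dividedDifference (hl : l ≤ 𝓝[≠] t₀) (hA : HasDerivAt A A₀' t₀)
    (h : ∀ᶠ t in l, Diagonalizes (U t) (A t) (v t)) (hU : Tendsto U l (𝓝 U₀))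
    (h₀ : Diagonalizes U₀ (A t₀) v₀) (j : n) :
    Tendsto (fun t => (v t j - v₀ j) / (t - t₀)) l (𝓝 (RCLike.re ((U₀ᴴ * A₀' * U₀) j j))) := by
  have hoverlap := h₀.tendsto_overlap hU j j
  rw [one_apply_eq] at hoverlap
  have hquot := (tendsto_dividedDifference_mul hl hA h hU h₀ j j).div hoverlap one_ne_zero
  rw [div_one] at hquot
  refine ((RCLike.continuous_re.tendsto _).comp hquot).congr' ?_
  filter_upwards [hoverlap.eventually_ne one_ne_zero] with t ht
  rw [Function.comp_apply, Pi.div_apply, mul_div_cancel_right₀ _ ht, RCLike.ofReal_re]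

theorem Diagonalizes.diagonalizesJet_of_tendsto [l.NeBot] (hl : l ≤ 𝓝[≠] t₀)
    (hA : HasDerivAt A A₀' t₀) (h : ∀ᶠ t in l, Diagonalizes (U t) (A t) (v t))
    (hU : Tendsto U l (𝓝 U₀)) (h₀ : Diagonalizes U₀ (A t₀) v₀) :
    DiagonalizesJet U₀ (A t₀) A₀' v₀ fun j => RCLike.re ((U₀ᴴ * A₀' * U₀) j j) where
  toDiagonalizes := h₀
  conjTranspose_mul_mul_apply i j hij := by
    -- For `v₀ i = v₀ j`, the quotients converge even though `(U₀ᴴ * U t) i j` may tend to `0`.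
    have hlim := tendsto_dividedDifference_mul hl hA h hU h₀ i j
    rw [hij] at hlim
    rw [tendsto_nhds_unique hlim (((RCLike.continuous_ofReal.tendsto _).comp
      (tendsto_dividedDifference hl hA h hU h₀ j)).mul (h₀.tendsto_overlap hU i j))]
    rcases eq_or_ne i j with rfl | hne
    · rw [one_apply_eq, mul_one, diagonal_apply_eq]
    · rw [one_apply_ne hne, mul_zero, diagonal_apply_ne _ hne]

/-- Compactness of the unitary group makes the eigenbases converge along any ultrafilter. -/
theorem Diagonalizes.exists_tendsto_diagonalizesJet {G : Ultrafilter ℝ}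
    (hG : (G : Filter ℝ) ≤ 𝓝[≠] t₀) (hA : HasDerivAt A A₀' t₀)
    (h : ∀ᶠ t in G, Diagonalizes (U t) (A t) (v t)) :
    ∃ U₀ v₀ v₀', DiagonalizesJet U₀ (A t₀) A₀' v₀ v₀' ∧ Tendsto U G (𝓝 U₀) ∧
      Tendsto v G (𝓝 v₀) ∧ ∀ j, Tendsto (fun t => (v t j - v₀ j) / (t - t₀)) G (𝓝 (v₀' j)) := by
  obtain ⟨U₀, -, hU⟩ := isCompact_setOf_conjTranspose_mul_self_eq_one.ultrafilter_le_nhds'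
    (G.map U) (h.mono fun t ht => ht.conjTranspose_mul_self)
  have hcont : Tendsto A G (𝓝 (A t₀)) :=
    (tendsto_of_hasDerivAt hA).mono_left (hG.trans nhdsWithin_le_nhds)
  have hv := tendsto_eigenvalue h hU hcont
  have h₀ := of_tendsto h hU hcont hv
  exact ⟨U₀, _, _, diagonalizesJet_of_tendsto hG hA h hU h₀, hU, hv,
    tendsto_dividedDifference hG hA h hU h₀⟩

theorem exists_diagonalizesJet {A A' : Matrix n n 𝕜} (hA : A.IsHermitian) (hA' : A'.IsHermitian) :
    ∃ U v v', DiagonalizesJet U A A' v v' := by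
  have hline (t : ℝ) : (A + t • A').IsHermitian := hA.add (hA'.smul (star_trivial t))
  have hderiv : HasDerivAt (fun t : ℝ => A + t • A') A' 0 :=
    hasDerivAt_matrix.mpr fun i j => by
      simpa using ((hasDerivAt_id (0 : ℝ)).smul_const (A' i j)).const_add (A i j)
  choose U hU using fun t => exists_diagonalizes_eigenvalues (hline t)
  obtain ⟨U₀, v₀, v₀', h, -⟩ := Diagonalizes.exists_tendsto_diagonalizesJet
    (Ultrafilter.of_le (𝓝[≠] 0)) hderiv (Eventually.of_forall hU)
  exact ⟨U₀, v₀, v₀', by simpa using h⟩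

end LimitsOfDividedDifferences

section DifferentiableSystems

variable {𝕜 n : Type*} [RCLike 𝕜] [Fintype n] [DecidableEq n] {t₀ : ℝ}
  {A A' : ℝ → Matrix n n 𝕜} {A₀' : Matrix n n 𝕜} {v v' : ℝ → n → ℝ} {v₀' : n → ℝ}

theorem exists_diagonalizesJet_of_hasDerivAt (hA : HasDerivAt A A₀' t₀)
    (h : ∀ᶠ t in 𝓝 t₀, ∃ U, Diagonalizes U (A t) (v t)) (hv : HasDerivAt v v₀' t₀) :
    ∃ U, DiagonalizesJet U (A t₀) A₀' (v t₀) v₀' := by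
  let G := Ultrafilter.of (𝓝[≠] t₀)
  have hG : (G : Filter ℝ) ≤ 𝓝[≠] t₀ := Ultrafilter.of_le _
  have hG₀ : (G : Filter ℝ) ≤ 𝓝 t₀ := hG.trans nhdsWithin_le_nhds
  choose! U hU using fun t (ht : ∃ U, Diagonalizes U (A t) (v t)) => ht
  obtain ⟨U₀, v₀, w, hjet, -, hlim, hquot⟩ := Diagonalizes.exists_tendsto_diagonalizesJet hG hA
    ((h.filter_mono hG₀).mono hU)
  obtain rfl : v₀ = v t₀ := tendsto_nhds_unique hlim (hv.continuousAt.tendsto.mono_left hG₀)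
  obtain rfl : w = v₀' := funext fun j => tendsto_nhds_unique (hquot j) <|
    ((hasDerivAt_pi.mp hv j).tendsto_slope.mono_left hG).congr fun t => slope_def_field _ _ _
  exact ⟨U₀, hjet⟩

theorem exists_tendsto_slope_tendsto_derivative {G : Ultrafilter ℝ} (hG : (G : Filter ℝ) ≤ 𝓝[≠] t₀)
    (hA : HasDerivAt A (A' t₀) t₀) (hA' : ContinuousAt A' t₀)
    (h : ∀ᶠ t in 𝓝 t₀, ∃ U, DiagonalizesJet U (A t) (A' t) (v t) (v' t))
    (hv : ContinuousAt v t₀) :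
    ∃ w, Tendsto (slope v t₀) G (𝓝 w) ∧ Tendsto v' G (𝓝 w) := by
  have hG₀ : (G : Filter ℝ) ≤ 𝓝 t₀ := hG.trans nhdsWithin_le_nhds
  choose! U hU using fun t (ht : ∃ U, DiagonalizesJet U (A t) (A' t) (v t) (v' t)) => ht
  have hUG := (h.filter_mono hG₀).mono hU
  obtain ⟨U₀, v₀, w, hjet, hU₀, hlim, hquot⟩ := Diagonalizes.exists_tendsto_diagonalizesJet hG hA
    (hUG.mono fun t ht => ht.toDiagonalizes)
  obtain rfl : v₀ = v t₀ := tendsto_nhds_unique hlim (hv.tendsto.mono_left hG₀)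
  refine ⟨w, tendsto_pi_nhds.mpr fun j => (hquot j).congr fun t => ?_,
    DiagonalizesJet.tendsto_derivative hUG hjet hU₀ (hA'.tendsto.mono_left hG₀)⟩
  exact (slope_def_field (fun s => v s j) t₀ t).symm

theorem continuousAt_derivative_of_diagonalizesJet
    (hA : HasDerivAt A (A' t₀) t₀) (hA' : ContinuousAt A' t₀)
    (h : ∀ᶠ t in 𝓝 t₀, ∃ U, DiagonalizesJet U (A t) (A' t) (v t) (v' t))
    (hv : HasDerivAt v (v' t₀) t₀) : ContinuousAt v' t₀ := by
  rw [continuousAt_iff_punctured_nhds, tendsto_iff_ultrafilter]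
  intro G hG
  obtain ⟨w, hslope, hlim⟩ := exists_tendsto_slope_tendsto_derivative hG hA hA' h hv.continuousAt
  rwa [tendsto_nhds_unique hslope (hv.tendsto_slope.mono_left hG)] at hlim

theorem hasDerivAt_of_diagonalizesJet
    (hA : HasDerivAt A (A' t₀) t₀) (hA' : ContinuousAt A' t₀)
    (h : ∀ᶠ t in 𝓝 t₀, ∃ U, DiagonalizesJet U (A t) (A' t) (v t) (v' t))
    (hv : ContinuousAt v t₀) (hv' : ContinuousAt v' t₀) : HasDerivAt v (v' t₀) t₀ := by
  rw [hasDerivAt_iff_tendsto_slope, tendsto_iff_ultrafilter]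
  intro G hG
  obtain ⟨w, hslope, hlim⟩ := exists_tendsto_slope_tendsto_derivative hG hA hA' h hv
  rwa [tendsto_nhds_unique hlim (hv'.tendsto.mono_left (hG.trans nhdsWithin_le_nhds))] at hslope

theorem eventually_dist_comp_perm_lt_of_diagonalizesJet {U : ℝ → Matrix n n 𝕜} {ε : ℝ}
    (hA : HasDerivAt A (A' t₀) t₀) (hA' : ContinuousAt A' t₀)
    (hU : ∀ t, DiagonalizesJet (U t) (A t) (A' t) (v t) (v' t)) (hε : 0 < ε) :
    ∀ᶠ t in 𝓝 t₀, ∃ σ : Equiv.Perm n,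
      dist (fun j => (v t j, v' t j)) (fun j => (v t₀ (σ j), v' t₀ (σ j))) < ε := by
  rw [← nhdsNE_sup_pure, eventually_sup, eventually_pure]
  refine ⟨mem_iff_ultrafilter.mpr fun G hG => ?_, 1, by simpa using hε⟩
  have hG₀ : (G : Filter ℝ) ≤ 𝓝 t₀ := hG.trans nhdsWithin_le_nhds
  obtain ⟨U₀, v₀, v₀', hjet, hU₀, hv, -⟩ := Diagonalizes.exists_tendsto_diagonalizesJet hG hA
    (Eventually.of_forall fun t => (hU t).toDiagonalizes)
  have hv' := DiagonalizesJet.tendsto_derivative (Eventually.of_forall hU) hjet hU₀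
    (hA'.tendsto.mono_left hG₀)
  obtain ⟨σ, rfl, rfl⟩ := (hU t₀).exists_perm hjet
  have hpair : Tendsto (fun t j => (v t j, v' t j)) G (𝓝 fun j => (v t₀ (σ j), v' t₀ (σ j))) :=
    tendsto_pi_nhds.mpr fun j =>
      (tendsto_pi_nhds.mp hv j).prodMk_nhds (tendsto_pi_nhds.mp hv' j)
  filter_upwards [hpair.eventually (Metric.ball_mem_nhds _ hε)] with t ht using ⟨σ, ht⟩

end DifferentiableSystems

section PathLifting

variable {n E : Type*} [Fintype n] [PseudoMetricSpace E] {x y z : n → E} {η : ℝ}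

theorem dist_comp_perm (x y : n → E) (σ : Equiv.Perm n) : dist (x ∘ σ) (y ∘ σ) = dist x y := by
  refine le_antisymm ((dist_pi_le_iff dist_nonneg).mpr fun j => dist_le_pi_dist x y (σ j))
    ((dist_pi_le_iff dist_nonneg).mpr fun j => ?_)
  simpa using dist_le_pi_dist (x ∘ σ) (y ∘ σ) (σ.symm j)

theorem exists_forall_dist_comp_le (x y : n → E) :
    ∃ σ : Equiv.Perm n, ∀ τ : Equiv.Perm n, dist x (y ∘ σ) ≤ dist x (y ∘ τ) := by
  classical exact Finite.exists_min _

/-- A permutation which matches the tuple `y` with the tuple `x` at the least possible distance. -/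
noncomputable def bestMatch (x y : n → E) : Equiv.Perm n :=
  (exists_forall_dist_comp_le x y).choose

theorem dist_comp_bestMatch_le (x y : n → E) (τ : Equiv.Perm n) :
    dist x (y ∘ bestMatch x y) ≤ dist x (y ∘ τ) :=
  (exists_forall_dist_comp_le x y).choose_spec τ

/-- The discrete lift of a sequence `x` of unordered tuples in which each tuple is matched optimally
with the one before. -/
noncomputable def greedyPath (x : ℕ → n → E) : ℕ → n → E
  | 0 => x 0
  | k + 1 => x (k + 1) ∘ bestMatch (greedyPath x k) (x (k + 1))

theorem exists_greedyPath_eq (x : ℕ → n → E) : ∀ k, ∃ σ : Equiv.Perm n, greedyPath x k = x k ∘ σ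
  | 0 => ⟨1, rfl⟩
  | _ + 1 => ⟨_, rfl⟩

theorem exists_dist_greedyPath_lt {x : ℕ → n → E} {k : ℕ}
    (h : ∃ σ : Equiv.Perm n, dist (x k) (z ∘ σ) < η) :
    ∃ σ : Equiv.Perm n, dist (greedyPath x k) (z ∘ σ) < η := by
  obtain ⟨σ, hσ⟩ := h
  obtain ⟨τ, hτ⟩ := exists_greedyPath_eq x k
  refine ⟨σ * τ, ?_⟩
  rwa [hτ, Equiv.Perm.coe_mul, ← Function.comp_assoc, dist_comp_perm]

omit [Fintype n] in
theorem exists_pos_forall_dist_eq_zero_of_lt [Finite n] (x : n → E) :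
    ∃ δ > 0, ∀ i j, dist (x i) (x j) < δ → dist (x i) (x j) = 0 := by
  have h : ∀ᶠ δ : ℝ in 𝓝[>] 0, ∀ i j, dist (x i) (x j) < δ → dist (x i) (x j) = 0 := by
    refine eventually_all.mpr fun i => eventually_all.mpr fun j => ?_
    rcases (dist_nonneg (x := x i) (y := x j)).eq_or_lt with h0 | hpos
    · exact Eventually.of_forall fun _ _ => h0.symm
    · filter_upwards [Ioo_mem_nhdsGT hpos] with δ hδ hlt using absurd hlt hδ.2.not_gt
  obtain ⟨δ, hsep, hδ⟩ := (h.and self_mem_nhdsWithin).exists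
  exact ⟨δ, hδ, hsep⟩

theorem dist_comp_bestMatch_lt (hz : ∀ i j, dist (z i) (z j) < 4 * η → dist (z i) (z j) = 0)
    {σ₀ : Equiv.Perm n} (hx : dist x (z ∘ σ₀) < η)
    (hy : ∃ τ : Equiv.Perm n, dist y (z ∘ τ) < η) :
    dist (y ∘ bestMatch x y) (z ∘ σ₀) < η := by
  obtain ⟨τ, hτ⟩ := hy
  set ρ := bestMatch x y
  have hyρ : dist (y ∘ ρ) (z ∘ τ ∘ ρ) < η := by
    rwa [← Function.comp_assoc, dist_comp_perm]
  have hmove : dist x (y ∘ ρ) < 2 * η :=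
    calc dist x (y ∘ ρ) ≤ dist x (y ∘ (τ⁻¹ * σ₀ : Equiv.Perm n)) := dist_comp_bestMatch_le x y _
      _ ≤ dist x (z ∘ σ₀) + dist (y ∘ (τ⁻¹ * σ₀ : Equiv.Perm n)) (z ∘ σ₀) :=
        dist_triangle_right _ _ _
      _ = dist x (z ∘ σ₀) + dist y (z ∘ τ) := by
        rw [← dist_comp_perm y (z ∘ τ) (τ⁻¹ * σ₀), Function.comp_assoc z, ← Equiv.Perm.coe_mul,
          mul_inv_cancel_left]
      _ < 2 * η := by linarith
  have hzz (j : n) : dist (z (τ (ρ j))) (z (σ₀ j)) = 0 := by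
    refine hz _ _ ((dist_le_pi_dist (z ∘ τ ∘ ρ) (z ∘ σ₀) j).trans_lt ?_)
    have := dist_triangle4 (z ∘ τ ∘ ρ) (y ∘ ρ) x (z ∘ σ₀)
    rw [dist_comm _ (y ∘ ρ), dist_comm _ x] at this
    linarith
  refine lt_of_le_of_lt ?_ hyρ
  refine (dist_pi_le_iff dist_nonneg).mpr fun j => ?_
  calc dist (y (ρ j)) (z (σ₀ j)) ≤ dist (y (ρ j)) (z (τ (ρ j))) + dist (z (τ (ρ j))) (z (σ₀ j)) :=
        dist_triangle _ _ _
    _ = dist (y (ρ j)) (z (τ (ρ j))) := by rw [hzz, add_zero]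
    _ ≤ dist (y ∘ ρ) (z ∘ τ ∘ ρ) := dist_le_pi_dist (y ∘ ρ) (z ∘ τ ∘ ρ) j

theorem dist_greedyPath_lt (hz : ∀ i j, dist (z i) (z j) < 4 * η → dist (z i) (z j) = 0)
    {x : ℕ → n → E} {k l : ℕ} (hkl : k ≤ l)
    (h : ∀ i ∈ Set.Icc k l, ∃ σ : Equiv.Perm n, dist (x i) (z ∘ σ) < η) :
    dist (greedyPath x k) (greedyPath x l) < 2 * η := by
  obtain ⟨σ₀, hσ₀⟩ := exists_dist_greedyPath_lt (h k ⟨le_rfl, hkl⟩)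
  have hl : dist (greedyPath x l) (z ∘ σ₀) < η := by
    induction l, hkl using Nat.le_induction with
    | base => exact hσ₀
    | succ l hkl ih =>
      exact dist_comp_bestMatch_lt hz (ih fun i hi => h i ⟨hi.1, hi.2.trans l.le_succ⟩)
        (h (l + 1) ⟨hkl.trans l.le_succ, le_rfl⟩)
  linarith [dist_triangle_right (greedyPath x k) (greedyPath x l) (z ∘ σ₀)]

theorem exists_tendsto_comp_perm {ι : Type*} {G : Ultrafilter ι} {y : ι → n → E}
    (h : ∀ ε > 0, ∀ᶠ i in G, ∃ σ : Equiv.Perm n, dist (y i) (x ∘ σ) < ε) :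
    ∃ ρ : Equiv.Perm n, Tendsto y G (𝓝 (x ∘ ρ)) := by
  classical
  obtain ⟨ρ, hρ⟩ : ∃ ρ, ∀ᶠ i in G, bestMatch (y i) x = ρ :=
    Ultrafilter.eventually_exists_iff.mp (Eventually.of_forall fun i => ⟨_, rfl⟩)
  refine ⟨ρ, Metric.tendsto_nhds.mpr fun ε hε => ?_⟩
  filter_upwards [h ε hε, hρ] with i ⟨σ, hσ⟩ hi
  exact hi ▸ (dist_comp_bestMatch_le (y i) x σ).trans_lt hσ

/-- The logarithm turns equidistant grids of the half-line, which have a first point, into grids of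
the line. -/
theorem exists_monotone_grids : ∃ (s : ℕ → ℕ → ℝ) (κ : ℕ → ℝ → ℕ), (∀ m, Monotone (s m)) ∧
    (∀ m, Monotone (κ m)) ∧ ∀ t, Tendsto (fun m => s m (κ m t)) atTop (𝓝 t) := by
  refine ⟨fun m k => Real.log ((k + 1) / m), fun m t => ⌊Real.exp t * m⌋₊, fun m i j hij => ?_,
    fun m t t' htt' => ?_, fun t => ?_⟩
  · rcases m.eq_zero_or_pos with rfl | hm
    · simp
    · dsimp only
      gcongr
  · dsimp only
    gcongr
  · have hexp : Tendsto (fun m : ℕ => ((⌊Real.exp t * m⌋₊ : ℝ) + 1) / m) atTop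
        (𝓝 (Real.exp t)) := by
      have hfloor := (tendsto_nat_floor_mul_div_atTop (Real.exp_pos t).le).comp
        (tendsto_natCast_atTop_atTop (R := ℝ))
      simpa only [Function.comp_apply, ← add_div, add_zero] using
        hfloor.add tendsto_one_div_atTop_nhds_zero_nat
    simpa using hexp.log (Real.exp_pos t).ne'

/-- The greedy paths along finer and finer grids have a limit along an ultrafilter. -/
theorem exists_continuous_selection (x : ℝ → n → E)
    (hx : ∀ t₀, ∀ ε > 0, ∀ᶠ t in 𝓝 t₀, ∃ σ : Equiv.Perm n, dist (x t) (x t₀ ∘ σ) < ε) :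
    ∃ y : ℝ → n → E, Continuous y ∧ ∀ t, ∃ σ : Equiv.Perm n, y t = x t ∘ σ := by
  obtain ⟨s, κ, hs, hκ, hlim⟩ := exists_monotone_grids
  let G : Ultrafilter ℕ := hyperfilter ℕ
  replace hlim (t : ℝ) : Tendsto (fun m => s m (κ m t)) G (𝓝 t) :=
    (hlim t).mono_left Nat.hyperfilter_le_atTop
  let p (m : ℕ) (t : ℝ) : n → E := greedyPath (fun k => x (s m k)) (κ m t)
  choose ρ hρ using fun t => exists_tendsto_comp_perm (G := G) (y := fun m => p m t) (x := x t)
    fun ε hε => ((hlim t).eventually (hx t ε hε)).mono fun m hm =>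
      exists_dist_greedyPath_lt (x := fun k => x (s m k)) hm
  refine ⟨fun t => x t ∘ ρ t, continuous_iff_continuousAt.mpr fun t₀ => ?_, fun t => ⟨ρ t, rfl⟩⟩
  obtain ⟨μ, hμ, hsep⟩ := exists_pos_forall_dist_eq_zero_of_lt (x t₀)
  refine Metric.tendsto_nhds.mpr fun ε hε => ?_
  obtain ⟨η, hη, hηε, hημ⟩ : ∃ η > 0, 2 * η < ε ∧ 4 * η ≤ μ :=
    ⟨min (ε / 4) (μ / 4), by positivity, by linarith [min_le_left (ε / 4) (μ / 4)],
      by linarith [min_le_right (ε / 4) (μ / 4)]⟩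
  obtain ⟨δ, hδ, hball⟩ := Metric.eventually_nhds_iff_ball.mp (hx t₀ η hη)
  have hdist {t t' : ℝ} (htt' : t ≤ t') (ht : t ∈ Metric.ball t₀ δ) (ht' : t' ∈ Metric.ball t₀ δ) :
      dist (x t ∘ ρ t) (x t' ∘ ρ t') ≤ 2 * η := by
    refine le_of_tendsto ((hρ t).dist (hρ t')) ?_
    filter_upwards [(hlim t).eventually (Metric.isOpen_ball.mem_nhds ht),
      (hlim t').eventually (Metric.isOpen_ball.mem_nhds ht')] with m hm hm'
    refine (dist_greedyPath_lt (fun i j hij => hsep i j (hij.trans_le hημ)) (hκ m htt')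
      fun i hi => hball _ ?_).le
    exact (convex_ball t₀ δ).ordConnected.out hm hm' ⟨hs m hi.1, hs m hi.2⟩
  filter_upwards [Metric.ball_mem_nhds t₀ hδ] with t ht
  rcases le_total t t₀ with htt₀ | htt₀
  · exact (hdist htt₀ ht (Metric.mem_ball_self hδ)).trans_lt hηε
  · rw [dist_comm]
    exact (hdist htt₀ (Metric.mem_ball_self hδ) ht).trans_lt hηε

end PathLifting

section Existence

variable {d : ℕ} {A A' : ℝ → Matrix (Fin d) (Fin d) ℂ}

theorem exists_contDiff_system (hH : ∀ t, (A t).IsHermitian)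
    (hA : ∀ t, HasDerivAt A (A' t) t) (hA' : Continuous A') :
    ∃ v : ℝ → Fin d → ℝ, (∀ t, IsEigenvalueTuple (A t) (v t)) ∧ ContDiff ℝ 1 v := by
  have hH' (t : ℝ) : (A' t).IsHermitian :=
    isHermitian_of_hasDerivAt (Eventually.of_forall hH) (hA t)
  choose U v v' hU using fun t => exists_diagonalizesJet (hH t) (hH' t)
  obtain ⟨y, hy, hyx⟩ := exists_continuous_selection (fun t j => (v t j, v' t j)) fun t₀ ε hε =>
    eventually_dist_comp_perm_lt_of_diagonalizesJet (hA t₀) hA'.continuousAt hU hε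
  choose σ hσ using hyx
  obtain rfl : y = fun t j => (v t (σ t j), v' t (σ t j)) := funext hσ
  have hjet (t : ℝ) := (hU t).comp_perm (σ t)
  have hv : Continuous fun t => v t ∘ σ t :=
    continuous_pi fun j => ((continuous_apply j).comp hy).fst
  have hv' : Continuous fun t => v' t ∘ σ t :=
    continuous_pi fun j => ((continuous_apply j).comp hy).snd
  have hderiv (t : ℝ) : HasDerivAt (fun t => v t ∘ σ t) (v' t ∘ σ t) t :=
    hasDerivAt_of_diagonalizesJet (hA t) hA'.continuousAt
      (Eventually.of_forall fun s => ⟨_, hjet s⟩) hv.continuousAt hv'.continuousAt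
  refine ⟨fun t => v t ∘ σ t, fun t => (hjet t).toDiagonalizes.isEigenvalueTuple,
    contDiff_one_iff_deriv.mpr ⟨fun t => (hderiv t).differentiableAt, ?_⟩⟩
  rwa [show deriv (fun t => v t ∘ σ t) = _ from funext fun t => (hderiv t).deriv]

end Existence

section ConvexFunctions

open Set

theorem eventually_eq_of_isLocalMax_of_support {f : ℝ → ℝ} {m p : ℝ} (hmax : IsLocalMax f m)
    (hp : ∀ᶠ t in 𝓝 m, f m + p * (t - m) ≤ f t) : ∀ᶠ t in 𝓝 m, f t = f m := by
  have hlin : HasDerivAt (fun t => p * (t - m)) p m := by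
    simpa using ((hasDerivAt_id m).sub_const m).const_mul p
  have hp0 : p = 0 := IsLocalMax.hasDerivAt_eq_zero (f := fun t => p * (t - m)) (by
    filter_upwards [hmax, hp] with t hle hge
    linarith [sub_self m, mul_zero p]) hlin
  filter_upwards [hmax, hp] with t hle hge
  rw [hp0, zero_mul, add_zero] at hge
  exact le_antisymm hle hge

theorem nonpos_of_forall_exists_support {f : ℝ → ℝ} {x z : ℝ} (hf : ContinuousOn f (Icc x z))
    (hx : f x ≤ 0) (hz : f z ≤ 0)
    (h : ∀ m ∈ Ioo x z, ∃ p, ∀ᶠ t in 𝓝 m, f m + p * (t - m) ≤ f t) {y : ℝ} (hy : y ∈ Icc x z) :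
    f y ≤ 0 := by
  by_contra! hpos
  obtain ⟨c, hc, hmax⟩ := isCompact_Icc.exists_isMaxOn ⟨y, hy⟩ hf
  have hfc : 0 < f c := hpos.trans_le (hmax hy)
  -- At the leftmost maximum point `m` the function would be locally constant.
  obtain ⟨m, ⟨hm, hmc⟩, hleast⟩ :=
    (isCompact_Icc.of_isClosed_subset (hf.preimage_isClosed_of_isClosed isClosed_Icc
      (isClosed_singleton (x := f c))) inter_subset_left).exists_isLeast ⟨c, hc, rfl⟩
  have hmc : f m = f c := hmc
  have hxm : x < m := lt_of_le_of_ne hm.1 fun e => by rw [← e] at hmc; linarith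
  have hmz : m < z := lt_of_le_of_ne hm.2 fun e => by rw [e] at hmc; linarith
  have hIcc : Icc x z ∈ 𝓝 m := Icc_mem_nhds hxm hmz
  have hlocal : IsLocalMax f m := by
    filter_upwards [hIcc] with t ht
    exact hmc ▸ hmax ht
  obtain ⟨p, hp⟩ := h m ⟨hxm, hmz⟩
  have hconst : ∀ᶠ t in 𝓝[<] m, f t = f m ∧ t ∈ Icc x z :=
    nhdsWithin_le_nhds ((eventually_eq_of_isLocalMax_of_support hlocal hp).and hIcc)
  obtain ⟨t, ⟨hft, ht⟩, htm⟩ := (hconst.and self_mem_nhdsWithin).exists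
  exact (hleast ⟨ht, hft.trans hmc⟩).not_gt htm

theorem convexOn_of_forall_exists_support {Ω : Set ℝ} (hΩ : Convex ℝ Ω) {f : ℝ → ℝ}
    (hf : ContinuousOn f Ω)
    (h : ∀ t₀ ∈ Ω, ∃ p, ∀ᶠ t in 𝓝 t₀, f t₀ + p * (t - t₀) ≤ f t) : ConvexOn ℝ Ω f := by
  refine convexOn_of_slope_mono_adjacent hΩ fun {x y z} hx hz hxy hyz => ?_
  have hsub : Icc x z ⊆ Ω := hΩ.ordConnected.out hx hz
  have hxz : 0 < z - x := sub_pos.mpr (hxy.trans hyz)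
  set q := (f z - f x) / (z - x)
  have hqz : q * (z - x) = f z - f x := div_mul_cancel₀ _ hxz.ne'
  have hchord : f y - f x - q * (y - x) ≤ 0 := by
    refine nonpos_of_forall_exists_support (f := fun t => f t - f x - q * (t - x)) (x := x) (z := z)
      (((hf.mono hsub).sub continuousOn_const).sub (by fun_prop)) (by simp) (by linarith)
      (fun m hm => ?_) ⟨hxy.le, hyz.le⟩
    obtain ⟨p, hp⟩ := h m (hsub (Ioo_subset_Icc_self hm))
    refine ⟨p - q, hp.mono fun t ht => ?_⟩
    linarith
  calc (f y - f x) / (y - x) ≤ q := by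
        rw [div_le_iff₀ (sub_pos.mpr hxy)]; linarith
    _ ≤ (f z - f y) / (z - y) := by
        rw [le_div_iff₀ (sub_pos.mpr hyz)]; linarith

theorem add_mul_sub_le_of_monotoneOn_derivative {Ω : Set ℝ} (hΩ : Convex ℝ Ω) {f f' : ℝ → ℝ}
    (hf : ∀ t ∈ Ω, HasDerivAt f (f' t) t) (hf' : MonotoneOn f' Ω) {s t : ℝ} (hs : s ∈ Ω)
    (ht : t ∈ Ω) : f s + f' s * (t - s) ≤ f t := by
  have hderiv : EqOn (deriv f) f' (interior Ω) := fun x hx => (hf x (interior_subset hx)).deriv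
  have hconvex : ConvexOn ℝ Ω f := MonotoneOn.convexOn_of_deriv hΩ
    (fun x hx => (hf x hx).continuousAt.continuousWithinAt)
    (fun x hx => (hf x (interior_subset hx)).differentiableAt.differentiableWithinAt)
    ((hf'.mono interior_subset).congr hderiv.symm)
  rcases lt_trichotomy s t with hst | rfl | hst
  · have := hconvex.le_slope_of_hasDerivAt hs ht hst (hf s hs)
    rw [slope_def_field, le_div_iff₀ (sub_pos.mpr hst)] at this
    linarith
  · simp
  · have := hconvex.slope_le_of_hasDerivAt ht hs hst (hf s hs)
    rw [slope_def_field, div_le_iff₀ (sub_pos.mpr hst)] at this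
    linarith

theorem abs_sub_sub_mul_le_of_majorant {Ω : Set ℝ} (hΩ : Convex ℝ Ω) {f f' Ψ ψ : ℝ → ℝ}
    (hf : ∀ t ∈ Ω, HasDerivAt f (f' t) t) (hΨ : ∀ t ∈ Ω, HasDerivAt Ψ (ψ t) t)
    (h : ∀ s ∈ Ω, ∀ t ∈ Ω, s ≤ t → |f' t - f' s| ≤ ψ t - ψ s) {s t : ℝ} (hs : s ∈ Ω) (ht : t ∈ Ω) :
    |f t - f s - f' s * (t - s)| ≤ Ψ t - Ψ s - ψ s * (t - s) := by
  have hsub := add_mul_sub_le_of_monotoneOn_derivative hΩ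
    (fun x hx => (hΨ x hx).sub (hf x hx)) (fun x hx y hy hxy => by
      linarith [(abs_le.mp (h x hx y hy hxy)).2] : MonotoneOn (fun x => ψ x - f' x) Ω) hs ht
  have hadd := add_mul_sub_le_of_monotoneOn_derivative hΩ
    (fun x hx => (hΨ x hx).add (hf x hx)) (fun x hx y hy hxy => by
      linarith [(abs_le.mp (h x hx y hy hxy)).1] : MonotoneOn (fun x => ψ x + f' x) Ω) hs ht
  simp only [Pi.sub_apply, Pi.add_apply] at hsub hadd
  rw [abs_le]
  constructor <;> linarith

end ConvexFunctions

section LuzinProperty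

open Set MeasureTheory

theorem dist_le_dist_of_abs_sub_le {f Θ : ℝ → ℝ} {S : Set ℝ}
    (h : ∀ s ∈ S, ∀ t ∈ S, s ≤ t → |f t - f s| ≤ Θ t - Θ s) :
    ∀ s ∈ S, ∀ t ∈ S, dist (f s) (f t) ≤ dist (Θ s) (Θ t) := by
  intro s hs t ht
  wlog hst : s ≤ t generalizing s t
  · rw [dist_comm, dist_comm (Θ s)]
    exact this t ht s hs (le_of_not_ge hst)
  rw [dist_comm, dist_comm (Θ s)]
  exact (h s hs t ht hst).trans (le_abs_self _)

theorem hausdorffMeasure_image_le_of_dist_le {α X Y : Type*} [Nonempty α] [MetricSpace X]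
    [MeasurableSpace X] [BorelSpace X] [MetricSpace Y] [MeasurableSpace Y] [BorelSpace Y]
    {f : α → X} {g : α → Y} {S : Set α}
    (h : ∀ s ∈ S, ∀ t ∈ S, dist (f s) (f t) ≤ dist (g s) (g t)) {d : ℝ} (hd : 0 ≤ d) :
    Measure.hausdorffMeasure d (f '' S) ≤ Measure.hausdorffMeasure d (g '' S) := by
  set r := Function.invFunOn g S
  have hr : ∀ s ∈ S, r (g s) ∈ S := fun s hs => Function.invFunOn_apply_mem hs
  have hgr : ∀ s ∈ S, g (r (g s)) = g s := fun s hs => Function.invFunOn_apply_eq hs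
  have hfr : ∀ s ∈ S, f (r (g s)) = f s := fun s hs => dist_le_zero.mp (by
    simpa [hgr s hs] using h _ (hr s hs) s hs)
  have hlip : LipschitzOnWith 1 (f ∘ r) (g '' S) := by
    refine LipschitzOnWith.of_dist_le_mul ?_
    rintro _ ⟨s, hs, rfl⟩ _ ⟨t, ht, rfl⟩
    simpa [hfr s hs, hfr t ht] using h s hs t ht
  have himage : (f ∘ r) '' (g '' S) = f '' S := by
    rw [image_image]
    exact image_congr hfr
  simpa only [himage, NNReal.coe_one, ENNReal.coe_one, ENNReal.one_rpow, one_mul] using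
    hlip.hausdorffMeasure_image_le hd

theorem intervalIntegrable_of_locallyIntegrable {W : ℝ → ℝ} (hW : LocallyIntegrable W) (a b : ℝ) :
    IntervalIntegrable W volume a b :=
  intervalIntegrable_iff.mpr
    ((hW.integrableOn_isCompact isCompact_uIcc).mono_set uIoc_subset_uIcc)

theorem volume_image_primitive_eq_zero {W : ℝ → ℝ} (hW : LocallyIntegrable W) (h0 : ∀ x, 0 < W x)
    {N : Set ℝ} (hN : volume N = 0) : volume ((fun t => ∫ x in (0 : ℝ)..t, W x) '' N) = 0 := by
  set Θ : ℝ → ℝ := fun t => ∫ x in (0 : ℝ)..t, W x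
  have hint := intervalIntegrable_of_locallyIntegrable hW
  have hc : Continuous Θ := intervalIntegral.continuous_primitive hint 0
  have hsub : ∀ s t, Θ t - Θ s = ∫ x in s..t, W x := fun s t =>
    intervalIntegral.integral_interval_sub_left (hint _ _) (hint _ _)
  have hmono : StrictMono Θ := fun s t hst => by
    rw [← sub_pos, hsub]
    exact intervalIntegral.intervalIntegral_pos_of_pos (hint _ _) h0 hst
  have hemb : MeasurableEmbedding Θ := hc.measurableEmbedding hmono.injective
  have himage : ∀ a b, a < b → Θ '' Ioc a b = Ioc (Θ a) (Θ b) := fun a b hab =>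
    hc.continuousOn.image_Ioc_of_strictMonoOn hab.le (hmono.strictMonoOn _)
  -- `Θ` pulls Lebesgue measure back to the measure with density `W`.
  have hcomap : volume.withDensity (fun x => ENNReal.ofReal (W x)) = volume.comap Θ := by
    have hIoc : ∀ a b, a < b → volume.withDensity (fun x => ENNReal.ofReal (W x)) (Ioc a b) =
        ENNReal.ofReal (Θ b - Θ a) := fun a b hab => by
      rw [withDensity_apply _ measurableSet_Ioc, hsub, intervalIntegral.integral_of_le hab.le,
        ofReal_integral_eq_lintegral_ofReal
          ((intervalIntegrable_iff_integrableOn_Ioc_of_le hab.le).mp (hint a b))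
          (Eventually.of_forall fun x => (h0 x).le)]
    refine Measure.ext_of_Ioc' _ _ (fun a b hab => ?_) fun a b hab => ?_
    · exact hIoc a b hab ▸ ENNReal.ofReal_ne_top
    · rw [hIoc a b hab, hemb.comap_apply, himage a b hab, Real.volume_Ioc]
  rw [← hemb.comap_apply, ← hcomap]
  exact withDensity_absolutelyContinuous _ _ hN

theorem volume_image_eq_zero_of_dominated {f W : ℝ → ℝ} (hW : LocallyIntegrable W)
    (h0 : ∀ x, 0 ≤ W x) {S : Set ℝ}
    (hf : ∀ s ∈ S, ∀ t ∈ S, s ≤ t → |f t - f s| ≤ ∫ x in s..t, W x) (hS : volume S = 0) :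
    volume (f '' S) = 0 := by
  have hW1 : LocallyIntegrable (fun x => W x + 1) := hW.add (locallyIntegrable_const 1)
  have hint := intervalIntegrable_of_locallyIntegrable hW
  have hint1 := intervalIntegrable_of_locallyIntegrable hW1
  have hdom : ∀ s ∈ S, ∀ t ∈ S, s ≤ t →
      |f t - f s| ≤ (∫ x in (0 : ℝ)..t, (W x + 1)) - ∫ x in (0 : ℝ)..s, (W x + 1) :=
    fun s hs t ht hst => by
      rw [intervalIntegral.integral_interval_sub_left (hint1 _ _) (hint1 _ _)]
      exact (hf s hs t ht hst).trans (intervalIntegral.integral_mono_on hst (hint _ _) (hint1 _ _)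
        fun x _ => by linarith)
  have hle := hausdorffMeasure_image_le_of_dist_le (dist_le_dist_of_abs_sub_le hdom) zero_le_one
  rw [hausdorffMeasure_real, volume_image_primitive_eq_zero hW1 (fun x => by linarith [h0 x]) hS]
    at hle
  exact nonpos_iff_eq_zero.mp hle

theorem measure_image_eq_zero_of_forall_nhdsWithin {X Y : Type*} [TopologicalSpace X]
    [SecondCountableTopology X] [MeasurableSpace Y] {μ : Measure Y} {f : X → Y} {S : Set X}
    (h : ∀ t ∈ S, ∃ u ∈ 𝓝[S] t, μ (f '' u) = 0) : μ (f '' S) = 0 := by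
  choose! u hu hu0 using h
  obtain ⟨C, hCS, hC, hcov⟩ := TopologicalSpace.countable_cover_nhdsWithin hu
  refine measure_mono_null (image_mono hcov) ?_
  rw [image_iUnion₂]
  exact (measure_biUnion_null_iff hC).mpr fun t ht => hu0 t (hCS ht)

end LuzinProperty

section AbsoluteContinuity

open Set MeasureTheory

theorem absolutelyContinuousOnInterval_of_dist_le {X Y : Type*} [PseudoMetricSpace X]
    [PseudoMetricSpace Y] {f : ℝ → X} {g : ℝ → Y} {a b : ℝ}
    (hg : AbsolutelyContinuousOnInterval g a b)
    (h : ∀ s ∈ uIcc a b, ∀ t ∈ uIcc a b, dist (f s) (f t) ≤ dist (g s) (g t)) :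
    AbsolutelyContinuousOnInterval f a b := by
  rw [absolutelyContinuousOnInterval_iff] at hg ⊢
  intro ε hε
  obtain ⟨δ, hδ, hlt⟩ := hg ε hε
  refine ⟨δ, hδ, fun E hE hE' => (Finset.sum_le_sum fun i hi => ?_).trans_lt (hlt E hE hE')⟩
  exact h _ (hE.1 i hi).1 _ (hE.1 i hi).2

theorem absolutelyContinuousOnInterval_of_dominated {f W : ℝ → ℝ} {a b : ℝ} (hab : a ≤ b)
    (hW : IntervalIntegrable W volume a b)
    (h : ∀ s ∈ Icc a b, ∀ t ∈ Icc a b, s ≤ t → |f t - f s| ≤ ∫ x in s..t, W x) :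
    AbsolutelyContinuousOnInterval f a b := by
  have hint : ∀ s ∈ Icc a b, IntervalIntegrable W volume a s := fun s hs =>
    hW.mono_set (uIcc_subset_uIcc left_mem_uIcc (Icc_subset_uIcc hs))
  refine absolutelyContinuousOnInterval_of_dist_le
    (hW.absolutelyContinuousOnInterval_intervalIntegral (c := a) left_mem_uIcc) ?_
  rw [uIcc_of_le hab]
  refine dist_le_dist_of_abs_sub_le fun s hs t ht hst => ?_
  rw [intervalIntegral.integral_interval_sub_left (hint t ht) (hint s hs)]
  exact h s hs t ht hst

theorem boundedVariationOn_of_dist_le {α X Y : Type*} [LinearOrder α] [PseudoMetricSpace X]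
    [PseudoMetricSpace Y] {f : α → X} {g : α → Y} {S : Set α} (hg : BoundedVariationOn g S)
    (h : ∀ s ∈ S, ∀ t ∈ S, dist (f s) (f t) ≤ dist (g s) (g t)) : BoundedVariationOn f S := by
  refine ne_top_of_le_ne_top hg (iSup_mono fun p => Finset.sum_le_sum fun i _ => ?_)
  rw [edist_dist, edist_dist]
  exact ENNReal.ofReal_le_ofReal (h _ (p.2.2.2 _) _ (p.2.2.2 _))

theorem boundedVariationOn_of_majorant {f K : ℝ → ℝ} {a b : ℝ} (hab : a ≤ b)
    (hK : ∀ s ∈ Icc a b, ∀ t ∈ Icc a b, s ≤ t → |f t - f s| ≤ K t - K s) :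
    BoundedVariationOn f (Icc a b) := by
  have hmono : MonotoneOn K (Icc a b) := fun s hs t ht hst => by
    linarith [(abs_nonneg _).trans (hK s hs t ht hst)]
  refine boundedVariationOn_of_dist_le (g := K) ?_ (dist_le_dist_of_abs_sub_le hK)
  simpa only [inter_self] using
    hmono.locallyBoundedVariationOn a b (left_mem_Icc.mpr hab) (right_mem_Icc.mpr hab)

theorem abs_sub_le_integral_abs_deriv_of_luzin {f : ℝ → ℝ} {s t : ℝ} (hst : s ≤ t)
    (hf : ContinuousOn f (Icc s t)) (hbv : BoundedVariationOn f (Icc s t))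
    (hN : ∀ N ⊆ Icc s t, volume N = 0 → volume (f '' N) = 0) :
    |f t - f s| ≤ ∫ x in s..t, |deriv f x| := by
  rw [← uIcc_of_le hst] at hbv
  set D : Set ℝ := Icc s t ∩ {x | DifferentiableAt ℝ f x}
  have hD : MeasurableSet D := measurableSet_Icc.inter (measurableSet_of_differentiableAt ℝ f)
  have hnull : volume (f '' (Icc s t \ D)) = 0 := by
    refine hN _ sdiff_subset ?_
    rw [measure_eq_zero_iff_ae_notMem]
    filter_upwards [hbv.ae_differentiableAt_of_mem_uIcc] with x hx hmem
    exact hmem.2 ⟨hmem.1, hx (Icc_subset_uIcc hmem.1)⟩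
  have hdiff : volume (f '' D) ≤ ∫⁻ x in D, ENNReal.ofReal |deriv f x| := by
    simpa only [ContinuousLinearMap.det_toSpanSingleton] using
      addHaar_image_le_lintegral_abs_det_fderiv volume hD (f := f)
        (f' := fun x => ContinuousLinearMap.toSpanSingleton ℝ (deriv f x))
        fun x hx => hx.2.hasDerivAt.hasFDerivAt.hasFDerivWithinAt
  have hivt : uIcc (f s) (f t) ⊆ f '' Icc s t := by
    rw [← uIcc_of_le hst] at hf ⊢
    exact intermediate_value_uIcc hf
  have hint : IntegrableOn (fun x => |deriv f x|) (Ioc s t) :=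
    (intervalIntegrable_iff_integrableOn_Ioc_of_le hst).mp hbv.intervalIntegrable_deriv.abs
  refine (ENNReal.ofReal_le_ofReal_iff
    (intervalIntegral.integral_nonneg hst fun x _ => abs_nonneg _)).mp ?_
  calc ENNReal.ofReal |f t - f s| = volume (uIcc (f s) (f t)) := Real.volume_interval.symm
    _ ≤ volume (f '' Icc s t) :=
        measure_mono hivt
    _ ≤ volume (f '' D) + volume (f '' (Icc s t \ D)) := by
        refine (measure_mono ?_).trans (measure_union_le _ _)
        rw [← image_union, union_sdiff_cancel inter_subset_left]
    _ ≤ ∫⁻ x in D, ENNReal.ofReal |deriv f x| := by rwa [hnull, add_zero]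
    _ ≤ ∫⁻ x in Ioc s t, ENNReal.ofReal |deriv f x| := by
        rw [restrict_Ioc_eq_restrict_Icc]
        exact lintegral_mono_set inter_subset_left
    _ = ENNReal.ofReal (∫ x in s..t, |deriv f x|) := by
        rw [intervalIntegral.integral_of_le hst,
          ofReal_integral_eq_lintegral_ofReal hint (Eventually.of_forall fun x => abs_nonneg _)]

/-- The Banach–Zarecki theorem. -/
theorem absolutelyContinuousOnInterval_of_luzin {f : ℝ → ℝ} {a b : ℝ} (hab : a ≤ b)
    (hf : ContinuousOn f (Icc a b)) (hbv : BoundedVariationOn f (Icc a b))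
    (hN : ∀ N ⊆ Icc a b, volume N = 0 → volume (f '' N) = 0) :
    AbsolutelyContinuousOnInterval f a b := by
  refine absolutelyContinuousOnInterval_of_dominated hab (W := fun x => |deriv f x|)
    (BoundedVariationOn.intervalIntegrable_deriv (by rwa [uIcc_of_le hab])).abs
    fun s hs t ht hst => ?_
  have hsub : Icc s t ⊆ Icc a b := Icc_subset_Icc hs.1 ht.2
  exact abs_sub_le_integral_abs_deriv_of_luzin hst (hf.mono hsub) (hbv.mono hsub)
    fun N hN' => hN N (hN'.trans hsub)

theorem abs_deriv_le_of_majorant {f K : ℝ → ℝ} {f' K' x : ℝ} (hf : HasDerivAt f f' x)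
    (hK : HasDerivAt K K' x) (h : ∀ᶠ y in 𝓝[>] x, |f y - f x| ≤ K y - K x) : |f'| ≤ K' := by
  refine le_of_tendsto_of_tendsto
    ((hasDerivAt_iff_tendsto_slope.mp hf).abs.mono_left (nhdsGT_le_nhdsNE x))
    ((hasDerivAt_iff_tendsto_slope.mp hK).mono_left (nhdsGT_le_nhdsNE x)) ?_
  filter_upwards [h, self_mem_nhdsWithin] with y hy hxy
  have hxy : 0 < y - x := sub_pos.mpr hxy
  rw [slope_def_field, slope_def_field, abs_div, abs_of_pos hxy]
  exact div_le_div_of_nonneg_right hy hxy.le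

section

variable {E : Type*} [NormedAddCommGroup E] [NormedSpace ℝ E]

/-- On the interval `Ω`, the function `u` is a primitive of the locally integrable function `v` in
the sense of Lebesgue integration, that is, a locally absolutely continuous function with
derivative `v` almost everywhere. -/
structure IsPrimitiveOn (Ω : Set ℝ) (u v : ℝ → E) : Prop where
  intervalIntegrable : ∀ s ∈ Ω, ∀ t ∈ Ω, IntervalIntegrable v volume s t
  sub_eq_integral : ∀ s ∈ Ω, ∀ t ∈ Ω, u t - u s = ∫ x in s..t, v x

namespace IsPrimitiveOn

variable {Ω Ω' : Set ℝ} {u v : ℝ → E} {s t : ℝ}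

theorem mono (h : IsPrimitiveOn Ω u v) (hsub : Ω' ⊆ Ω) : IsPrimitiveOn Ω' u v where
  intervalIntegrable s hs t ht := h.intervalIntegrable s (hsub hs) t (hsub ht)
  sub_eq_integral s hs t ht := h.sub_eq_integral s (hsub hs) t (hsub ht)

theorem ae_hasDerivAt [CompleteSpace E] (h : IsPrimitiveOn (Icc s t) u v) (hst : s ≤ t) :
    ∀ᵐ x, x ∈ Ioo s t → HasDerivAt u (v x) x := by
  have hs : s ∈ Icc s t := left_mem_Icc.mpr hst
  filter_upwards [(h.intervalIntegrable s hs t (right_mem_Icc.mpr hst)).ae_hasDerivAt_integral]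
    with x hx hxst
  refine ((hx (Icc_subset_uIcc (Ioo_subset_Icc_self hxst)) s left_mem_uIcc).add_const
    (u s)).congr_of_eventuallyEq ?_
  filter_upwards [Icc_mem_nhds hxst.1 hxst.2] with y hy
  rw [← h.sub_eq_integral s hs y hy, sub_add_cancel]

end IsPrimitiveOn

end

theorem isPrimitiveOn_deriv_of_absolutelyContinuousOnInterval {Ω : Set ℝ} {u : ℝ → ℝ}
    (h : ∀ a ∈ Ω, ∀ b ∈ Ω, a ≤ b → AbsolutelyContinuousOnInterval u a b) :
    IsPrimitiveOn Ω u (deriv u) where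
  intervalIntegrable a ha b hb := by
    rcases le_total a b with hab | hba
    · exact (h a ha b hb hab).intervalIntegrable_deriv
    · exact (h b hb a ha hba).intervalIntegrable_deriv.symm
  sub_eq_integral a ha b hb := by
    rcases le_total a b with hab | hba
    · exact (h a ha b hb hab).integral_deriv_eq_sub.symm
    · rw [intervalIntegral.integral_symm, (h b hb a ha hba).integral_deriv_eq_sub, neg_sub]

theorem lintegral_enorm_Ioc_le_of_majorant {f g K : ℝ → ℝ} {s t : ℝ} (hst : s ≤ t)
    (hfg : IsPrimitiveOn (Icc s t) f g)
    (hK : ∀ x ∈ Icc s t, ∀ y ∈ Icc s t, x ≤ y → |f y - f x| ≤ K y - K x) :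
    ∫⁻ x in Ioc s t, ‖g x‖ₑ ≤ ENNReal.ofReal (K t - K s) := by
  have hmono : MonotoneOn K (uIcc s t) := by
    rw [uIcc_of_le hst]
    exact fun x hx y hy hxy => by linarith [(abs_nonneg _).trans (hK x hx y hy hxy)]
  have hint := hmono.intervalIntegrable_deriv
  have hle := hmono.intervalIntegral_deriv_mem_uIcc
  rw [uIcc_of_le (sub_nonneg.mpr (hmono left_mem_uIcc right_mem_uIcc hst))] at hle
  have hae : ∀ᵐ x, x ∈ Ioc s t → |g x| ≤ deriv K x := by
    filter_upwards [hmono.ae_differentiableWithinAt_of_mem, hfg.ae_hasDerivAt hst,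
      Measure.ae_ne volume t] with x hKx hfx hxt hx
    have hx' : x ∈ Ioo s t := ⟨hx.1, lt_of_le_of_ne hx.2 hxt⟩
    have hnhds : Icc s t ∈ 𝓝 x := Icc_mem_nhds hx'.1 hx'.2
    refine abs_deriv_le_of_majorant (hfx hx') ((hKx (Icc_subset_uIcc
      (Ioc_subset_Icc_self hx))).differentiableAt (uIcc_of_le hst ▸ hnhds)).hasDerivAt ?_
    filter_upwards [self_mem_nhdsWithin, mem_nhdsWithin_of_mem_nhds hnhds] with y hxy hy
    exact hK x (Ioc_subset_Icc_self hx) y hy (le_of_lt hxy)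
  have hnonneg : 0 ≤ᵐ[volume.restrict (Ioc s t)] deriv K :=
    (ae_restrict_iff' measurableSet_Ioc).mpr
      (hae.mono fun x hx hxI => (abs_nonneg _).trans (hx hxI))
  calc ∫⁻ x in Ioc s t, ‖g x‖ₑ ≤ ∫⁻ x in Ioc s t, ENNReal.ofReal (deriv K x) :=
        setLIntegral_mono_ae' measurableSet_Ioc (hae.mono fun x hx hxI => by
          rw [Real.enorm_eq_ofReal_abs]
          exact ENNReal.ofReal_le_ofReal (hx hxI))
    _ = ENNReal.ofReal (∫ x in s..t, deriv K x) := by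
        rw [intervalIntegral.integral_of_le hst, ofReal_integral_eq_lintegral_ofReal
          ((intervalIntegrable_iff_integrableOn_Ioc_of_le hst).mp hint) hnonneg]
    _ ≤ ENNReal.ofReal (K t - K s) := ENNReal.ofReal_le_ofReal hle.2

theorem setLIntegral_Ioo_le_of_forall_Ioc {g : ℝ → ENNReal} {a b : ℝ} {C : ENNReal}
    (h : ∀ s ∈ Ioo a b, ∀ t ∈ Ioo a b, s ≤ t → ∫⁻ x in Ioc s t, g x ≤ C) :
    ∫⁻ x in Ioo a b, g x ≤ C := by
  rcases le_or_gt b a with hab | hab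
  · simp [Ioo_eq_empty hab.not_gt]
  obtain ⟨u, hu_anti, hu_mem, hu_lim⟩ := exists_seq_strictAnti_tendsto' hab
  obtain ⟨v, hv_mono, hv_mem, hv_lim⟩ := exists_seq_strictMono_tendsto' hab
  have hunion : Ioo a b = ⋃ n, Ioc (u n) (v n) := by
    refine Subset.antisymm (fun x hx => ?_) (iUnion_subset fun n x hx =>
      ⟨(hu_mem n).1.trans hx.1, hx.2.trans_lt (hv_mem n).2⟩)
    obtain ⟨n, hun, hvn⟩ := ((hu_lim.eventually (gt_mem_nhds hx.1)).and
      (hv_lim.eventually (lt_mem_nhds hx.2))).exists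
    exact mem_iUnion.mpr ⟨n, hun, hvn.le⟩
  rw [hunion, setLIntegral_iUnion_of_directed]
  · refine iSup_le fun n => ?_
    rcases le_total (u n) (v n) with hle | hle
    · exact h _ (hu_mem n) _ (hv_mem n) hle
    · simp [Ioc_eq_empty hle.not_gt]
  · exact directed_of_isDirected_le fun m n hmn =>
      Ioc_subset_Ioc (hu_anti.antitone hmn) (hv_mono.monotone hmn)

theorem lintegral_enorm_Ioo_le_of_majorant {f g K : ℝ → ℝ} {a b C : ℝ}
    (hfg : IsPrimitiveOn (Ioo a b) f g)
    (hK : ∀ s ∈ Ioo a b, ∀ t ∈ Ioo a b, s ≤ t → |f t - f s| ≤ K t - K s)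
    (hC : ∀ s ∈ Ioo a b, ∀ t ∈ Ioo a b, s ≤ t → K t - K s ≤ C) :
    ∫⁻ x in Ioo a b, ‖g x‖ₑ ≤ ENNReal.ofReal C := by
  refine setLIntegral_Ioo_le_of_forall_Ioc fun s hs t ht hst => ?_
  have hsub : Icc s t ⊆ Ioo a b := fun x hx => ⟨hs.1.trans_le hx.1, hx.2.trans_lt ht.2⟩
  exact (lintegral_enorm_Ioc_le_of_majorant hst (hfg.mono hsub)
    fun x hx y hy hxy => hK x (hsub hx) y (hsub hy) hxy).trans
      (ENNReal.ofReal_le_ofReal (hC s hs t ht hst))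

end AbsoluteContinuity

section Rearrangement

variable {𝕜 n : Type*} [RCLike 𝕜] [Fintype n] [DecidableEq n] {U V A : Matrix n n 𝕜} {v w : n → ℝ}

theorem norm_conjTranspose_mul_mul_apply_le (hV : Vᴴ * V = 1) (hU : Uᴴ * U = 1)
    (M : Matrix n n 𝕜) (i j : n) : ‖(Vᴴ * M * U) i j‖ ≤ ∑ k, ∑ l, ‖M k l‖ := by
  simp only [Matrix.mul_apply, Finset.sum_mul]
  rw [Finset.sum_comm]
  refine (norm_sum_le _ _).trans (Finset.sum_le_sum fun k _ => (norm_sum_le _ _).trans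
    (Finset.sum_le_sum fun l _ => ?_))
  rw [norm_mul, norm_mul, conjTranspose_apply, norm_star]
  calc ‖V k i‖ * ‖M k l‖ * ‖U l j‖ ≤ 1 * ‖M k l‖ * 1 := by
        gcongr
        · exact entry_norm_bound_of_unitary (mem_unitaryGroup_iff'.mpr hV) k i
        · exact entry_norm_bound_of_unitary (mem_unitaryGroup_iff'.mpr hU) l j
    _ = ‖M k l‖ := by ring

theorem conjTranspose_mul_self_conjTranspose_mul (hV : Vᴴ * V = 1) (hU : Uᴴ * U = 1) :
    (Vᴴ * U)ᴴ * (Vᴴ * U) = 1 := by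
  rw [Matrix.conjTranspose_mul, conjTranspose_conjTranspose, Matrix.mul_assoc,
    ← Matrix.mul_assoc V, mul_eq_one_comm.mp hV, Matrix.one_mul, hU]

theorem of_norm_sq_mem_doublyStochastic (hU : Uᴴ * U = 1) :
    Matrix.of (fun i j => ‖U i j‖ ^ 2) ∈ doublyStochastic ℝ n := by
  rw [mem_doublyStochastic_iff_sum]
  refine ⟨fun i j => sq_nonneg _, fun i => ?_, fun j => ?_⟩
  · have h := congr_fun₂ (mul_eq_one_comm.mp hU : U * Uᴴ = 1) i i
    simp only [Matrix.mul_apply, one_apply_eq, conjTranspose_apply, RCLike.star_def,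
      RCLike.mul_conj] at h
    exact_mod_cast h
  · have h := congr_fun₂ hU j j
    simp only [Matrix.mul_apply, one_apply_eq, conjTranspose_apply, RCLike.star_def,
      RCLike.conj_mul] at h
    exact_mod_cast h

theorem dotProduct_mulVec_le_of_mem_doublyStochastic {P : Matrix n n ℝ}
    (hP : P ∈ doublyStochastic ℝ n) (hw : Monovary w v) : w ⬝ᵥ (P *ᵥ v) ≤ w ⬝ᵥ v := by
  obtain ⟨c, hc0, hc1, rfl⟩ := exists_eq_sum_perm_of_mem_doublyStochastic hP
  calc w ⬝ᵥ ((∑ σ, c σ • σ.permMatrix ℝ) *ᵥ v)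
      = ∑ σ : Equiv.Perm n, c σ * (w ⬝ᵥ (v ∘ σ)) := by
        simp only [sum_mulVec, smul_mulVec, permMatrix_mulVec, dotProduct_sum, dotProduct_smul,
          smul_eq_mul]
    _ ≤ ∑ σ : Equiv.Perm n, c σ * (w ⬝ᵥ v) :=
        Finset.sum_le_sum fun σ _ =>
          mul_le_mul_of_nonneg_left hw.sum_mul_comp_perm_le_sum_mul (hc0 σ)
    _ = w ⬝ᵥ v := by rw [← Finset.sum_mul, hc1, one_mul]

theorem Diagonalizes.re_conjTranspose_mul_mul_apply_self_eq_mulVec (h : Diagonalizes U A v)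
    (V : Matrix n n 𝕜) :
    (fun i => RCLike.re ((Vᴴ * A * V) i i)) = Matrix.of (fun i j => ‖(Vᴴ * U) i j‖ ^ 2) *ᵥ v := by
  have hconj : Vᴴ * A * V = Vᴴ * U * diagonal (fun j => (v j : 𝕜)) * (Vᴴ * U)ᴴ := by
    rw [Matrix.conjTranspose_mul, conjTranspose_conjTranspose, Matrix.mul_assoc Vᴴ U, ← h.mul_eq]
    calc Vᴴ * A * V = Vᴴ * A * (U * Uᴴ) * V := by rw [h.mul_conjTranspose_self, Matrix.mul_one]
      _ = Vᴴ * (A * U) * (Uᴴ * V) := by simp only [Matrix.mul_assoc]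
  funext i
  simp only [mulVec, dotProduct, of_apply, hconj]
  rw [Matrix.mul_apply, map_sum]
  refine Finset.sum_congr rfl fun l _ => ?_
  rw [mul_diagonal, conjTranspose_apply, mul_right_comm, RCLike.star_def, RCLike.mul_conj]
  norm_cast

theorem Diagonalizes.dotProduct_re_conjTranspose_mul_mul_le (h : Diagonalizes U A v)
    (hV : Vᴴ * V = 1) (hw : Monovary w v) :
    (w ⬝ᵥ fun i => RCLike.re ((Vᴴ * A * V) i i)) ≤ w ⬝ᵥ v := by
  rw [h.re_conjTranspose_mul_mul_apply_self_eq_mulVec]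
  exact dotProduct_mulVec_le_of_mem_doublyStochastic
    (of_norm_sq_mem_doublyStochastic
      (conjTranspose_mul_self_conjTranspose_mul hV h.conjTranspose_mul_self)) hw

end Rearrangement

section Spread

variable {n : Type*} [Fintype n]

/-- The sum of the distances between all pairs of entries of `x`. -/
def spread (x : n → ℝ) : ℝ :=
  ∑ i, ∑ l, |x i - x l|

/-- A subgradient of the convex function `spread` at `x`. It is ordered as the entries of `x`. -/
noncomputable def spreadSubgradient (x : n → ℝ) (i : n) : ℝ :=
  2 * ∑ l, (SignType.sign (x i - x l) : ℝ)

theorem spreadSubgradient_dotProduct (x y : n → ℝ) :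
    spreadSubgradient x ⬝ᵥ y = ∑ i, ∑ l, (SignType.sign (x i - x l) : ℝ) * (y i - y l) := by
  have hswap : ∑ i, ∑ l, (SignType.sign (x i - x l) : ℝ) * y l =
      -∑ i, ∑ l, (SignType.sign (x i - x l) : ℝ) * y i := by
    rw [Finset.sum_comm, ← Finset.sum_neg_distrib]
    refine Finset.sum_congr rfl fun i _ => ?_
    rw [← Finset.sum_neg_distrib]
    refine Finset.sum_congr rfl fun l _ => ?_
    rw [← neg_sub, Left.sign_neg, SignType.coe_neg, neg_mul]
  simp only [mul_sub, Finset.sum_sub_distrib]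
  rw [hswap, sub_neg_eq_add, ← two_mul, Finset.mul_sum]
  refine Finset.sum_congr rfl fun i _ => ?_
  rw [spreadSubgradient, mul_assoc, Finset.sum_mul]

theorem spreadSubgradient_dotProduct_self (x : n → ℝ) : spreadSubgradient x ⬝ᵥ x = spread x := by
  simp only [spreadSubgradient_dotProduct, sign_mul_self, spread]

theorem spreadSubgradient_add_two_le {x : n → ℝ} {i k : n} (hik : x i < x k) :
    spreadSubgradient x i + 2 ≤ spreadSubgradient x k := by
  classical
  have hmono (l : n) : (SignType.sign (x i - x l) : ℝ) ≤ SignType.sign (x k - x l) := by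
    have h : SignType.sign (x i - x l) ≤ SignType.sign (x k - x l) :=
      SignType.sign.monotone (by linarith)
    revert h
    cases SignType.sign (x i - x l) <;> cases SignType.sign (x k - x l) <;> simp
  have hsum : ∑ l ∈ Finset.univ.erase i, (SignType.sign (x i - x l) : ℝ) ≤
      ∑ l ∈ Finset.univ.erase i, (SignType.sign (x k - x l) : ℝ) :=
    Finset.sum_le_sum fun l _ => hmono l
  rw [spreadSubgradient, spreadSubgradient, ← Finset.add_sum_erase _ _ (Finset.mem_univ i),
    ← Finset.add_sum_erase _ (fun l => (SignType.sign (x k - x l) : ℝ)) (Finset.mem_univ i),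
    sign_pos (sub_pos.mpr hik), sub_self, sign_zero, SignType.coe_zero, SignType.coe_one]
  linarith

theorem monovary_spreadSubgradient_add (x : n → ℝ) {ε : n → ℝ} (hε : ∀ i, |ε i| ≤ 1) :
    Monovary (spreadSubgradient x + ε) x := fun i k hik => by
  rw [Pi.add_apply, Pi.add_apply]
  linarith [spreadSubgradient_add_two_le hik, (abs_le.mp (hε i)).2, (abs_le.mp (hε k)).1]

theorem abs_spreadSubgradient_le (x : n → ℝ) (i : n) :
    |spreadSubgradient x i| ≤ 2 * Fintype.card n := by
  rw [spreadSubgradient, abs_mul, abs_two]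
  gcongr
  calc |∑ l, (SignType.sign (x i - x l) : ℝ)| ≤ ∑ l, |(SignType.sign (x i - x l) : ℝ)| :=
        Finset.abs_sum_le_sum_abs _ _
    _ ≤ ∑ _l : n, (1 : ℝ) := Finset.sum_le_sum fun l _ => by
        rcases SignType.sign (x i - x l) <;> simp
    _ = Fintype.card n := by simp

theorem abs_spread_sub_le (x y : n → ℝ) :
    |spread x - spread y| ≤ 2 * Fintype.card n * Fintype.card n * ‖x - y‖ := by
  have hpair (i l : n) : |(|x i - x l| - |y i - y l|)| ≤ 2 * ‖x - y‖ :=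
    calc |(|x i - x l| - |y i - y l|)| ≤ |x i - x l - (y i - y l)| := abs_abs_sub_abs_le_abs_sub _ _
      _ = |(x - y) i - (x - y) l| := by rw [Pi.sub_apply, Pi.sub_apply, sub_sub_sub_comm]
      _ ≤ |(x - y) i| + |(x - y) l| := abs_sub _ _
      _ ≤ 2 * ‖x - y‖ := by
        rw [two_mul]
        exact add_le_add (norm_le_pi_norm (x - y) i) (norm_le_pi_norm (x - y) l)
  simp only [spread, ← Finset.sum_sub_distrib]
  calc |∑ i, ∑ l, (|x i - x l| - |y i - y l|)| ≤ ∑ _i : n, ∑ _l : n, 2 * ‖x - y‖ :=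
        (Finset.abs_sum_le_sum_abs _ _).trans (Finset.sum_le_sum fun i _ =>
          (Finset.abs_sum_le_sum_abs _ _).trans (Finset.sum_le_sum fun l _ => hpair i l))
    _ = 2 * Fintype.card n * Fintype.card n * ‖x - y‖ := by
        simp only [Finset.sum_const, Finset.card_univ, nsmul_eq_mul]
        ring

theorem continuous_spread : Continuous (spread : (n → ℝ) → ℝ) :=
  continuous_finsetSum _ fun i _ => continuous_finsetSum _ fun l _ =>
    ((continuous_apply i).sub (continuous_apply l)).abs

theorem sign_mul_nonneg_of_abs_sub_le {x y : ℝ} (h : |x - y| ≤ |y|) :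
    0 ≤ (SignType.sign x : ℝ) * y := by
  rcases lt_trichotomy x 0 with hx | rfl | hx
  · rw [sign_neg hx, SignType.coe_neg_one]
    by_contra! hy
    rw [abs_of_pos (by linarith : 0 < y)] at h
    linarith [(abs_le.mp h).1]
  · rw [sign_zero, SignType.coe_zero, zero_mul]
  · rw [sign_pos hx, SignType.coe_one, one_mul]
    by_contra! hy
    rw [abs_of_neg hy] at h
    linarith [(abs_le.mp h).2]

theorem eventually_sign_mul_taylor_le {f : ℝ → ℝ} {f' t₀ : ℝ} (hf : HasDerivAt f f' t₀) :
    ∀ᶠ t in 𝓝 t₀, (SignType.sign (f t₀) : ℝ) * (f t₀ + f' * (t - t₀)) ≤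
      (SignType.sign (f t) : ℝ) * (f t₀ + f' * (t - t₀)) := by
  rcases lt_trichotomy (f t₀) 0 with h₀ | h₀ | h₀
  · filter_upwards [hf.continuousAt.eventually_lt_const h₀] with t ht
    rw [sign_neg h₀, sign_neg ht]
  · simp only [h₀, sign_zero, SignType.coe_zero, zero_mul, zero_add]
    rcases eq_or_ne f' 0 with rfl | hf'
    · simp only [zero_mul, mul_zero, le_refl, Filter.eventually_true]
    · filter_upwards [(hasDerivAt_iff_isLittleO.mp hf).def (abs_pos.mpr hf')] with t ht
      rw [h₀, sub_zero, smul_eq_mul, Real.norm_eq_abs, Real.norm_eq_abs, ← abs_mul,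
        mul_comm (t - t₀)] at ht
      exact sign_mul_nonneg_of_abs_sub_le ht
  · filter_upwards [hf.continuousAt.eventually_const_lt h₀] with t ht
    rw [sign_pos h₀, sign_pos ht]

theorem eventually_spread_taylor_le {v : ℝ → n → ℝ} {v' : n → ℝ} {t₀ : ℝ}
    (hv : HasDerivAt v v' t₀) :
    ∀ᶠ t in 𝓝 t₀, spread (v t₀) + spreadSubgradient (v t₀) ⬝ᵥ v' * (t - t₀) ≤
      spreadSubgradient (v t) ⬝ᵥ (v t₀ + (t - t₀) • v') := by
  have hsign : ∀ᶠ t in 𝓝 t₀, ∀ i l, _ := eventually_all.mpr fun i => eventually_all.mpr fun l =>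
    eventually_sign_mul_taylor_le ((hasDerivAt_pi.mp hv i).sub (hasDerivAt_pi.mp hv l))
  filter_upwards [hsign] with t ht
  calc spread (v t₀) + spreadSubgradient (v t₀) ⬝ᵥ v' * (t - t₀)
      = spreadSubgradient (v t₀) ⬝ᵥ (v t₀ + (t - t₀) • v') := by
        rw [dotProduct_add, spreadSubgradient_dotProduct_self, dotProduct_smul, smul_eq_mul,
          mul_comm]
    _ ≤ spreadSubgradient (v t) ⬝ᵥ (v t₀ + (t - t₀) • v') := by
        rw [spreadSubgradient_dotProduct, spreadSubgradient_dotProduct]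
        refine Finset.sum_le_sum fun i _ => Finset.sum_le_sum fun l _ => ?_
        have hlin : (v t₀ + (t - t₀) • v') i - (v t₀ + (t - t₀) • v') l =
            v t₀ i - v t₀ l + (v' i - v' l) * (t - t₀) := by
          simp only [Pi.add_apply, Pi.smul_apply, smul_eq_mul]
          ring
        rw [hlin]
        exact ht i l

end Spread

section RegularSystems

open Set MeasureTheory

/-- The primitive of `W` which vanishes at `0`. -/
noncomputable def primitive (W : ℝ → ℝ) (t : ℝ) : ℝ :=
  ∫ x in (0 : ℝ)..t, W x

section Primitive

variable {W : ℝ → ℝ}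

theorem primitive_sub_primitive (hW : LocallyIntegrable W) (s t : ℝ) :
    primitive W t - primitive W s = ∫ x in s..t, W x :=
  intervalIntegral.integral_interval_sub_left (intervalIntegrable_of_locallyIntegrable hW _ _)
    (intervalIntegrable_of_locallyIntegrable hW _ _)

theorem continuous_primitive (hW : LocallyIntegrable W) : Continuous (primitive W) :=
  intervalIntegral.continuous_primitive (intervalIntegrable_of_locallyIntegrable hW) 0

theorem hasDerivAt_primitive_primitive (hW : LocallyIntegrable W) (t : ℝ) :
    HasDerivAt (primitive (primitive W)) (primitive W t) t :=
  ((continuous_primitive hW).integral_hasStrictDerivAt 0 t).hasDerivAt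

/-- The remainder of the first order Taylor expansion at `s` of the second primitive of `W`. -/
noncomputable def taylorRemainder (W : ℝ → ℝ) (s t : ℝ) : ℝ :=
  primitive (primitive W) t - primitive (primitive W) s - primitive W s * (t - s)

end Primitive

variable {𝕜 n : Type*} [RCLike 𝕜] [Fintype n] [DecidableEq n]

/-- A differentiable system `v` of the eigenvalues on `Ω`, with derivative `v'`, of a curve `A` of
matrices with derivative `A'`, the variation of which is bounded by the integral of `W`. -/
structure IsRegularSystem (Ω : Set ℝ) (A A' : ℝ → Matrix n n 𝕜) (W : ℝ → ℝ) (v v' : ℝ → n → ℝ) :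
    Prop where
  isOpen : IsOpen Ω
  convex : Convex ℝ Ω
  hasDerivAt_curve : ∀ t ∈ Ω, HasDerivAt A (A' t) t
  sum_norm_sub_le : ∀ s ∈ Ω, ∀ t ∈ Ω, s ≤ t → ∑ i, ∑ j, ‖(A' t - A' s) i j‖ ≤ ∫ x in s..t, W x
  diagonalizesJet : ∀ t ∈ Ω, ∃ U, DiagonalizesJet U (A t) (A' t) (v t) (v' t)
  hasDerivAt : ∀ t ∈ Ω, HasDerivAt v (v' t) t
  locallyIntegrable : LocallyIntegrable W
  nonneg : ∀ x, 0 ≤ W x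

/-- The multiple of the second primitive of `W` which makes the spread of the eigenvalues convex,
for matrices with index type `n`. -/
noncomputable def convexifier (n : Type*) [Fintype n] (W : ℝ → ℝ) (t : ℝ) : ℝ :=
  Fintype.card n * (2 * Fintype.card n + 1) * primitive (primitive W) t

namespace IsRegularSystem

variable {Ω : Set ℝ} {A A' : ℝ → Matrix n n 𝕜} {W : ℝ → ℝ} {v v' : ℝ → n → ℝ} {s t : ℝ}

theorem continuousAt_matrix_derivative (h : IsRegularSystem Ω A A' W v v') (ht : t ∈ Ω) :
    ContinuousAt A' t := by
  have hle (s t : ℝ) (i j : n) : ‖(A' s - A' t) i j‖ ≤ ∑ k, ∑ l, ‖(A' s - A' t) k l‖ :=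
    (Finset.single_le_sum (f := fun l => ‖(A' s - A' t) i l‖) (fun _ _ => norm_nonneg _)
      (Finset.mem_univ j)).trans (Finset.single_le_sum
      (f := fun k => ∑ l, ‖(A' s - A' t) k l‖)
      (fun _ _ => Finset.sum_nonneg fun _ _ => norm_nonneg _) (Finset.mem_univ i))
  refine tendsto_pi_nhds.mpr fun i => tendsto_pi_nhds.mpr fun j => ?_
  rw [tendsto_iff_dist_tendsto_zero]
  have hprimitive : Tendsto (fun s => |primitive W s - primitive W t|) (𝓝 t) (𝓝 0) := by
    simpa only [sub_self, abs_zero] using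
      (((continuous_primitive h.locallyIntegrable).tendsto t).sub_const (primitive W t)).abs
  refine squeeze_zero' (Eventually.of_forall fun s => dist_nonneg) ?_ hprimitive
  filter_upwards [h.isOpen.mem_nhds ht] with s hs
  rcases le_total s t with hst | hst
  · rw [dist_comm, dist_eq_norm, abs_sub_comm, primitive_sub_primitive h.locallyIntegrable]
    exact ((hle t s i j).trans (h.sum_norm_sub_le s hs t ht hst)).trans (le_abs_self _)
  · rw [dist_eq_norm, primitive_sub_primitive h.locallyIntegrable]
    exact ((hle s t i j).trans (h.sum_norm_sub_le t ht s hs hst)).trans (le_abs_self _)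

theorem continuousAt_derivative (h : IsRegularSystem Ω A A' W v v') (ht : t ∈ Ω) :
    ContinuousAt v' t :=
  continuousAt_derivative_of_diagonalizesJet (h.hasDerivAt_curve t ht)
    (h.continuousAt_matrix_derivative ht)
    (by filter_upwards [h.isOpen.mem_nhds ht] with s hs using h.diagonalizesJet s hs)
    (h.hasDerivAt t ht)

theorem continuousOn (h : IsRegularSystem Ω A A' W v v') : ContinuousOn v Ω := fun t ht =>
  (h.hasDerivAt t ht).continuousAt.continuousWithinAt

theorem hasDerivAt_re_conjTranspose_mul_mul (h : IsRegularSystem Ω A A' W v v') (ht : t ∈ Ω)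
    (V : Matrix n n 𝕜) (i : n) :
    HasDerivAt (fun t => RCLike.re ((Vᴴ * A t * V) i i)) (RCLike.re ((Vᴴ * A' t * V) i i)) t := by
  have hentry : HasDerivAt (fun t => (Vᴴ * A t * V) i i) ((Vᴴ * A' t * V) i i) t := by
    simp only [Matrix.mul_apply]
    exact HasDerivAt.fun_sum fun l _ => HasDerivAt.mul_const (HasDerivAt.fun_sum fun k _ =>
      (hasDerivAt_matrix.mp (h.hasDerivAt_curve t ht) k l).const_mul _) _
  exact RCLike.reCLM.hasFDerivAt.comp_hasDerivAt t hentry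

theorem abs_re_conjTranspose_mul_mul_sub_taylor_le (h : IsRegularSystem Ω A A' W v v')
    (hs : s ∈ Ω) (ht : t ∈ Ω) {V : Matrix n n 𝕜}
    (hV : DiagonalizesJet V (A s) (A' s) (v s) (v' s)) (i : n) :
    |RCLike.re ((Vᴴ * A t * V) i i) - (v s + (t - s) • v' s) i| ≤ taylorRemainder W s t := by
  have hmajorant : ∀ x ∈ Ω, ∀ y ∈ Ω, x ≤ y →
      |RCLike.re ((Vᴴ * A' y * V) i i) - RCLike.re ((Vᴴ * A' x * V) i i)| ≤
        primitive W y - primitive W x := fun x hx y hy hxy => by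
    have hsub : RCLike.re ((Vᴴ * A' y * V) i i) - RCLike.re ((Vᴴ * A' x * V) i i) =
        RCLike.re ((Vᴴ * (A' y - A' x) * V) i i) := by
      rw [Matrix.mul_sub, Matrix.sub_mul, Matrix.sub_apply, map_sub]
    rw [hsub, primitive_sub_primitive h.locallyIntegrable]
    exact ((RCLike.abs_re_le_norm _).trans (norm_conjTranspose_mul_mul_apply_le
      hV.conjTranspose_mul_self hV.conjTranspose_mul_self _ i i)).trans
      (h.sum_norm_sub_le x hx y hy hxy)
  have htaylor := abs_sub_sub_mul_le_of_majorant h.convex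
    (fun t ht => h.hasDerivAt_re_conjTranspose_mul_mul ht V i)
    (fun t _ => hasDerivAt_primitive_primitive h.locallyIntegrable t) hmajorant hs ht
  rw [hV.toDiagonalizes.re_conjTranspose_mul_mul_apply_self,
    hV.re_conjTranspose_mul_mul_apply_self, mul_comm, sub_sub] at htaylor
  exact htaylor

theorem dotProduct_taylor_le (h : IsRegularSystem Ω A A' W v v') (hs : s ∈ Ω) (ht : t ∈ Ω)
    {w : n → ℝ} (hw : Monovary w (v t)) {C : ℝ} (hC : ∀ i, |w i| ≤ C) :
    w ⬝ᵥ (v s + (t - s) • v' s) ≤ w ⬝ᵥ v t + Fintype.card n * C * taylorRemainder W s t := by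
  obtain ⟨U, hU⟩ := h.diagonalizesJet t ht
  obtain ⟨V, hV⟩ := h.diagonalizesJet s hs
  have hterm (i : n) : w i * (v s + (t - s) • v' s) i ≤
      w i * RCLike.re ((Vᴴ * A t * V) i i) + C * taylorRemainder W s t := by
    have hle := mul_le_mul (hC i) (h.abs_re_conjTranspose_mul_mul_sub_taylor_le hs ht hV i)
      (abs_nonneg _) ((abs_nonneg _).trans (hC i))
    rw [← abs_mul] at hle
    linarith [(abs_le.mp hle).1]
  calc w ⬝ᵥ (v s + (t - s) • v' s)
      ≤ ∑ i, (w i * RCLike.re ((Vᴴ * A t * V) i i) + C * taylorRemainder W s t) :=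
        Finset.sum_le_sum fun i _ => hterm i
    _ = (w ⬝ᵥ fun i => RCLike.re ((Vᴴ * A t * V) i i)) +
          Fintype.card n * C * taylorRemainder W s t := by
        rw [Finset.sum_add_distrib, Finset.sum_const, Finset.card_univ, nsmul_eq_mul,
          ← mul_assoc (Fintype.card n : ℝ),
          dotProduct]
    _ ≤ w ⬝ᵥ v t + Fintype.card n * C * taylorRemainder W s t := by
        gcongr
        exact hU.toDiagonalizes.dotProduct_re_conjTranspose_mul_mul_le hV.conjTranspose_mul_self hw

/-- For a weight vector ordered as the eigenvalues at `t`, the eigenvalues dominate the diagonal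
entries in an eigenbasis at `t₀`, which are the Taylor polynomials at `t₀` up to the remainder. The
subgradient of the spread has gaps which are large enough to absorb the perturbation `ε`. -/
theorem convexOn_spread_add_dotProduct_add_convexifier (h : IsRegularSystem Ω A A' W v v')
    {ε : n → ℝ} (hε : ∀ i, |ε i| ≤ 1) :
    ConvexOn ℝ Ω (fun t => spread (v t) + ε ⬝ᵥ v t + convexifier n W t) := by
  have hconvexifier : Continuous (convexifier n W) := continuous_const.mul
    (continuous_primitive (continuous_primitive h.locallyIntegrable).locallyIntegrable)
  refine convexOn_of_forall_exists_support h.convex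
    (((continuous_spread.comp_continuousOn h.continuousOn).add
      ((continuous_const.dotProduct continuous_id).comp_continuousOn h.continuousOn)).add
      hconvexifier.continuousOn) fun t₀ ht₀ => ?_
  refine ⟨(spreadSubgradient (v t₀) + ε) ⬝ᵥ v' t₀ +
    Fintype.card n * (2 * Fintype.card n + 1) * primitive W t₀, ?_⟩
  filter_upwards [eventually_spread_taylor_le (h.hasDerivAt t₀ ht₀), h.isOpen.mem_nhds ht₀]
    with t hspread ht
  have hweight (i : n) : |(spreadSubgradient (v t) + ε) i| ≤ 2 * Fintype.card n + 1 :=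
    (abs_add_le _ _).trans (add_le_add (abs_spreadSubgradient_le _ i) (hε i))
  have hsum := h.dotProduct_taylor_le ht₀ ht (monovary_spreadSubgradient_add (v t) hε) hweight
  rw [add_dotProduct, add_dotProduct, spreadSubgradient_dotProduct_self, dotProduct_add ε,
    dotProduct_smul, smul_eq_mul] at hsum
  simp only [add_dotProduct, convexifier, taylorRemainder] at hsum ⊢
  linarith

theorem convexOn_spread_add_convexifier (h : IsRegularSystem Ω A A' W v v') :
    ConvexOn ℝ Ω (fun t => spread (v t) + convexifier n W t) := by
  simpa only [zero_dotProduct, add_zero] using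
    h.convexOn_spread_add_dotProduct_add_convexifier (ε := 0) (by simp)

theorem convexOn_spread_add_convexifier_add (h : IsRegularSystem Ω A A' W v v') {e : ℝ}
    (he : |e| ≤ 1) (j : n) :
    ConvexOn ℝ Ω (fun t => spread (v t) + convexifier n W t + e * v t j) := by
  have hε (i : n) : |(Pi.single j e : n → ℝ) i| ≤ 1 := by
    rcases eq_or_ne i j with rfl | hij
    · rwa [Pi.single_eq_same]
    · rw [Pi.single_eq_of_ne hij, abs_zero]
      exact zero_le_one
  simpa only [single_dotProduct, add_right_comm] using
    h.convexOn_spread_add_dotProduct_add_convexifier hε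

theorem dcOn (h : IsRegularSystem Ω A A' W v v') (j : n) : DCOn Ω fun t => v t j := by
  have hadd := (h.convexOn_spread_add_convexifier_add (e := 1) (by simp) j).smul
    (c := 1 / 2) (by norm_num)
  have hsub := (h.convexOn_spread_add_convexifier_add (e := -1) (by simp) j).smul
    (c := 1 / 2) (by norm_num)
  refine ⟨_, _, hadd.continuousOn h.isOpen, hadd, hsub.continuousOn h.isOpen, hsub, fun x _ => ?_⟩
  simp only [smul_eq_mul]
  ring

end IsRegularSystem

end RegularSystems

section DerivativeMajorant

open Set MeasureTheory

theorem abs_derivative_sub_le_of_convexOn {Ω : Set ℝ} (hΩ : IsOpen Ω) {c f f' : ℝ → ℝ}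
    (hc : ConvexOn ℝ Ω c) (hadd : ConvexOn ℝ Ω fun t => c t + f t)
    (hsub : ConvexOn ℝ Ω fun t => c t - f t) (hf : ∀ t ∈ Ω, HasDerivAt f (f' t) t) {s t : ℝ}
    (hs : s ∈ Ω) (ht : t ∈ Ω) (hst : s ≤ t) :
    |f' t - f' s| ≤ derivWithin c (Ioi t) t - derivWithin c (Ioi s) s := by
  have hderiv : ∀ x ∈ Ω, HasDerivWithinAt c (derivWithin c (Ioi x) x) (Ioi x) x := fun x hx =>
    hc.hasDerivWithinAt_rightDeriv_of_mem_interior (hΩ.interior_eq.symm ▸ hx)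
  have hmono {g g' : ℝ → ℝ} (hg : ConvexOn ℝ Ω g)
      (hg' : ∀ x ∈ Ω, HasDerivWithinAt g (g' x) (Ioi x) x) : g' s ≤ g' t := by
    have h := hg.monotoneOn_rightDeriv (hΩ.interior_eq.symm ▸ hs) (hΩ.interior_eq.symm ▸ ht) hst
    dsimp only at h
    rwa [(hg' s hs).derivWithin (uniqueDiffWithinAt_Ioi s),
      (hg' t ht).derivWithin (uniqueDiffWithinAt_Ioi t)] at h
  have h₁ := hmono hadd fun x hx => (hderiv x hx).add (hf x hx).hasDerivWithinAt
  have h₂ := hmono hsub fun x hx => (hderiv x hx).sub (hf x hx).hasDerivWithinAt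
  exact abs_le.mpr ⟨by linarith, by linarith⟩

theorem abs_le_of_hasDerivWithinAt_Ioi {f : ℝ → ℝ} {f' x C : ℝ}
    (hf : HasDerivWithinAt f f' (Ioi x) x)
    (h : ∀ᶠ y in 𝓝[>] x, |f y - f x| ≤ C * |y - x|) : |f'| ≤ C := by
  refine le_of_tendsto ((hasDerivWithinAt_iff_tendsto_slope' self_notMem_Ioi).mp hf).abs ?_
  filter_upwards [self_mem_nhdsWithin, h] with y hxy hy
  rwa [slope_def_field, abs_div, div_le_iff₀ (abs_pos.mpr (sub_pos.mpr hxy).ne')]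

namespace IsRegularSystem

variable {𝕜 n : Type*} [RCLike 𝕜] [Fintype n] [DecidableEq n] {Ω : Set ℝ}
  {A A' : ℝ → Matrix n n 𝕜} {W : ℝ → ℝ} {v v' : ℝ → n → ℝ} {M s t : ℝ}

/-- The right derivative of the convex function which makes all the eigenvalues difference-convex.
It is a monotone majorant of their derivatives. -/
noncomputable def derivativeMajorant (W : ℝ → ℝ) (v : ℝ → n → ℝ) (t : ℝ) : ℝ :=
  derivWithin (fun t => spread (v t) + convexifier n W t) (Ioi t) t

theorem abs_derivative_sub_le_derivativeMajorant_sub (h : IsRegularSystem Ω A A' W v v')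
    (hs : s ∈ Ω) (ht : t ∈ Ω) (hst : s ≤ t) (j : n) :
    |v' t j - v' s j| ≤ derivativeMajorant W v t - derivativeMajorant W v s := by
  refine abs_derivative_sub_le_of_convexOn h.isOpen h.convexOn_spread_add_convexifier
    (f := fun t => v t j) (f' := fun t => v' t j) ?_ ?_
    (fun t ht => hasDerivAt_pi.mp (h.hasDerivAt t ht) j) hs ht hst
  · simpa only [one_mul] using h.convexOn_spread_add_convexifier_add (e := 1) (by simp) j
  · simpa only [neg_mul, one_mul, ← sub_eq_add_neg] using
      h.convexOn_spread_add_convexifier_add (e := -1) (by simp) j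

theorem abs_spread_sub_le (h : IsRegularSystem Ω A A' W v v') (hM : ∀ t ∈ Ω, ‖v' t‖ ≤ M)
    (hs : s ∈ Ω) (ht : t ∈ Ω) :
    |spread (v t) - spread (v s)| ≤ 2 * Fintype.card n * Fintype.card n * M * |t - s| :=
  calc |spread (v t) - spread (v s)| ≤ 2 * Fintype.card n * Fintype.card n * ‖v t - v s‖ :=
        _root_.abs_spread_sub_le _ _
    _ ≤ 2 * Fintype.card n * Fintype.card n * (M * |t - s|) := by
        gcongr
        exact h.convex.norm_image_sub_le_of_norm_hasDerivWithin_le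
          (fun t ht => (h.hasDerivAt t ht).hasDerivWithinAt) hM hs ht
    _ = 2 * Fintype.card n * Fintype.card n * M * |t - s| := by ring

theorem abs_derivativeMajorant_sub_le (h : IsRegularSystem Ω A A' W v v')
    (hM : ∀ t ∈ Ω, ‖v' t‖ ≤ M) (ht : t ∈ Ω) :
    |derivativeMajorant W v t - Fintype.card n * (2 * Fintype.card n + 1) * primitive W t| ≤
      2 * Fintype.card n * Fintype.card n * M := by
  have hconvexifier : HasDerivAt (convexifier n W)
      (Fintype.card n * (2 * Fintype.card n + 1) * primitive W t) t :=
    (hasDerivAt_primitive_primitive h.locallyIntegrable t).const_mul _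
  have hmajorant : HasDerivWithinAt (fun t => spread (v t) + convexifier n W t)
      (derivativeMajorant W v t) (Ioi t) t :=
    h.convexOn_spread_add_convexifier.hasDerivWithinAt_rightDeriv_of_mem_interior
      (h.isOpen.interior_eq.symm ▸ ht)
  have hspread : HasDerivWithinAt (fun t => spread (v t))
      (derivativeMajorant W v t - Fintype.card n * (2 * Fintype.card n + 1) * primitive W t)
      (Ioi t) t := by
    simpa only [Pi.sub_def, add_sub_cancel_right] using hmajorant.sub hconvexifier.hasDerivWithinAt
  refine abs_le_of_hasDerivWithinAt_Ioi hspread ?_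
  filter_upwards [mem_nhdsWithin_of_mem_nhds (h.isOpen.mem_nhds ht)] with x hx
  exact h.abs_spread_sub_le hM ht hx

theorem derivativeMajorant_sub_le (h : IsRegularSystem Ω A A' W v v')
    (hM : ∀ t ∈ Ω, ‖v' t‖ ≤ M) (hs : s ∈ Ω) (ht : t ∈ Ω) :
    derivativeMajorant W v t - derivativeMajorant W v s ≤
      4 * Fintype.card n * Fintype.card n * M +
        Fintype.card n * (2 * Fintype.card n + 1) * ∫ x in s..t, W x := by
  rw [← primitive_sub_primitive h.locallyIntegrable]
  linarith [(abs_le.mp (h.abs_derivativeMajorant_sub_le hM hs)).1,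
    (abs_le.mp (h.abs_derivativeMajorant_sub_le hM ht)).2]

end IsRegularSystem

end DerivativeMajorant

section EigenvalueClusters

open Set MeasureTheory

variable {𝕜 n : Type*} [RCLike 𝕜] [Fintype n] [DecidableEq n]

namespace Diagonalizes

variable {A B U V : Matrix n n 𝕜} {v w : n → ℝ} {δ : ℝ}

theorem norm_conjTranspose_mul_apply_le (hV : Diagonalizes V A v) (hU : Diagonalizes U B w)
    (hδ : 0 < δ) {i l : n} (hsep : δ ≤ |w l - v i|) :
    ‖(Vᴴ * U) i l‖ ≤ (∑ k, ∑ m, ‖(B - A) k m‖) / δ := by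
  rw [le_div_iff₀ hδ]
  calc ‖(Vᴴ * U) i l‖ * δ ≤ |w l - v i| * ‖(Vᴴ * U) i l‖ := by
        rw [mul_comm]
        gcongr
    _ = ‖(Vᴴ * (B - A) * U) i l‖ := by
        rw [hV.conjTranspose_mul_sub_mul_apply hU, norm_mul, RCLike.norm_ofReal]
    _ ≤ ∑ k, ∑ m, ‖(B - A) k m‖ := norm_conjTranspose_mul_mul_apply_le
        hV.conjTranspose_mul_self hU.conjTranspose_mul_self _ i l

theorem dotProduct_re_conjTranspose_mul_mul_sub (hU : Diagonalizes U B w) (hV : Vᴴ * V = 1)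
    (c : n → ℝ) :
    (c ⬝ᵥ fun i => RCLike.re ((Vᴴ * B * V) i i)) - c ⬝ᵥ w =
      ∑ i, ∑ l, (c i - c l) * (‖(Vᴴ * U) i l‖ ^ 2 * w l) := by
  have hcol := (mem_doublyStochastic_iff_sum.mp (of_norm_sq_mem_doublyStochastic
    (conjTranspose_mul_self_conjTranspose_mul hV hU.conjTranspose_mul_self))).2.2
  have hdot : c ⬝ᵥ w = ∑ i, ∑ l, c l * (‖(Vᴴ * U) i l‖ ^ 2 * w l) := by
    rw [Finset.sum_comm]
    refine Finset.sum_congr rfl fun l _ => ?_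
    rw [← Finset.mul_sum, ← Finset.sum_mul]
    exact congrArg (c l * ·) ((one_mul (w l)).symm.trans (congrArg (· * w l) (hcol l).symm))
  rw [hU.re_conjTranspose_mul_mul_apply_self_eq_mulVec, hdot]
  simp only [dotProduct, mulVec, of_apply, Finset.mul_sum, sub_mul, Finset.sum_sub_distrib]

/-- The weights `(c i - c l) * ‖(Vᴴ * U) i l‖ ^ 2` are of second order in `B - A`, since `c` only
distinguishes separated eigenvalues. -/
theorem abs_dotProduct_re_conjTranspose_mul_mul_sub_le (hV : Diagonalizes V A v)
    (hU : Diagonalizes U B w) (hδ : 0 < δ) {c : n → ℝ}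
    (hsep : ∀ i l, c i ≠ c l → δ ≤ |w l - v i|) :
    |(c ⬝ᵥ fun i => RCLike.re ((Vᴴ * B * V) i i)) - c ⬝ᵥ w| ≤
      spread c * (((∑ k, ∑ m, ‖(B - A) k m‖) / δ) ^ 2 * ‖w‖) := by
  rw [hU.dotProduct_re_conjTranspose_mul_mul_sub hV.conjTranspose_mul_self, spread,
    Finset.sum_mul]
  refine (Finset.abs_sum_le_sum_abs _ _).trans (Finset.sum_le_sum fun i _ => ?_)
  rw [Finset.sum_mul]
  refine (Finset.abs_sum_le_sum_abs _ _).trans (Finset.sum_le_sum fun l _ => ?_)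
  rw [abs_mul]
  rcases eq_or_ne (c i) (c l) with hil | hil
  · rw [hil, sub_self, abs_zero, zero_mul, zero_mul]
  · rw [abs_mul, abs_of_nonneg (sq_nonneg ‖(Vᴴ * U) i l‖)]
    gcongr
    · exact hV.norm_conjTranspose_mul_apply_le hU hδ (hsep i l hil)
    · exact norm_le_pi_norm w l

end Diagonalizes

theorem exists_nhds_forall_le_dist {n X E : Type*} [Finite n] [TopologicalSpace X]
    [MetricSpace E] {v : X → n → E} {t₀ : X} (hv : ContinuousAt v t₀) :
    ∃ δ > 0, ∃ u ∈ 𝓝 t₀, ∀ s ∈ u, ∀ t ∈ u, ∀ i l, v t₀ i ≠ v t₀ l → δ ≤ dist (v t l) (v s i) := by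
  cases nonempty_fintype n
  obtain ⟨δ, hδ, hsep⟩ := exists_pos_forall_dist_eq_zero_of_lt (v t₀)
  refine ⟨δ / 2, half_pos hδ, _, Metric.tendsto_nhds.mp hv (δ / 4) (by positivity),
    fun s hs t ht i l hil => ?_⟩
  have hle : δ ≤ dist (v t₀ l) (v t₀ i) := by
    by_contra! hlt
    exact hil (dist_eq_zero.mp (hsep l i hlt)).symm
  have htri := dist_triangle4 (v t₀ l) (v t l) (v s i) (v t₀ i)
  have hl := (dist_le_pi_dist (v t) (v t₀) l).trans_lt ht
  have hi := (dist_le_pi_dist (v s) (v t₀) i).trans_lt hs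
  rw [dist_comm] at hl
  linarith

theorem taylorRemainder_add_taylorRemainder (W : ℝ → ℝ) (s t : ℝ) :
    taylorRemainder W s t + taylorRemainder W t s =
      (primitive W t - primitive W s) * (t - s) := by
  rw [taylorRemainder, taylorRemainder]
  ring

namespace IsRegularSystem

variable {Ω : Set ℝ} {A A' : ℝ → Matrix n n 𝕜} {W : ℝ → ℝ} {v v' : ℝ → n → ℝ} {s t t₀ : ℝ}

theorem exists_nhds_sum_norm_sub_le (h : IsRegularSystem Ω A A' W v v') (ht₀ : t₀ ∈ Ω) :
    ∃ L, ∃ u ∈ 𝓝 t₀, ∀ s ∈ u, ∀ t ∈ u, ∑ i, ∑ j, ‖(A t - A s) i j‖ ≤ L * |t - s| := by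
  have hentry (i j : n) : ∃ K, ∃ u ∈ 𝓝 t₀, LipschitzOnWith K (fun t => A t i j) u :=
    (hasStrictDerivAt_of_hasDerivAt_of_continuousAt
      (by filter_upwards [h.isOpen.mem_nhds ht₀] with t ht using
        hasDerivAt_matrix.mp (h.hasDerivAt_curve t ht) i j)
      (tendsto_pi_nhds.mp (tendsto_pi_nhds.mp (h.continuousAt_matrix_derivative ht₀) i) j)
      ).hasStrictFDerivAt.exists_lipschitzOnWith
  choose K u hu hlip using hentry
  refine ⟨∑ i, ∑ j, (K i j : ℝ), ⋂ i, ⋂ j, u i j,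
    Filter.iInter_mem.mpr fun i => Filter.iInter_mem.mpr fun j => hu i j, fun s hs t ht => ?_⟩
  simp only [mem_iInter] at hs ht
  simp only [Finset.sum_mul]
  exact Finset.sum_le_sum fun i _ => Finset.sum_le_sum fun j _ =>
    (hlip i j).norm_sub_le (ht i j) (hs i j)

theorem abs_dotProduct_sub_taylor_le (h : IsRegularSystem Ω A A' W v v') (hs : s ∈ Ω) (ht : t ∈ Ω)
    {c : n → ℝ} {δ : ℝ} (hδ : 0 < δ) (hsep : ∀ i l, c i ≠ c l → δ ≤ |v t l - v s i|) :
    |c ⬝ᵥ v t - c ⬝ᵥ (v s + (t - s) • v' s)| ≤ (∑ i, |c i|) * taylorRemainder W s t +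
      spread c * (((∑ k, ∑ m, ‖(A t - A s) k m‖) / δ) ^ 2 * ‖v t‖) := by
  obtain ⟨V, hV⟩ := h.diagonalizesJet s hs
  obtain ⟨U, hU⟩ := h.diagonalizesJet t ht
  have hcluster := hV.toDiagonalizes.abs_dotProduct_re_conjTranspose_mul_mul_sub_le
    hU.toDiagonalizes hδ hsep
  have htaylor : |(c ⬝ᵥ fun i => RCLike.re ((Vᴴ * A t * V) i i)) -
      c ⬝ᵥ (v s + (t - s) • v' s)| ≤ (∑ i, |c i|) * taylorRemainder W s t := by
    rw [← dotProduct_sub, Finset.sum_mul]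
    refine (Finset.abs_sum_le_sum_abs _ _).trans (Finset.sum_le_sum fun i _ => ?_)
    rw [abs_mul]
    gcongr
    exact h.abs_re_conjTranspose_mul_mul_sub_taylor_le hs ht hV i
  rw [abs_sub_comm] at hcluster
  exact (abs_sub_le _ _ _).trans ((add_le_add hcluster htaylor).trans_eq (add_comm _ _))

theorem exists_nhds_abs_dotProduct_sub_taylor_le (h : IsRegularSystem Ω A A' W v v')
    (ht₀ : t₀ ∈ Ω) {c : n → ℝ} (hc : ∀ i l, v t₀ i = v t₀ l → c i = c l) :
    ∃ u ∈ 𝓝 t₀, ∃ C, 0 ≤ C ∧ ∀ s ∈ u, ∀ t ∈ u,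
      |c ⬝ᵥ v t - c ⬝ᵥ (v s + (t - s) • v' s)| ≤
        (∑ i, |c i|) * taylorRemainder W s t + C * (t - s) ^ 2 := by
  have hv : ContinuousAt v t₀ := (h.hasDerivAt t₀ ht₀).continuousAt
  obtain ⟨L, u₁, hu₁, hlip⟩ := h.exists_nhds_sum_norm_sub_le ht₀
  obtain ⟨δ, hδ, u₂, hu₂, hsep⟩ := exists_nhds_forall_le_dist hv
  have hnorm : ∀ᶠ t in 𝓝 t₀, ‖v t‖ < ‖v t₀‖ + 1 :=
    hv.norm.eventually_lt_const (lt_add_one _)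
  have hspread : 0 ≤ spread c :=
    Finset.sum_nonneg fun i _ => Finset.sum_nonneg fun l _ => abs_nonneg _
  refine ⟨_, inter_mem (inter_mem (h.isOpen.mem_nhds ht₀) hnorm) (inter_mem hu₁ hu₂),
    spread c * ((L / δ) ^ 2 * (‖v t₀‖ + 1)), by positivity,
    fun s ⟨⟨hs, _⟩, hs₁, hs₂⟩ t ⟨⟨ht, htv⟩, ht₁, ht₂⟩ => ?_⟩
  refine (h.abs_dotProduct_sub_taylor_le hs ht hδ fun i l hil =>
    hsep s hs₂ t ht₂ i l (mt (hc i l) hil)).trans (add_le_add le_rfl ?_)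
  calc spread c * (((∑ k, ∑ m, ‖(A t - A s) k m‖) / δ) ^ 2 * ‖v t‖)
      ≤ spread c * ((L * |t - s| / δ) ^ 2 * (‖v t₀‖ + 1)) := by
        gcongr
        · exact hlip s hs₁ t ht₁
        · exact htv.le
    _ = spread c * ((L / δ) ^ 2 * (‖v t₀‖ + 1)) * (t - s) ^ 2 := by
        rw [mul_div_right_comm, mul_pow, sq_abs]
        ring

theorem exists_nhds_abs_dotProduct_derivative_sub_le (h : IsRegularSystem Ω A A' W v v')
    (ht₀ : t₀ ∈ Ω) {c : n → ℝ} (hc : ∀ i l, v t₀ i = v t₀ l → c i = c l) :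
    ∃ u ∈ 𝓝 t₀, ∃ C, 0 ≤ C ∧ ∀ s ∈ u, ∀ t ∈ u, s ≤ t →
      |c ⬝ᵥ v' t - c ⬝ᵥ v' s| ≤ ∫ x in s..t, ((∑ i, |c i|) * W x + C) := by
  obtain ⟨u, hu, C, hC, htaylor⟩ := h.exists_nhds_abs_dotProduct_sub_taylor_le ht₀ hc
  refine ⟨u, hu, 2 * C, by positivity, fun s hs t ht hst => ?_⟩
  rcases hst.eq_or_lt with rfl | hst
  · rw [sub_self, abs_zero, intervalIntegral.integral_same]
  have hpos : 0 < t - s := sub_pos.mpr hst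
  have hint : ∫ x in s..t, ((∑ i, |c i|) * W x + 2 * C) =
      (∑ i, |c i|) * (primitive W t - primitive W s) + 2 * C * (t - s) := by
    rw [intervalIntegral.integral_add
      ((intervalIntegrable_of_locallyIntegrable h.locallyIntegrable _ _).const_mul _)
      intervalIntegrable_const, intervalIntegral.integral_const_mul,
      primitive_sub_primitive h.locallyIntegrable, intervalIntegral.integral_const, smul_eq_mul]
    ring
  have hremainder : (∑ i, |c i|) * taylorRemainder W s t + (∑ i, |c i|) * taylorRemainder W t s =
      (∑ i, |c i|) * (primitive W t - primitive W s) * (t - s) := by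
    rw [← mul_add, taylorRemainder_add_taylorRemainder, mul_assoc]
  have hst' := abs_le.mp (htaylor s hs t ht)
  have hts' := abs_le.mp (htaylor t ht s hs)
  simp only [dotProduct_add, dotProduct_smul, smul_eq_mul] at hst' hts'
  rw [hint]
  refine le_of_mul_le_mul_right ?_ hpos
  rw [← abs_of_pos hpos, ← abs_mul, abs_of_pos hpos]
  exact abs_le.mpr ⟨by linarith [hst'.1, hts'.1], by linarith [hst'.2, hts'.2]⟩

end IsRegularSystem

end EigenvalueClusters

section LuzinPropertyOfDerivatives

open Set MeasureTheory

theorem measure_image_eq_zero_of_accPt {X Y : Type*} [TopologicalSpace X]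
    [SecondCountableTopology X] [MeasurableSpace Y] {μ : Measure Y} [NullSingletonClass μ]
    {f : X → Y} {E : Set X} (h : μ (f '' {t ∈ E | AccPt t (𝓟 E)}) = 0) : μ (f '' E) = 0 := by
  have hisolated : μ (f '' {t ∈ E | ¬AccPt t (𝓟 E)}) = 0 := by
    refine measure_image_eq_zero_of_forall_nhdsWithin fun t ⟨_, hacc⟩ => ⟨{t}, ?_, ?_⟩
    · rw [accPt_iff_frequently, not_frequently] at hacc
      refine mem_nhdsWithin_iff_eventually.mpr ?_
      filter_upwards [hacc] with x hx hxE
      by_contra hxt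
      exact hx ⟨hxt, hxE.1⟩
    · rw [image_singleton, measure_singleton]
  refine measure_mono_null ?_ (measure_union_null h hisolated)
  rw [← image_union]
  exact image_mono fun t ht => (em (AccPt t (𝓟 E))).imp (⟨ht, ·⟩) (⟨ht, ·⟩)

theorem eq_of_hasDerivAt_of_eqOn_of_accPt {f g : ℝ → ℝ} {f' g' x : ℝ} {E : Set ℝ}
    (hf : HasDerivAt f f' x) (hg : HasDerivAt g g' x) (hfg : EqOn f g E) (hx : x ∈ E)
    (hacc : AccPt x (𝓟 E)) : f' = g' :=
  (uniqueDiffWithinAt_iff_accPt.mpr hacc).eq_deriv E hf.hasDerivWithinAt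
    (hg.hasDerivWithinAt.congr hfg (hfg hx))

variable {𝕜 n : Type*} [RCLike 𝕜] [Fintype n] [DecidableEq n]

namespace IsRegularSystem

variable {Ω : Set ℝ} {A A' : ℝ → Matrix n n 𝕜} {W : ℝ → ℝ} {v v' : ℝ → n → ℝ} {a b : ℝ}

theorem volume_image_derivative_eq_zero_of_cluster (h : IsRegularSystem Ω A A' W v v') {j : n}
    {E : Set ℝ} (hE : E ⊆ Ω) (hE0 : volume E = 0) {S : Finset n}
    (hS : ∀ t ∈ E, ∀ i, i ∈ S ↔ v t i = v t j) : volume ((fun t => v' t j) '' E) = 0 := by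
  set c : n → ℝ := fun i => if i ∈ S then (S.card : ℝ)⁻¹ else 0
  have hmean : ∀ s ∈ E, AccPt s (𝓟 E) → c ⬝ᵥ v' s = v' s j := fun s hs hacc => by
    have hderiv : ∀ i ∈ S, v' s i = v' s j := fun i hi =>
      eq_of_hasDerivAt_of_eqOn_of_accPt (hasDerivAt_pi.mp (h.hasDerivAt s (hE hs)) i)
        (hasDerivAt_pi.mp (h.hasDerivAt s (hE hs)) j) (fun t ht => (hS t ht i).mp hi) hs hacc
    have hcard : (S.card : ℝ) ≠ 0 :=
      Nat.cast_ne_zero.mpr (Finset.card_ne_zero_of_mem ((hS s hs j).mpr rfl))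
    simp only [c, dotProduct, ite_mul, zero_mul, Finset.sum_ite_mem, Finset.univ_inter]
    rw [Finset.sum_congr rfl fun i hi => congrArg _ (hderiv i hi), Finset.sum_const, nsmul_eq_mul,
      mul_inv_cancel_left₀ hcard]
  refine measure_image_eq_zero_of_accPt
    (measure_image_eq_zero_of_forall_nhdsWithin fun t₀ ⟨ht₀, _⟩ => ?_)
  have hc : ∀ i l, v t₀ i = v t₀ l → c i = c l := fun i l hil => by
    simp only [c, hS t₀ ht₀, hil]
  obtain ⟨u, hu, C, hC, hdom⟩ := h.exists_nhds_abs_dotProduct_derivative_sub_le (hE ht₀) hc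
  refine ⟨u ∩ {t ∈ E | AccPt t (𝓟 E)},
    inter_mem (mem_nhdsWithin_of_mem_nhds hu) self_mem_nhdsWithin,
    volume_image_eq_zero_of_dominated (W := fun x => (∑ i, |c i|) * W x + C)
      ((h.locallyIntegrable.smul (∑ i, |c i|)).add (locallyIntegrable_const C))
      (fun x => add_nonneg (mul_nonneg (Finset.sum_nonneg fun i _ => abs_nonneg _) (h.nonneg x)) hC)
      (fun s hs t ht hst => ?_) (measure_mono_null (fun t ht => ht.2.1) hE0)⟩
  rw [← hmean s hs.2.1 hs.2.2, ← hmean t ht.2.1 ht.2.2]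
  exact hdom s hs.1 t ht.1 hst

theorem volume_image_derivative_eq_zero (h : IsRegularSystem Ω A A' W v v') (j : n) {N : Set ℝ}
    (hN : N ⊆ Ω) (hN0 : volume N = 0) : volume ((fun t => v' t j) '' N) = 0 := by
  let cluster : ℝ → Finset n := fun t => {i | v t i = v t j}
  have hcover : N = ⋃ S, N ∩ cluster ⁻¹' {S} := by
    rw [← inter_iUnion, ← preimage_iUnion, iUnion_of_singleton, preimage_univ, inter_univ]
  rw [hcover, image_iUnion, measure_iUnion_null_iff]
  exact fun S => h.volume_image_derivative_eq_zero_of_cluster (S := S) (inter_subset_left.trans hN)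
    (measure_mono_null inter_subset_left hN0) fun t ⟨_, (ht : cluster t = S)⟩ i => by
      simp only [← ht, cluster, Finset.mem_filter_univ]

theorem absolutelyContinuousOnInterval_derivative (h : IsRegularSystem Ω A A' W v v') (j : n)
    (ha : a ∈ Ω) (hb : b ∈ Ω) (hab : a ≤ b) :
    AbsolutelyContinuousOnInterval (fun t => v' t j) a b := by
  have hsub : Icc a b ⊆ Ω := h.convex.ordConnected.out ha hb
  exact absolutelyContinuousOnInterval_of_luzin hab
    (fun t ht => (tendsto_pi_nhds.mp (h.continuousAt_derivative (hsub ht)) j).mono_left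
      nhdsWithin_le_nhds)
    (boundedVariationOn_of_majorant hab fun s hs t ht hst =>
      h.abs_derivative_sub_le_derivativeMajorant_sub (hsub hs) (hsub ht) hst j)
    fun N hN hN0 => h.volume_image_derivative_eq_zero j (hN.trans hsub) hN0

theorem isPrimitiveOn_derivative (h : IsRegularSystem Ω A A' W v v') (j : n) :
    IsPrimitiveOn Ω (fun t => v' t j) (deriv fun t => v' t j) :=
  isPrimitiveOn_deriv_of_absolutelyContinuousOnInterval fun _ ha _ hb hab =>
    h.absolutelyContinuousOnInterval_derivative j ha hb hab

theorem lintegral_enorm_deriv_derivative_le {M D : ℝ}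
    (h : IsRegularSystem (Ioo a b) A A' W v v') (j : n) (hM : ∀ t ∈ Ioo a b, ‖v' t‖ ≤ M)
    (hD : ∀ s ∈ Ioo a b, ∀ t ∈ Ioo a b, s ≤ t → ∫ x in s..t, W x ≤ D) :
    ∫⁻ x in Ioo a b, ‖deriv (fun t => v' t j) x‖ₑ ≤
      ENNReal.ofReal (4 * Fintype.card n * Fintype.card n * M +
        Fintype.card n * (2 * Fintype.card n + 1) * D) := by
  refine lintegral_enorm_Ioo_le_of_majorant (h.isPrimitiveOn_derivative j)
    (fun s hs t ht hst => h.abs_derivative_sub_le_derivativeMajorant_sub hs ht hst j)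
    fun s hs t ht hst => (h.derivativeMajorant_sub_le hM hs ht).trans ?_
  gcongr
  exact hD s hs t ht hst

end IsRegularSystem

end LuzinPropertyOfDerivatives

section WeakDerivatives

open Set MeasureTheory

variable {Ω : Set ℝ} {x₀ : ℝ}

theorem exists_subset_Ioo (hΩ : IsOpen Ω) (hne : Ω.Nonempty) {K : Set ℝ} (hK : IsCompact K)
    (hKΩ : K ⊆ Ω) : ∃ s ∈ Ω, ∃ t ∈ Ω, s < t ∧ K ⊆ Ioo s t := by
  obtain ⟨x₀, hx₀⟩ := hne
  have hK' : IsCompact (insert x₀ K) := hK.insert x₀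
  have hKΩ' : insert x₀ K ⊆ Ω := insert_subset hx₀ hKΩ
  obtain ⟨m, hm, hmin⟩ := hK'.exists_isLeast (insert_nonempty x₀ K)
  obtain ⟨M, hM, hmax⟩ := hK'.exists_isGreatest (insert_nonempty x₀ K)
  obtain ⟨s, hs, hsm⟩ := ((hΩ.eventually_mem (hKΩ' hm)).filter_mono nhdsWithin_le_nhds
    |>.and (self_mem_nhdsWithin (s := Iio m))).exists
  obtain ⟨t, ht, htM⟩ := ((hΩ.eventually_mem (hKΩ' hM)).filter_mono nhdsWithin_le_nhds
    |>.and (self_mem_nhdsWithin (s := Ioi M))).exists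
  have hKst : insert x₀ K ⊆ Ioo s t := fun x hx =>
    ⟨lt_of_lt_of_le hsm (hmin hx), lt_of_le_of_lt (hmax hx) htM⟩
  have hx₀st := hKst (mem_insert x₀ K)
  exact ⟨s, hs, t, ht, hx₀st.1.trans hx₀st.2, (subset_insert x₀ K).trans hKst⟩

section

variable {E : Type*} [NormedAddCommGroup E] {u v w : ℝ → E}

theorem intervalIntegrable_of_locallyIntegrableOn (hΩ : OrdConnected Ω)
    (hv : LocallyIntegrableOn v Ω) : ∀ s ∈ Ω, ∀ t ∈ Ω, IntervalIntegrable v volume s t :=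
  fun _ hs _ ht => intervalIntegrable_iff.mpr
    ((hv.integrableOn_compact_subset (hΩ.uIcc_subset hs ht) isCompact_uIcc).mono_set
      uIoc_subset_uIcc)

variable [NormedSpace ℝ E]

theorem isPrimitiveOn_integral (hv : ∀ s ∈ Ω, ∀ t ∈ Ω, IntervalIntegrable v volume s t)
    (hx₀ : x₀ ∈ Ω) (c : E) : IsPrimitiveOn Ω (fun t => c + ∫ x in x₀..t, v x) v where
  intervalIntegrable := hv
  sub_eq_integral s hs t ht := by
    rw [add_sub_add_left_eq_sub,
      intervalIntegral.integral_interval_sub_left (hv _ hx₀ _ ht) (hv _ hx₀ _ hs)]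

theorem isPrimitiveOn_of_hasDerivAt [CompleteSpace E] (hΩ : OrdConnected Ω)
    (hu : ∀ t ∈ Ω, HasDerivAt u (v t) t) (hv : ContinuousOn v Ω) : IsPrimitiveOn Ω u v where
  intervalIntegrable _ hs _ ht := (hv.mono (hΩ.uIcc_subset hs ht)).intervalIntegrable
  sub_eq_integral _ hs _ ht :=
    (intervalIntegral.integral_eq_sub_of_hasDerivAt
      (fun x hx => hu x (hΩ.uIcc_subset hs ht hx))
      (hv.mono (hΩ.uIcc_subset hs ht)).intervalIntegrable).symm

namespace IsPrimitiveOn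

theorem locallyIntegrableOn (h : IsPrimitiveOn Ω u v) (hΩ : IsOpen Ω) :
    LocallyIntegrableOn v Ω := fun x hx => by
  obtain ⟨s, hs, t, ht, hst, hx'⟩ := exists_subset_Ioo hΩ ⟨x, hx⟩ isCompact_singleton
    (singleton_subset_iff.mpr hx)
  have hxst : x ∈ Ioo s t := hx' rfl
  exact ⟨Ioc s t, mem_nhdsWithin_of_mem_nhds (Ioc_mem_nhds hxst.1 hxst.2),
    (intervalIntegrable_iff_integrableOn_Ioc_of_le hst.le).mp (h.intervalIntegrable s hs t ht)⟩

theorem congr_ae (h : IsPrimitiveOn Ω u v) (hΩ : OrdConnected Ω)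
    (hvw : ∀ᵐ x, x ∈ Ω → v x = w x) : IsPrimitiveOn Ω u w := by
  have hae {s t : ℝ} (hs : s ∈ Ω) (ht : t ∈ Ω) : ∀ᵐ x, x ∈ uIoc s t → v x = w x :=
    hvw.mono fun x hx hxst => hx (hΩ.uIcc_subset hs ht (uIoc_subset_uIcc hxst))
  refine ⟨fun s hs t ht => (h.intervalIntegrable s hs t ht).congr_ae ?_, fun s hs t ht => ?_⟩
  · exact (ae_restrict_iff' measurableSet_uIoc).mpr (hae hs ht)
  · rw [h.sub_eq_integral s hs t ht, intervalIntegral.integral_congr_ae (hae hs ht)]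

theorem hasDerivAt [CompleteSpace E] (h : IsPrimitiveOn Ω u v) (hΩ : IsOpen Ω)
    (hv : ContinuousOn v Ω) {t : ℝ} (ht : t ∈ Ω) : HasDerivAt u (v t) t := by
  refine ((intervalIntegral.integral_hasDerivAt_right (h.intervalIntegrable t ht t ht)
    (hv.stronglyMeasurableAtFilter hΩ t ht) (hv.continuousAt (hΩ.mem_nhds ht))).const_add
      (u t)).congr_of_eventuallyEq ?_
  filter_upwards [hΩ.mem_nhds ht] with y hy
  rw [← h.sub_eq_integral t ht y hy, add_sub_cancel]

end IsPrimitiveOn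

end

variable {u v w : ℝ → ℝ}

namespace IsPrimitiveOn

theorem absolutelyContinuousOnInterval {s t : ℝ} (h : IsPrimitiveOn (Icc s t) u v) (hst : s ≤ t) :
    AbsolutelyContinuousOnInterval u s t :=
  absolutelyContinuousOnInterval_of_dominated hst (h.intervalIntegrable s (left_mem_Icc.mpr hst) t
    (right_mem_Icc.mpr hst)).abs fun x hx y hy hxy => by
      rw [h.sub_eq_integral x hx y hy]
      exact intervalIntegral.abs_integral_le_integral_abs hxy

theorem continuousOn (h : IsPrimitiveOn Ω u v) (hΩ : IsOpen Ω) (hΩc : OrdConnected Ω) :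
    ContinuousOn u Ω := fun x hx => by
  obtain ⟨s, hs, t, ht, hst, hx'⟩ := exists_subset_Ioo hΩ ⟨x, hx⟩ isCompact_singleton
    (singleton_subset_iff.mpr hx)
  have hcont := ((h.mono (hΩc.out hs ht)).absolutelyContinuousOnInterval hst.le).continuousOn
  rw [uIcc_of_le hst.le] at hcont
  have hxst : x ∈ Ioo s t := hx' rfl
  exact (hcont.continuousAt (Icc_mem_nhds hxst.1 hxst.2)).continuousWithinAt

theorem integral_mul_deriv {φ : ℝ → ℝ} {s t : ℝ} (h : IsPrimitiveOn (Icc s t) u v) (hst : s ≤ t)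
    (hφ : ContDiff ℝ 1 φ) (hs : φ s = 0) (ht : φ t = 0) :
    ∫ x in s..t, u x * deriv φ x = -∫ x in s..t, v x * φ x := by
  have hφ' : IsPrimitiveOn (Icc s t) φ (deriv φ) := isPrimitiveOn_of_hasDerivAt ordConnected_Icc
    (fun x _ => (hφ.differentiable one_ne_zero x).hasDerivAt)
    (hφ.continuous_deriv le_rfl).continuousOn
  have hae : ∀ᵐ x, x ∈ uIoc s t → deriv u x * φ x = v x * φ x := by
    filter_upwards [h.ae_hasDerivAt hst, Measure.ae_ne volume t] with x hx hxt hxst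
    rw [uIoc_of_le hst] at hxst
    rw [(hx ⟨hxst.1, lt_of_le_of_ne hxst.2 hxt⟩).deriv]
  rw [(h.absolutelyContinuousOnInterval hst).integral_mul_deriv_eq_deriv_mul
    (hφ'.absolutelyContinuousOnInterval hst), hs, ht, intervalIntegral.integral_congr_ae hae]
  ring

theorem hasWeakDeriv (h : IsPrimitiveOn Ω u v) (hΩ : IsOpen Ω) (hΩc : OrdConnected Ω) :
    HasWeakDeriv 1 Ω u v := by
  refine ⟨(h.continuousOn hΩ hΩc).locallyIntegrableOn hΩ.measurableSet, h.locallyIntegrableOn hΩ,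
    fun φ hφ hc hsupp => ?_⟩
  rcases Ω.eq_empty_or_nonempty with rfl | hne
  · simp only [Measure.restrict_empty, integral_zero_measure, mul_zero]
  obtain ⟨s, hs, t, ht, hst, hφst⟩ := exists_subset_Ioo hΩ hne hc hsupp
  have hsub : Icc s t ⊆ Ω := hΩc.out hs ht
  have hφ0 : ∀ x ∉ Ioo s t, φ x = 0 := fun x hx =>
    image_eq_zero_of_notMem_tsupport fun hx' => hx (hφst hx')
  have hdφ0 : ∀ x ∉ Ioo s t, deriv φ x = 0 := fun x hx =>
    image_eq_zero_of_notMem_tsupport fun hx' => hx (hφst (tsupport_deriv_subset hx'))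
  have hrestrict {f : ℝ → ℝ} (hf : ∀ x ∉ Ioo s t, f x = 0) :
      ∫ x in Ω, f x = ∫ x in s..t, f x := by
    rw [intervalIntegral.integral_of_le hst.le]
    exact setIntegral_eq_of_subset_of_forall_sdiff_eq_zero hΩ.measurableSet
      (Ioc_subset_Icc_self.trans hsub) fun x hx => hf x fun hx' => hx.2 (Ioo_subset_Ioc_self hx')
  rw [iteratedDeriv_one, hrestrict fun x hx => by rw [hdφ0 x hx, mul_zero],
    hrestrict fun x hx => by rw [hφ0 x hx, mul_zero],
    (h.mono hsub).integral_mul_deriv hst.le (hφ.of_le (by simp)) (hφ0 s left_notMem_Ioo)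
      (hφ0 t right_notMem_Ioo), pow_one, neg_one_mul]

end IsPrimitiveOn

theorem integrable_mul_of_tsupport_subset {g φ : ℝ → ℝ} (hg : LocallyIntegrableOn g Ω)
    (hφ : Continuous φ) (hc : HasCompactSupport φ) (hs : tsupport φ ⊆ Ω) :
    Integrable (fun x => g x * φ x) := by
  rw [← integrableOn_iff_integrable_of_support_subset (s := tsupport φ)]
  · exact (hg.integrableOn_compact_subset hs hc).mul_continuousOn hφ.continuousOn hc
  · exact (Function.support_mul_subset_right g φ).trans (subset_tsupport φ)

theorem exists_contDiff_deriv_eq (hΩ : IsOpen Ω) (hΩc : OrdConnected Ω) (hne : Ω.Nonempty)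
    {θ : ℝ → ℝ} (hθ : ContDiff ℝ ∞ θ) (hc : HasCompactSupport θ) (hs : tsupport θ ⊆ Ω)
    (hθ0 : ∫ x, θ x = 0) :
    ∃ φ : ℝ → ℝ, ContDiff ℝ ∞ φ ∧ HasCompactSupport φ ∧ tsupport φ ⊆ Ω ∧ deriv φ = θ := by
  obtain ⟨s, hs, t, ht, -, hθst⟩ := exists_subset_Ioo hΩ hne hc hs
  have hzero : ∀ x ∉ Ioo s t, θ x = 0 := fun x hx =>
    image_eq_zero_of_notMem_tsupport fun hx' => hx (hθst hx')
  let φ : ℝ → ℝ := fun y => ∫ x in s..y, θ x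
  have hφ : ∀ y, HasDerivAt φ (θ y) y := fun y => hθ.continuous.integral_hasStrictDerivAt s y
    |>.hasDerivAt
  have hφ' : deriv φ = θ := funext fun y => (hφ y).deriv
  have hφ0 : ∀ y ∉ Icc s t, φ y = 0 := fun y hy => by
    rcases lt_or_ge y s with hys | hsy
    · refine (intervalIntegral.integral_congr fun x hx => ?_).trans
        intervalIntegral.integral_zero
      rw [uIcc_of_ge hys.le] at hx
      exact hzero x fun hx' => hx'.1.not_ge hx.2
    · have hty : t ≤ y := le_of_not_ge fun hyt => hy ⟨hsy, hyt⟩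
      simp only [φ]
      rw [intervalIntegral.integral_of_le hsy, setIntegral_eq_integral_of_forall_compl_eq_zero, hθ0]
      exact fun x hx => hzero x fun hx' => hx ⟨hx'.1, hx'.2.le.trans hty⟩
  have hsupp : tsupport φ ⊆ Icc s t :=
    closure_minimal (Function.support_subset_iff'.mpr hφ0) isClosed_Icc
  exact ⟨φ, contDiff_infty_iff_deriv.mpr ⟨fun y => (hφ y).differentiableAt, hφ'.symm ▸ hθ⟩,
    isCompact_Icc.of_isClosed_subset (isClosed_tsupport _) hsupp, hsupp.trans (hΩc.out hs ht), hφ'⟩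

theorem exists_contDiff_integral_eq_one (hΩ : IsOpen Ω) (hne : Ω.Nonempty) :
    ∃ η : ℝ → ℝ, ContDiff ℝ ∞ η ∧ HasCompactSupport η ∧ tsupport η ⊆ Ω ∧ ∫ x, η x = 1 := by
  obtain ⟨x₀, hx₀⟩ := hne
  obtain ⟨r, hr, hrΩ⟩ := Metric.nhds_basis_closedBall.mem_iff.mp (hΩ.mem_nhds hx₀)
  let β : ContDiffBump x₀ := ⟨r / 2, r, by positivity, by linarith⟩
  exact ⟨β.normed volume, β.contDiff_normed, β.hasCompactSupport_normed,
    β.tsupport_normed_eq.trans_subset hrΩ, β.integral_normed⟩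

namespace HasWeakDeriv

theorem trans_one (huv : HasWeakDeriv 1 Ω u v) (hvw : HasWeakDeriv 1 Ω v w) :
    HasWeakDeriv 2 Ω u w := by
  refine ⟨huv.1, hvw.2.1, fun φ hφ hc hs => ?_⟩
  have hφ' : ContDiff ℝ ∞ (deriv φ) := (contDiff_infty_iff_deriv.mp hφ).2
  rw [iteratedDeriv_succ', huv.2.2 (deriv φ) hφ' hc.deriv (tsupport_deriv_subset.trans hs),
    ← iteratedDeriv_one, hvw.2.2 φ hφ hc hs]
  ring

theorem one_of_two (huv : HasWeakDeriv 1 Ω u v) (huw : HasWeakDeriv 2 Ω u w) :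
    HasWeakDeriv 1 Ω v w := by
  refine ⟨huv.2.1, huw.2.1, fun φ hφ hc hs => ?_⟩
  have hφ' : ContDiff ℝ ∞ (deriv φ) := (contDiff_infty_iff_deriv.mp hφ).2
  have hparts := huw.2.2 φ hφ hc hs
  rw [iteratedDeriv_succ', huv.2.2 (deriv φ) hφ' hc.deriv (tsupport_deriv_subset.trans hs),
    ← iteratedDeriv_one] at hparts
  linarith

theorem sub {f g : ℝ → ℝ} (hf : HasWeakDeriv 1 Ω f v) (hg : HasWeakDeriv 1 Ω g w) :
    HasWeakDeriv 1 Ω (fun x => f x - g x) fun x => v x - w x := by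
  refine ⟨hf.1.sub hg.1, hf.2.1.sub hg.2.1, fun φ hφ hc hs => ?_⟩
  have hint {f : ℝ → ℝ} (hf : LocallyIntegrableOn f Ω) : IntegrableOn (fun x => f x * φ x) Ω :=
    (integrable_mul_of_tsupport_subset hf hφ.continuous hc hs).integrableOn
  have hint' {f : ℝ → ℝ} (hf : LocallyIntegrableOn f Ω) :
      IntegrableOn (fun x => f x * iteratedDeriv 1 φ x) Ω := by
    rw [iteratedDeriv_one]
    exact (integrable_mul_of_tsupport_subset hf (hφ.continuous_deriv (by simp)) hc.deriv
      (tsupport_deriv_subset.trans hs)).integrableOn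
  simp only [sub_mul]
  rw [integral_sub (hint' hf.1) (hint' hg.1), integral_sub (hint hf.2.1) (hint hg.2.1),
    hf.2.2 φ hφ hc hs, hg.2.2 φ hφ hc hs, mul_sub]

theorem integral_mul_eq_zero {g θ : ℝ → ℝ} (h : HasWeakDeriv 1 Ω g 0) (hΩ : IsOpen Ω)
    (hΩc : OrdConnected Ω) (hne : Ω.Nonempty) (hθ : ContDiff ℝ ∞ θ) (hc : HasCompactSupport θ)
    (hs : tsupport θ ⊆ Ω) (hθ0 : ∫ x, θ x = 0) : ∫ x, g x * θ x = 0 := by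
  obtain ⟨φ, hφ, hφc, hφs, hφ'⟩ := exists_contDiff_deriv_eq hΩ hΩc hne hθ hc hs hθ0
  have hweak := h.2.2 φ hφ hφc hφs
  simp only [iteratedDeriv_one, hφ', Pi.zero_apply, zero_mul, integral_zero, mul_zero] at hweak
  rw [← setIntegral_eq_integral_of_forall_compl_eq_zero fun x hx => ?_, hweak]
  rw [image_eq_zero_of_notMem_tsupport fun hx' => hx (hs hx'), mul_zero]

theorem exists_ae_eq_const {g : ℝ → ℝ} (h : HasWeakDeriv 1 Ω g 0) (hΩ : IsOpen Ω)
    (hΩc : OrdConnected Ω) : ∃ c, ∀ᵐ x, x ∈ Ω → g x = c := by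
  rcases Ω.eq_empty_or_nonempty with rfl | hne
  · exact ⟨0, Eventually.of_forall fun x hx => hx.elim⟩
  obtain ⟨η, hη, hηc, hηs, hη1⟩ := exists_contDiff_integral_eq_one hΩ hne
  refine ⟨∫ x, g x * η x, ?_⟩
  set c := ∫ x, g x * η x
  have hloc : LocallyIntegrableOn (fun x => g x - c) Ω :=
    h.1.sub ((locallyIntegrable_const c).locallyIntegrableOn Ω)
  refine (hΩ.ae_eq_zero_of_integral_contDiff_smul_eq_zero hloc fun ψ hψ hψc hψs => ?_).mono
    fun x hx hxΩ => sub_eq_zero.mp (hx hxΩ)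
  have hψi : Integrable ψ := hψ.continuous.integrable_of_hasCompactSupport hψc
  have hηi : Integrable η := hη.continuous.integrable_of_hasCompactSupport hηc
  have hgψ := integrable_mul_of_tsupport_subset h.1 hψ.continuous hψc hψs
  have hgη := integrable_mul_of_tsupport_subset h.1 hη.continuous hηc hηs
  -- Subtracting a multiple of `η` makes the test function `ψ` the derivative of a test function.
  set I := ∫ x, ψ x with hI
  have hmean : ∫ x, (ψ x - I * η x) = 0 := by
    rw [integral_sub hψi (hηi.const_mul I), integral_const_mul, hη1, mul_one, sub_self]
  have hηc' : HasCompactSupport fun x => I * η x := hηc.mul_left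
  have hsupp : tsupport (fun x => ψ x - I * η x) ⊆ Ω :=
    (tsupport_sub ψ _).trans (union_subset hψs ((tsupport_mul_subset_right).trans hηs))
  have hzero := h.integral_mul_eq_zero hΩ hΩc hne (hψ.sub (contDiff_const.mul hη)) (hψc.sub hηc')
    hsupp hmean
  calc ∫ x, ψ x • (g x - c) = (∫ x, g x * ψ x) - c * I := by
        rw [hI, ← integral_const_mul, ← integral_sub hgψ (hψi.const_mul c)]
        simp only [smul_eq_mul, mul_sub, mul_comm]
    _ = ∫ x, g x * (ψ x - I * η x) := by
        rw [mul_comm c, ← integral_const_mul, ← integral_sub hgψ (hgη.const_mul I)]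
        simp only [mul_sub, mul_left_comm]
    _ = 0 := hzero

theorem exists_ae_eq_integral (h : HasWeakDeriv 1 Ω u v) (hΩ : IsOpen Ω) (hΩc : OrdConnected Ω)
    (hx₀ : x₀ ∈ Ω) : ∃ c, ∀ᵐ t, t ∈ Ω → u t = c + ∫ x in x₀..t, v x := by
  have hprim := (isPrimitiveOn_integral
    (intervalIntegrable_of_locallyIntegrableOn hΩc h.2.1) hx₀ 0).hasWeakDeriv hΩ hΩc
  have hsub := h.sub hprim
  simp only [sub_self, zero_add] at hsub
  obtain ⟨c, hc⟩ := exists_ae_eq_const hsub hΩ hΩc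
  exact ⟨c, hc.mono fun t ht htΩ => sub_eq_iff_eq_add.mp (ht htΩ)⟩

theorem isPrimitiveOn (h : HasWeakDeriv 1 Ω u v) (hΩ : IsOpen Ω) (hΩc : OrdConnected Ω)
    (hu : ContinuousOn u Ω) : IsPrimitiveOn Ω u v := by
  rcases Ω.eq_empty_or_nonempty with rfl | ⟨x₀, hx₀⟩
  · exact ⟨fun s hs => hs.elim, fun s hs => hs.elim⟩
  have hv := intervalIntegrable_of_locallyIntegrableOn hΩc h.2.1
  obtain ⟨c, hc⟩ := h.exists_ae_eq_integral hΩ hΩc hx₀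
  have hprim := isPrimitiveOn_integral hv hx₀ c
  have heq : EqOn u (fun t => c + ∫ x in x₀..t, v x) Ω :=
    Measure.eqOn_open_of_ae_eq ((ae_restrict_iff' hΩ.measurableSet).mpr hc) hΩ hu
      (hprim.continuousOn hΩ hΩc)
  refine ⟨hv, fun s hs t ht => ?_⟩
  rw [heq hs, heq ht, hprim.sub_eq_integral s hs t ht]

theorem exists_hasDerivAt (huv : HasWeakDeriv 1 Ω u v) (huw : HasWeakDeriv 2 Ω u w)
    (hΩ : IsOpen Ω) (hΩc : OrdConnected Ω) (hu : ContinuousOn u Ω) :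
    ∃ u' : ℝ → ℝ, (∀ t ∈ Ω, HasDerivAt u (u' t) t) ∧ IsPrimitiveOn Ω u' w := by
  rcases Ω.eq_empty_or_nonempty with rfl | ⟨x₀, hx₀⟩
  · exact ⟨0, fun t ht => ht.elim, fun s hs => hs.elim, fun s hs => hs.elim⟩
  obtain ⟨c, hc⟩ := (huv.one_of_two huw).exists_ae_eq_integral hΩ hΩc hx₀
  have hprim := isPrimitiveOn_integral
    (intervalIntegrable_of_locallyIntegrableOn hΩc huw.2.1) hx₀ c
  exact ⟨_, fun t ht => ((huv.isPrimitiveOn hΩ hΩc hu).congr_ae hΩc hc).hasDerivAt hΩ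
    (hprim.continuousOn hΩ hΩc) ht, hprim⟩

end HasWeakDeriv

end WeakDerivatives

section RegularSystemsFromWeakDerivatives

open Set MeasureTheory

namespace IsPrimitiveOn

variable {E F : Type*} [NormedAddCommGroup E] [NormedSpace ℝ E]
  [NormedAddCommGroup F] [NormedSpace ℝ F] {Ω : Set ℝ} {u v : ℝ → E}

theorem clm_comp [CompleteSpace E] [CompleteSpace F] (h : IsPrimitiveOn Ω u v) (L : E →L[ℝ] F) :
    IsPrimitiveOn Ω (fun t => L (u t)) fun t => L (v t) where
  intervalIntegrable s hs t ht :=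
    ⟨L.integrable_comp (h.intervalIntegrable s hs t ht).1,
      L.integrable_comp (h.intervalIntegrable s hs t ht).2⟩
  sub_eq_integral s hs t ht := by
    rw [← map_sub, h.sub_eq_integral s hs t ht,
      L.intervalIntegral_comp_comm (h.intervalIntegrable s hs t ht)]

theorem add {f g : ℝ → E} (h : IsPrimitiveOn Ω u v) (h' : IsPrimitiveOn Ω f g) :
    IsPrimitiveOn Ω (fun t => u t + f t) fun t => v t + g t where
  intervalIntegrable s hs t ht :=
    (h.intervalIntegrable s hs t ht).add (h'.intervalIntegrable s hs t ht)
  sub_eq_integral s hs t ht := by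
    rw [add_sub_add_comm, h.sub_eq_integral s hs t ht, h'.sub_eq_integral s hs t ht,
      intervalIntegral.integral_add (h.intervalIntegrable s hs t ht)
        (h'.intervalIntegrable s hs t ht)]

theorem of_re_im {u v : ℝ → ℂ} (hre : IsPrimitiveOn Ω (fun t => (u t).re) fun t => (v t).re)
    (him : IsPrimitiveOn Ω (fun t => (u t).im) fun t => (v t).im) : IsPrimitiveOn Ω u v := by
  have h := (hre.clm_comp Complex.ofRealCLM).add
    (him.clm_comp (Complex.ofRealCLM.smulRight Complex.I))
  simpa [Complex.re_add_im] using h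

end IsPrimitiveOn

theorem hasDerivAt_of_re_im {u : ℝ → ℂ} {u' : ℂ} {t : ℝ}
    (hre : HasDerivAt (fun s => (u s).re) u'.re t) (him : HasDerivAt (fun s => (u s).im) u'.im t) :
    HasDerivAt u u' t := by
  have h := hre.ofReal_comp.add (him.ofReal_comp.mul_const Complex.I)
  simpa only [Complex.re_add_im, Pi.add_def] using h

variable {𝕜 n : Type*} [RCLike 𝕜] [Fintype n] {Ω : Set ℝ} {s t : ℝ}

section

variable {A' B : ℝ → Matrix n n 𝕜}

theorem intervalIntegral_sum_sum_norm
    (hB : ∀ i j, IntervalIntegrable (fun x => B x i j) volume s t) :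
    ∫ x in s..t, ∑ i, ∑ j, ‖B x i j‖ = ∑ i, ∑ j, ∫ x in s..t, ‖B x i j‖ := by
  have hsum i := IntervalIntegrable.sum Finset.univ fun j (_ : j ∈ Finset.univ) => (hB i j).norm
  simp only [Finset.sum_fn] at hsum
  rw [intervalIntegral.integral_finsetSum fun i _ => hsum i]
  exact Finset.sum_congr rfl fun i _ =>
    intervalIntegral.integral_finsetSum fun j _ => (hB i j).norm

theorem sum_norm_sub_le_integral (hA' : ∀ i j, IsPrimitiveOn Ω (A' · i j) (B · i j)) (hs : s ∈ Ω)
    (ht : t ∈ Ω) (hst : s ≤ t) :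
    ∑ i, ∑ j, ‖(A' t - A' s) i j‖ ≤ ∫ x in s..t, ∑ i, ∑ j, ‖B x i j‖ := by
  rw [intervalIntegral_sum_sum_norm fun i j => (hA' i j).intervalIntegrable s hs t ht]
  refine Finset.sum_le_sum fun i _ => Finset.sum_le_sum fun j _ => ?_
  rw [Matrix.sub_apply, (hA' i j).sub_eq_integral s hs t ht]
  exact intervalIntegral.norm_integral_le_integral_norm hst

end

variable [DecidableEq n] {A A' B : ℝ → Matrix n n 𝕜} {v v' : ℝ → n → ℝ}

theorem isRegularSystem_of_isPrimitiveOn (hΩ : IsOpen Ω) (hΩc : Convex ℝ Ω)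
    (hA : ∀ t ∈ Ω, HasDerivAt A (A' t) t) (hA' : ∀ i j, IsPrimitiveOn Ω (A' · i j) (B · i j))
    (hB : LocallyIntegrable (Ω.indicator fun x => ∑ i, ∑ j, ‖B x i j‖))
    (hv : ∀ t ∈ Ω, ∃ U, Diagonalizes U (A t) (v t)) (hv' : ∀ t ∈ Ω, HasDerivAt v (v' t) t) :
    IsRegularSystem Ω A A' (Ω.indicator fun x => ∑ i, ∑ j, ‖B x i j‖) v v' where
  isOpen := hΩ
  convex := hΩc
  locallyIntegrable := hB
  nonneg := indicator_nonneg fun x _ => by positivity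
  hasDerivAt_curve := hA
  sum_norm_sub_le s hs t ht hst := by
    refine (sum_norm_sub_le_integral hA' hs ht hst).trans_eq
      (intervalIntegral.integral_congr fun x hx => ?_)
    rw [indicator_of_mem (hΩc.ordConnected.uIcc_subset hs ht hx)]
  diagonalizesJet t ht := exists_diagonalizesJet_of_hasDerivAt (hA t ht)
    (eventually_of_mem (hΩ.mem_nhds ht) hv) (hv' t ht)
  hasDerivAt := hv'

namespace IsRegularSystem

variable {W : ℝ → ℝ}

theorem hasWeakDeriv (h : IsRegularSystem Ω A A' W v v') (j : n) :
    HasWeakDeriv 1 Ω (fun t => v t j) (fun t => v' t j) ∧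
      HasWeakDeriv 2 Ω (fun t => v t j) (deriv fun t => v' t j) := by
  have hprim : IsPrimitiveOn Ω (fun t => v t j) fun t => v' t j :=
    isPrimitiveOn_of_hasDerivAt h.convex.ordConnected
      (fun t ht => hasDerivAt_pi.mp (h.hasDerivAt t ht) j) fun t ht =>
        (tendsto_pi_nhds.mp (h.continuousAt_derivative ht) j).mono_left nhdsWithin_le_nhds
  have hweak := hprim.hasWeakDeriv h.isOpen h.convex.ordConnected
  exact ⟨hweak, hweak.trans_one
    ((h.isPrimitiveOn_derivative j).hasWeakDeriv h.isOpen h.convex.ordConnected)⟩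

theorem norm_derivative_le (h : IsRegularSystem Ω A A' W v v') (ht : t ∈ Ω) :
    ‖v' t‖ ≤ ∑ i, ∑ j, ‖A' t i j‖ := by
  obtain ⟨U, hU⟩ := h.diagonalizesJet t ht
  refine (pi_norm_le_iff_of_nonneg (by positivity)).mpr fun j => ?_
  rw [← hU.re_conjTranspose_mul_mul_apply_self j, Real.norm_eq_abs]
  exact (RCLike.abs_re_le_norm _).trans (norm_conjTranspose_mul_mul_apply_le
    hU.conjTranspose_mul_self hU.conjTranspose_mul_self _ j j)

end IsRegularSystem

theorem Diagonalizes.norm_le {M U : Matrix n n 𝕜} {x : n → ℝ} (h : Diagonalizes U M x) :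
    ‖x‖ ≤ ∑ i, ∑ j, ‖M i j‖ := by
  refine (pi_norm_le_iff_of_nonneg (by positivity)).mpr fun j => ?_
  rw [← h.re_conjTranspose_mul_mul_apply_self j, Real.norm_eq_abs]
  exact (RCLike.abs_re_le_norm _).trans (norm_conjTranspose_mul_mul_apply_le
    h.conjTranspose_mul_self h.conjTranspose_mul_self _ j j)

end RegularSystemsFromWeakDerivatives

section RegularityOnTheLine

open Set MeasureTheory

variable {d : ℕ} {A : ℝ → Matrix (Fin d) (Fin d) ℂ} {Ω : Set ℝ}

theorem DCOn.continuousOn {E : Type*} [AddCommGroup E] [Module ℝ E] [TopologicalSpace E]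
    {U : Set E} {f : E → ℝ} (h : DCOn U f) : ContinuousOn f U := by
  obtain ⟨g, k, hg, -, hk, -, hf⟩ := h
  exact (hg.sub hk).congr hf

theorem exists_hasDerivAt_of_memW21Loc (hΩ : IsOpen Ω) (hΩc : OrdConnected Ω)
    (hA : Componentwise (fun f => ContinuousOn f Ω) A) (hW : Componentwise (MemW21Loc Ω) A) :
    ∃ A' B : ℝ → Matrix (Fin d) (Fin d) ℂ, (∀ t ∈ Ω, HasDerivAt A (A' t) t) ∧
      ∀ i j, IsPrimitiveOn Ω (A' · i j) (B · i j) := by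
  choose p P hp hP using fun i j => (hW i j).1
  choose q Q hq hQ using fun i j => (hW i j).2
  choose re' hre hre' using fun i j => (hp i j).exists_hasDerivAt (hP i j) hΩ hΩc (hA i j).1
  choose im' him him' using fun i j => (hq i j).exists_hasDerivAt (hQ i j) hΩ hΩc (hA i j).2
  refine ⟨fun t => of fun i j => ⟨re' i j t, im' i j t⟩, fun t => of fun i j => ⟨P i j t, Q i j t⟩,
    fun t ht => hasDerivAt_matrix.mpr fun i j => ?_, fun i j => ?_⟩
  · exact hasDerivAt_of_re_im (hre i j t ht) (him i j t ht)
  · exact .of_re_im (hre' i j) (him' i j)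

theorem regularity_of_differentiable_system (hH : ∀ t, (A t).IsHermitian)
    (hDC : Componentwise (DCOn univ) A) (hW : Componentwise (MemW21Loc univ) A)
    {ev : Fin d → ℝ → ℝ} (hev : ∀ t, IsEigenvalueTuple (A t) fun j => ev j t)
    (hd : ∀ j, Differentiable ℝ (ev j)) (j : Fin d) :
    ContDiff ℝ 1 (ev j) ∧ DCOn univ (ev j) ∧ MemW21Loc univ (ev j) := by
  obtain ⟨A', B, hA, hA'⟩ := exists_hasDerivAt_of_memW21Loc isOpen_univ ordConnected_univ
    (fun i j => ⟨(hDC i j).1.continuousOn, (hDC i j).2.continuousOn⟩) hW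
  have hB : LocallyIntegrable fun x => ∑ i, ∑ j, ‖B x i j‖ :=
    locallyIntegrable_finsetSum _ fun i _ => locallyIntegrable_finsetSum _ fun j _ =>
      locallyIntegrableOn_univ.mp ((hA' i j).locallyIntegrableOn isOpen_univ).norm
  have h := isRegularSystem_of_isPrimitiveOn isOpen_univ convex_univ hA hA'
    (by rwa [indicator_univ]) (fun t _ => (hev t).exists_diagonalizes (hH t))
    fun t _ => hasDerivAt_pi.mpr fun j => (hd j t).hasDerivAt
  refine ⟨contDiff_one_iff_deriv.mpr ⟨hd j, continuous_iff_continuousAt.mpr fun t => ?_⟩, h.dcOn j,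
    _, _, h.hasWeakDeriv j⟩
  exact tendsto_pi_nhds.mp (h.continuousAt_derivative (mem_univ t)) j

theorem exists_hasDerivAt_continuous_of_contDiff (hA : Componentwise (ContDiff ℝ 1) A) :
    ∃ A', (∀ t, HasDerivAt A (A' t) t) ∧ Continuous A' := by
  have hre i j := contDiff_one_iff_deriv.mp (hA i j).1
  have him i j := contDiff_one_iff_deriv.mp (hA i j).2
  refine ⟨fun t => of fun i j => ⟨deriv (fun s => (A s i j).re) t, deriv (fun s => (A s i j).im) t⟩,
    fun t => hasDerivAt_matrix.mpr fun i j => ?_, continuous_matrix fun i j => ?_⟩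
  · exact hasDerivAt_of_re_im ((hre i j).1 t).hasDerivAt ((him i j).1 t).hasDerivAt
  · exact Complex.equivRealProdCLM.symm.continuous.comp ((hre i j).2.prodMk (him i j).2)

end RegularityOnTheLine

section UniformBounds

open Set MeasureTheory
open scoped NNReal

theorem abs_derivWithin_Ioi_le_of_lipschitzOnWith {g : ℝ → ℝ} {s : Set ℝ} {t : ℝ} {L : ℝ≥0}
    (hg : LipschitzOnWith L g s) (hs : s ∈ 𝓝 t) : |derivWithin g (Ioi t) t| ≤ L := by
  by_cases hd : DifferentiableWithinAt ℝ g (Ioi t) t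
  · refine le_of_tendsto ((hasDerivWithinAt_iff_tendsto_slope' self_notMem_Ioi).mp
      hd.hasDerivWithinAt).abs ?_
    filter_upwards [self_mem_nhdsWithin, mem_nhdsWithin_of_mem_nhds hs] with y hty hy
    rw [slope_def_field, abs_div, div_le_iff₀ (abs_pos.mpr (sub_pos.mpr hty).ne')]
    exact hg.dist_le_mul y hy t (mem_of_mem_nhds hs)
  · rw [derivWithin_zero_of_not_differentiableWithinAt hd, abs_zero]
    exact L.coe_nonneg

section ConvexDifference

variable {α β : ℝ} {L : ℝ≥0} {f g h f' w : ℝ → ℝ}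

theorem derivative_eq_derivWithin_Ioi_sub (hg : ConvexOn ℝ (Ioo α β) g)
    (hh : ConvexOn ℝ (Ioo α β) h) (hf : ∀ x ∈ Ioo α β, f x = g x - h x) {t c : ℝ}
    (ht : t ∈ Ioo α β) (hf' : HasDerivAt f c t) :
    c = derivWithin g (Ioi t) t - derivWithin h (Ioi t) t := by
  have ht' : t ∈ interior (Ioo α β) := by rwa [interior_Ioo]
  refine (uniqueDiffWithinAt_Ioi t).eq_deriv _ hf'.hasDerivWithinAt
    (((hg.hasDerivWithinAt_rightDeriv_of_mem_interior ht').sub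
      (hh.hasDerivWithinAt_rightDeriv_of_mem_interior ht')).congr_of_eventuallyEq ?_ (hf t ht))
  filter_upwards [mem_nhdsWithin_of_mem_nhds (isOpen_Ioo.mem_nhds ht)] with y hy using hf y hy

/-- The derivative of `g - h` varies at most as much as the sum of the one-sided derivatives of `g`
and `h`, which is monotone. -/
theorem lintegral_enorm_le_of_convexOn_sub (hg : ConvexOn ℝ (Ioo α β) g)
    (hh : ConvexOn ℝ (Ioo α β) h) (hgL : LipschitzOnWith L g (Ioo α β))
    (hhL : LipschitzOnWith L h (Ioo α β)) (hf : ∀ x ∈ Ioo α β, f x = g x - h x)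
    (hf' : ∀ t ∈ Ioo α β, HasDerivAt f (f' t) t) (hw : IsPrimitiveOn (Ioo α β) f' w) :
    ∫⁻ x in Ioo α β, ‖w x‖ₑ ≤ ENNReal.ofReal (4 * L) := by
  have hg' := hg.monotoneOn_rightDeriv
  have hh' := hh.monotoneOn_rightDeriv
  rw [interior_Ioo] at hg' hh'
  have heq (t) (ht : t ∈ Ioo α β) := derivative_eq_derivWithin_Ioi_sub hg hh hf ht (hf' t ht)
  have hgb (t) (ht : t ∈ Ioo α β) := abs_le.mp
    (abs_derivWithin_Ioi_le_of_lipschitzOnWith hgL (isOpen_Ioo.mem_nhds ht))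
  have hhb (t) (ht : t ∈ Ioo α β) := abs_le.mp
    (abs_derivWithin_Ioi_le_of_lipschitzOnWith hhL (isOpen_Ioo.mem_nhds ht))
  refine lintegral_enorm_Ioo_le_of_majorant
    (K := fun t => derivWithin g (Ioi t) t + derivWithin h (Ioi t) t) hw
    (fun s hs t ht hst => ?_) fun s hs t ht _ => ?_
  · rw [heq s hs, heq t ht, abs_le]
    constructor <;> linarith [hg' hs ht hst, hh' hs ht hst]
  · linarith [hgb s hs, hgb t ht, hhb s hs, hhb t ht]

end ConvexDifference

/-- The function `u` is bounded by `C` on `S`, and so are its first derivative on `Ω ∩ S` and the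
`L¹` norm of its second derivative on `Ω ∩ S`, provided that these derivatives exist on `Ω`. -/
structure HasJetBound (Ω S : Set ℝ) (C : ℝ) (u : ℝ → ℝ) : Prop where
  abs_le : ∀ t ∈ S, |u t| ≤ C
  abs_derivative_le : ∀ t ∈ Ω ∩ S, ∀ c, HasDerivAt u c t → |c| ≤ C
  lintegral_enorm_le : ∀ u' w : ℝ → ℝ, (∀ t ∈ Ω, HasDerivAt u (u' t) t) → IsPrimitiveOn Ω u' w →
    ∫⁻ x in Ω ∩ S, ‖w x‖ₑ ≤ ENNReal.ofReal C

namespace HasJetBound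

variable {Ω S T : Set ℝ} {C D : ℝ} {u : ℝ → ℝ}

theorem empty : HasJetBound Ω ∅ C u where
  abs_le _ ht := ht.elim
  abs_derivative_le _ ht := ht.2.elim
  lintegral_enorm_le _ _ _ _ := by
    rw [inter_empty, Measure.restrict_empty, lintegral_zero_measure]
    exact zero_le

theorem mono (h : HasJetBound Ω T C u) (hST : S ⊆ T) (hCD : C ≤ D) : HasJetBound Ω S D u where
  abs_le t ht := (h.abs_le t (hST ht)).trans hCD
  abs_derivative_le t ht c hc := (h.abs_derivative_le t ⟨ht.1, hST ht.2⟩ c hc).trans hCD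
  lintegral_enorm_le u' w hu hw := (lintegral_mono_set (inter_subset_inter_right Ω hST)).trans
    ((h.lintegral_enorm_le u' w hu hw).trans (ENNReal.ofReal_le_ofReal hCD))

theorem union (hS : HasJetBound Ω S C u) (hT : HasJetBound Ω T D u) (hC : 0 ≤ C) (hD : 0 ≤ D) :
    HasJetBound Ω (S ∪ T) (C + D) u where
  abs_le t ht := ht.elim (fun h => (hS.abs_le t h).trans (le_add_of_nonneg_right hD))
    fun h => (hT.abs_le t h).trans (le_add_of_nonneg_left hC)
  abs_derivative_le t ht c hc := ht.2.elim
    (fun h => (hS.abs_derivative_le t ⟨ht.1, h⟩ c hc).trans (le_add_of_nonneg_right hD))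
    fun h => (hT.abs_derivative_le t ⟨ht.1, h⟩ c hc).trans (le_add_of_nonneg_left hC)
  lintegral_enorm_le u' w hu hw := by
    rw [inter_union_distrib_left, ENNReal.ofReal_add hC hD]
    exact (lintegral_union_le _ _ _).trans
      (add_le_add (hS.lintegral_enorm_le u' w hu hw) (hT.lintegral_enorm_le u' w hu hw))

theorem of_convexOn_sub {a b α β : ℝ} {L : ℝ≥0} {g h : ℝ → ℝ} (hg : ConvexOn ℝ (Ioo α β) g)
    (hh : ConvexOn ℝ (Ioo α β) h) (hgL : LipschitzOnWith L g (Ioo α β))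
    (hhL : LipschitzOnWith L h (Ioo α β)) (hu : ∀ x ∈ Ioo α β, u x = g x - h x)
    (huC : ∀ x ∈ Ioo α β, |u x| ≤ C) (hLC : 4 * L ≤ C) :
    HasJetBound (Ioo a b) (Ioo α β) C u where
  abs_le := huC
  abs_derivative_le t ht c hc := by
    have hgt := abs_derivWithin_Ioi_le_of_lipschitzOnWith hgL (isOpen_Ioo.mem_nhds ht.2)
    have hht := abs_derivWithin_Ioi_le_of_lipschitzOnWith hhL (isOpen_Ioo.mem_nhds ht.2)
    rw [derivative_eq_derivWithin_Ioi_sub hg hh hu ht.2 hc]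
    linarith [abs_sub (derivWithin g (Ioi t) t) (derivWithin h (Ioi t) t), L.coe_nonneg]
  lintegral_enorm_le u' w hu' hw := by
    rw [Ioo_inter_Ioo]
    have hsub : Ioo (max a α) (min b β) ⊆ Ioo α β :=
      Ioo_subset_Ioo (le_max_right _ _) (min_le_right _ _)
    have hsub' : Ioo (max a α) (min b β) ⊆ Ioo a b :=
      Ioo_subset_Ioo (le_max_left _ _) (min_le_left _ _)
    exact (lintegral_enorm_le_of_convexOn_sub (hg.subset hsub (convex_Ioo _ _))
      (hh.subset hsub (convex_Ioo _ _)) (hgL.mono hsub) (hhL.mono hsub) (fun x hx => hu x (hsub hx))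
      (fun t ht => hu' t (hsub' ht)) (hw.mono hsub')).trans (ENNReal.ofReal_le_ofReal hLC)

end HasJetBound

namespace LocallyDCOn

theorem exists_ball {E : Type*} [NormedAddCommGroup E] [NormedSpace ℝ E] [FiniteDimensional ℝ E]
    {U : Set E} {f : E → ℝ} {p : E} (hf : LocallyDCOn U f) (hU : U ∈ 𝓝 p) :
    ∃ ρ > 0, ∃ L : ℝ≥0, ∃ g h : E → ℝ, ConvexOn ℝ (Metric.ball p ρ) g ∧
      ConvexOn ℝ (Metric.ball p ρ) h ∧ LipschitzOnWith L g (Metric.ball p ρ) ∧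
      LipschitzOnWith L h (Metric.ball p ρ) ∧ ∀ x ∈ Metric.ball p ρ, f x = g x - h x := by
  obtain ⟨V, hV, -, -, g, h, -, hg, -, hh, hfgh⟩ := hf p (mem_of_mem_nhds hU)
  rw [nhdsWithin_eq_nhds.mpr hU] at hV
  have hlip {g : E → ℝ} (hg : ConvexOn ℝ V g) : ∃ L : ℝ≥0, ∃ T ∈ 𝓝 p, LipschitzOnWith L g T := by
    obtain ⟨L, T, hT, hL⟩ := (hg.subset interior_subset hg.1.interior).locallyLipschitzOn
      isOpen_interior (mem_interior_iff_mem_nhds.mpr hV)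
    rw [isOpen_interior.nhdsWithin_eq (mem_interior_iff_mem_nhds.mpr hV)] at hT
    exact ⟨L, T, hT, hL⟩
  obtain ⟨L, S, hS, hgL⟩ := hlip hg
  obtain ⟨M, T, hT, hhM⟩ := hlip hh
  obtain ⟨ρ, hρ, hball⟩ := Metric.mem_nhds_iff.mp (inter_mem hV (inter_mem hS hT))
  obtain ⟨hρV, hρS, hρT⟩ : Metric.ball p ρ ⊆ V ∧ Metric.ball p ρ ⊆ S ∧ Metric.ball p ρ ⊆ T :=
    ⟨fun x hx => (hball hx).1, fun x hx => (hball hx).2.1, fun x hx => (hball hx).2.2⟩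
  exact ⟨ρ, hρ, max L M, g, h, hg.subset hρV (convex_ball p ρ), hh.subset hρV (convex_ball p ρ),
    (hgL.mono hρS).weaken (le_max_left _ _), (hhM.mono hρT).weaken (le_max_right _ _),
    fun x hx => hfgh x (hρV hx)⟩

variable {F : Type*} [NormedAddCommGroup F] [NormedSpace ℝ F] [FiniteDimensional ℝ F]
  {U : Set (ℝ × F)} {f : ℝ × F → ℝ} {a b : ℝ}

theorem exists_ball_hasJetBound {p : ℝ × F} (hf : LocallyDCOn U f) (hU : U ∈ 𝓝 p) :
    ∃ S ∈ 𝓝 p, ∃ C, 0 ≤ C ∧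
      ∀ r, HasJetBound (Ioo a b) ((·, r) ⁻¹' S) C fun t => f (t, r) := by
  obtain ⟨ρ, hρ, L, g, h, hg, hh, hgL, hhL, hfgh⟩ := hf.exists_ball hU
  refine ⟨_, Metric.ball_mem_nhds p hρ, |f p| + 2 * L * ρ + 4 * L, by positivity, fun r => ?_⟩
  have hslice : (·, r) ⁻¹' Metric.ball p ρ = Ioo (p.1 - ρ) (p.1 + ρ) ∨
      (·, r) ⁻¹' Metric.ball p ρ = ∅ := by
    rw [← ball_prod_same p.1 p.2 ρ, ← Real.ball_eq_Ioo]
    by_cases hr : r ∈ Metric.ball p.2 ρ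
    · exact .inl (mk_preimage_prod_left hr)
    · exact .inr (mk_preimage_prod_left_eq_empty hr)
  rcases hslice with hslice | hslice
  swap
  · rw [hslice]
    exact .empty
  have hmaps : MapsTo (·, r) (Ioo (p.1 - ρ) (p.1 + ρ)) (Metric.ball p ρ) := hslice.ge
  have hconv {g : ℝ × F → ℝ} (hg : ConvexOn ℝ (Metric.ball p ρ) g) :
      ConvexOn ℝ (Ioo (p.1 - ρ) (p.1 + ρ)) fun t => g (t, r) :=
    hslice ▸ hg.comp_affineMap ((AffineMap.id ℝ ℝ).prod (AffineMap.const ℝ ℝ r))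
  have hlip {g : ℝ × F → ℝ} (hg : LipschitzOnWith L g (Metric.ball p ρ)) :
      LipschitzOnWith L (fun t => g (t, r)) (Ioo (p.1 - ρ) (p.1 + ρ)) := by
    simpa only [mul_one, Function.comp_def] using
      hg.comp (LipschitzWith.prodMk_right r).lipschitzOnWith hmaps
  rw [hslice]
  refine .of_convexOn_sub (hconv hg) (hconv hh) (hlip hgL) (hlip hhL)
    (fun t ht => hfgh _ (hmaps ht)) (fun t ht => ?_) (le_add_of_nonneg_left (by positivity))
  have hx : dist (t, r) p < ρ := hmaps ht
  have hp : p ∈ Metric.ball p ρ := Metric.mem_ball_self hρ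
  have hgp := (hgL.dist_le_mul _ hx _ hp).trans (mul_le_mul_of_nonneg_left hx.le L.coe_nonneg)
  have hhp := (hhL.dist_le_mul _ hx _ hp).trans (mul_le_mul_of_nonneg_left hx.le L.coe_nonneg)
  rw [Real.dist_eq, abs_le] at hgp hhp
  rw [abs_le, hfgh _ hx]
  constructor <;> linarith [neg_abs_le (f p), le_abs_self (f p), hfgh p hp, L.coe_nonneg]

theorem exists_slice_hasJetBound {K : Set (ℝ × F)} (hf : LocallyDCOn U f) (hU : IsOpen U)
    (hK : IsCompact K) (hKU : K ⊆ U) :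
    ∃ C, 0 ≤ C ∧ ∀ r, HasJetBound (Ioo a b) ((·, r) ⁻¹' K) C fun t => f (t, r) := by
  refine hK.induction_on (p := fun S => ∃ C, 0 ≤ C ∧
    ∀ r, HasJetBound (Ioo a b) ((·, r) ⁻¹' S) C fun t => f (t, r)) ?_ ?_ ?_ fun p hp => ?_
  · exact ⟨0, le_rfl, fun r => .empty⟩
  · rintro S T hST ⟨C, hC, h⟩
    exact ⟨C, hC, fun r => (h r).mono (preimage_mono hST) le_rfl⟩
  · rintro S T ⟨C, hC, hS⟩ ⟨D, hD, hT⟩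
    exact ⟨C + D, add_nonneg hC hD, fun r => (hS r).union (hT r) hC hD⟩
  · obtain ⟨S, hS, h⟩ := hf.exists_ball_hasJetBound (hU.mem_nhds (hKU hp))
    exact ⟨S, mem_nhdsWithin_of_mem_nhds hS, h⟩

end LocallyDCOn

end UniformBounds

section UniformSystems

open Set MeasureTheory

namespace HasJetBound

variable {Ω S : Set ℝ} {C : ℝ} {u : ℝ → ℂ}

theorem norm_le (hre : HasJetBound Ω S C fun t => (u t).re)
    (him : HasJetBound Ω S C fun t => (u t).im) {t : ℝ} (ht : t ∈ S) : ‖u t‖ ≤ 2 * C := by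
  linarith [Complex.norm_le_abs_re_add_abs_im (u t), hre.abs_le t ht, him.abs_le t ht]

theorem norm_derivative_le (hre : HasJetBound Ω S C fun t => (u t).re)
    (him : HasJetBound Ω S C fun t => (u t).im) {t : ℝ} (ht : t ∈ Ω ∩ S) {c : ℂ}
    (hu : HasDerivAt u c t) : ‖c‖ ≤ 2 * C := by
  have hcre := hre.abs_derivative_le t ht c.re (Complex.reCLM.hasFDerivAt.comp_hasDerivAt t hu)
  have hcim := him.abs_derivative_le t ht c.im (Complex.imCLM.hasFDerivAt.comp_hasDerivAt t hu)
  linarith [Complex.norm_le_abs_re_add_abs_im c]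

theorem lintegral_enorm_le_two_mul (hre : HasJetBound Ω S C fun t => (u t).re)
    (him : HasJetBound Ω S C fun t => (u t).im) (hC : 0 ≤ C) (hΩ : IsOpen Ω) {u' w : ℝ → ℂ}
    (hu : ∀ t ∈ Ω, HasDerivAt u (u' t) t) (hw : IsPrimitiveOn Ω u' w) :
    ∫⁻ x in Ω ∩ S, ‖w x‖ₑ ≤ ENNReal.ofReal (2 * C) := by
  have hwre := hre.lintegral_enorm_le _ _
    (fun t ht => Complex.reCLM.hasFDerivAt.comp_hasDerivAt t (hu t ht)) (hw.clm_comp Complex.reCLM)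
  have hwim := him.lintegral_enorm_le _ _
    (fun t ht => Complex.imCLM.hasFDerivAt.comp_hasDerivAt t (hu t ht)) (hw.clm_comp Complex.imCLM)
  have hmeas : AEStronglyMeasurable (fun x => (w x).re) (volume.restrict (Ω ∩ S)) :=
    Complex.continuous_re.comp_aestronglyMeasurable
      ((hw.locallyIntegrableOn hΩ).aestronglyMeasurable.mono_measure
        (Measure.restrict_mono_set _ inter_subset_left))
  calc ∫⁻ x in Ω ∩ S, ‖w x‖ₑ ≤ ∫⁻ x in Ω ∩ S, (‖(w x).re‖ₑ + ‖(w x).im‖ₑ) :=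
        lintegral_mono fun x => by
          have h := ENNReal.ofReal_le_ofReal (Complex.norm_le_abs_re_add_abs_im (w x))
          rwa [ENNReal.ofReal_add (abs_nonneg _) (abs_nonneg _), ofReal_norm,
            ← Real.enorm_eq_ofReal_abs, ← Real.enorm_eq_ofReal_abs] at h
    _ = (∫⁻ x in Ω ∩ S, ‖(w x).re‖ₑ) + ∫⁻ x in Ω ∩ S, ‖(w x).im‖ₑ :=
        lintegral_add_left' hmeas.enorm _
    _ ≤ ENNReal.ofReal C + ENNReal.ofReal C := add_le_add hwre hwim
    _ = ENNReal.ofReal (2 * C) := by rw [two_mul, ENNReal.ofReal_add hC hC]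

end HasJetBound

theorem setIntegral_norm_le_of_lintegral_enorm_le {E : Type*} [NormedAddCommGroup E] {α : Type*}
    [MeasurableSpace α] {μ : Measure α} {w : α → E} {C : ℝ} (hC : 0 ≤ C)
    (hw : AEStronglyMeasurable w μ) (h : ∫⁻ x, ‖w x‖ₑ ∂μ ≤ ENNReal.ofReal C) (s : Set α) :
    ∫ x in s, ‖w x‖ ∂μ ≤ C := by
  rw [integral_norm_eq_lintegral_enorm hw.restrict]
  exact ENNReal.toReal_le_of_le_ofReal hC ((setLIntegral_le_lintegral s _).trans h)

section

variable {m n : Type*} [Fintype m] [Fintype n]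

theorem sum_sum_le_card_mul_card_mul {x : m → n → ℝ} {C : ℝ} (h : ∀ i j, x i j ≤ C) :
    ∑ i, ∑ j, x i j ≤ Fintype.card m * Fintype.card n * C := by
  calc ∑ i, ∑ j, x i j ≤ ∑ _i : m, ∑ _j : n, C :=
        Finset.sum_le_sum fun i _ => Finset.sum_le_sum fun j _ => h i j
    _ = Fintype.card m * Fintype.card n * C := by
        simp only [Finset.sum_const, Finset.card_univ, nsmul_eq_mul, mul_assoc]

theorem le_sum_sum {x : m → n → ℝ} (h : ∀ i j, 0 ≤ x i j) (i : m) (j : n) :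
    x i j ≤ ∑ i, ∑ j, x i j :=
  (Finset.single_le_sum (fun j _ => h i j) (Finset.mem_univ j)).trans
    (Finset.single_le_sum (f := fun i => ∑ j, x i j)
      (fun i _ => Finset.sum_nonneg fun j _ => h i j) (Finset.mem_univ i))

end

theorem setLIntegral_enorm_le_of_abs_le {u : ℝ → ℝ} {a b D : ℝ} (hD : 0 ≤ D)
    (hu : ∀ t ∈ Ioo a b, |u t| ≤ D) :
    ∫⁻ x in Ioo a b, ‖u x‖ₑ ≤ ENNReal.ofReal (D * (b - a)) := by
  calc ∫⁻ x in Ioo a b, ‖u x‖ₑ ≤ ∫⁻ _x in Ioo a b, ENNReal.ofReal D :=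
        setLIntegral_mono measurable_const fun x hx => by
          rw [Real.enorm_eq_ofReal_abs]
          exact ENNReal.ofReal_le_ofReal (hu x hx)
    _ = ENNReal.ofReal (D * (b - a)) := by
        rw [setLIntegral_const, Real.volume_Ioo, ENNReal.ofReal_mul hD]

theorem abs_derivWithin_Icc_le {u : ℝ → ℝ} {a b D : ℝ} (hab : a < b)
    (hu : ContDiffOn ℝ 1 u (Icc a b)) (hD : ∀ t ∈ Ioo a b, |deriv u t| ≤ D) :
    ∀ t ∈ Icc a b, |derivWithin u (Icc a b) t| ≤ D := by
  have hmaps : MapsTo (derivWithin u (Icc a b)) (Ioo a b) (Icc (-D) D) := fun x hx => by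
    rw [derivWithin_of_mem_nhds (Icc_mem_nhds hx.1 hx.2)]
    exact abs_le.mp (hD x hx)
  have hcont := hu.continuousOn_derivWithin (uniqueDiffOn_Icc hab) le_rfl
  have hclosure := hmaps.closure_of_continuousOn (by rwa [closure_Ioo hab.ne])
  rw [closure_Ioo hab.ne, closure_Icc] at hclosure
  exact fun t ht => abs_le.mpr (hclosure ht)

theorem IsRegularSystem.w21norm_le {𝕜 n : Type*} [RCLike 𝕜] [Fintype n] [DecidableEq n]
    {A A' : ℝ → Matrix n n 𝕜} {v v' : ℝ → n → ℝ} {W : ℝ → ℝ} {a b D : ℝ}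
    (h : IsRegularSystem (Ioo a b) A A' W v v') (hD : 0 ≤ D) (hab : a ≤ b)
    (hv : ∀ t ∈ Ioo a b, ‖v t‖ ≤ D) (hv' : ∀ t ∈ Ioo a b, ‖v' t‖ ≤ D)
    (hW : ∀ s ∈ Ioo a b, ∀ t ∈ Ioo a b, s ≤ t → ∫ x in s..t, W x ≤ D) (j : n) :
    W21norm (Ioo a b) (fun t => v t j) ≤
      ENNReal.ofReal (D * (2 * (b - a) + Fintype.card n * (6 * Fintype.card n + 1))) := by
  have hDab : 0 ≤ D * (b - a) := mul_nonneg hD (sub_nonneg.mpr hab)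
  have hsum : D * (2 * (b - a) + Fintype.card n * (6 * Fintype.card n + 1)) =
      D * (b - a) + D * (b - a) + (4 * Fintype.card n * Fintype.card n * D +
        Fintype.card n * (2 * Fintype.card n + 1) * D) := by ring
  refine (iInf₂_le _ _).trans ((iInf_le _ (h.hasWeakDeriv j)).trans ?_)
  rw [hsum, ENNReal.ofReal_add (by positivity) (by positivity), ENNReal.ofReal_add hDab hDab]
  exact add_le_add (add_le_add
    (setLIntegral_enorm_le_of_abs_le hD fun t ht => (norm_le_pi_norm (v t) j).trans (hv t ht))
    (setLIntegral_enorm_le_of_abs_le hD fun t ht => (norm_le_pi_norm (v' t) j).trans (hv' t ht)))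
    (h.lintegral_enorm_deriv_derivative_le j hv' hW)

section

variable {d : ℕ} {a b C : ℝ} {A : ℝ → Matrix (Fin d) (Fin d) ℂ}

theorem sum_norm_le_of_hasJetBound {Ω S : Set ℝ} (hb : Componentwise (HasJetBound Ω S C) A) {t : ℝ}
    (ht : t ∈ S) : ∑ i, ∑ j, ‖A t i j‖ ≤ d * d * (2 * C) := by
  simpa only [Fintype.card_fin] using
    sum_sum_le_card_mul_card_mul fun i j => (hb i j).1.norm_le (hb i j).2 ht

theorem sum_norm_derivative_le_of_hasJetBound {Ω S : Set ℝ}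
    (hb : Componentwise (HasJetBound Ω S C) A) {t : ℝ} (ht : t ∈ Ω ∩ S)
    {M : Matrix (Fin d) (Fin d) ℂ} (hA : HasDerivAt A M t) :
    ∑ i, ∑ j, ‖M i j‖ ≤ d * d * (2 * C) := by
  simpa only [Fintype.card_fin] using sum_sum_le_card_mul_card_mul fun i j =>
    (hb i j).1.norm_derivative_le (hb i j).2 ht (hasDerivAt_matrix.mp hA i j)

theorem integrableOn_of_hasJetBound (hC : 0 ≤ C)
    (hb : Componentwise (HasJetBound (Ioo a b) (Icc a b) C) A)
    {A' B : ℝ → Matrix (Fin d) (Fin d) ℂ} (hA : ∀ t ∈ Ioo a b, HasDerivAt A (A' t) t)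
    (hA' : ∀ i j, IsPrimitiveOn (Ioo a b) (A' · i j) (B · i j)) :
    (∀ i j, IntegrableOn (B · i j) (Ioo a b)) ∧ ∀ s ∈ Ioo a b, ∀ t ∈ Ioo a b, s ≤ t →
      ∫ x in s..t, ∑ i, ∑ j, ‖B x i j‖ ≤ d * d * (2 * C) := by
  have hmeas i j := ((hA' i j).locallyIntegrableOn isOpen_Ioo).aestronglyMeasurable
  have hle i j := (hb i j).1.lintegral_enorm_le_two_mul (hb i j).2 hC isOpen_Ioo
    (fun t ht => hasDerivAt_matrix.mp (hA t ht) i j) (hA' i j)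
  simp only [inter_eq_left.mpr Ioo_subset_Icc_self] at hle
  refine ⟨fun i j => ⟨hmeas i j, (hle i j).trans_lt ENNReal.ofReal_lt_top⟩, fun s hs t ht hst => ?_⟩
  rw [intervalIntegral_sum_sum_norm fun i j => (hA' i j).intervalIntegrable s hs t ht]
  refine (sum_sum_le_card_mul_card_mul (C := 2 * C) fun i j => ?_).trans_eq
    (by rw [Fintype.card_fin])
  have h := setIntegral_norm_le_of_lintegral_enorm_le (by positivity) (hmeas i j) (hle i j)
    (Ioc s t)
  have hsub : Ioc s t ⊆ Ioo a b := fun x hx => ⟨hs.1.trans hx.1, hx.2.trans_lt ht.2⟩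
  rwa [Measure.restrict_restrict measurableSet_Ioc, inter_eq_left.mpr hsub,
    ← intervalIntegral.integral_of_le hst] at h

section

variable {ev : Fin d → ℝ → ℝ}

theorem exists_isRegularSystem_of_hasJetBound (hC : 0 ≤ C)
    (hA : Componentwise (fun f => ContinuousOn f (Ioo a b)) A)
    (hW : Componentwise (MemW21Loc (Ioo a b)) A)
    (hb : Componentwise (HasJetBound (Ioo a b) (Icc a b) C) A)
    (hev : ∀ t ∈ Ioo a b, ∃ U, Diagonalizes U (A t) fun j => ev j t)
    (hd : ∀ j, DifferentiableOn ℝ (ev j) (Ioo a b)) :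
    ∃ A' W, IsRegularSystem (Ioo a b) A A' W (fun t j => ev j t) (fun t j => deriv (ev j) t) ∧
      ∀ s ∈ Ioo a b, ∀ t ∈ Ioo a b, s ≤ t → ∫ x in s..t, W x ≤ d * d * (2 * C) := by
  obtain ⟨A', B, hAA', hA'⟩ := exists_hasDerivAt_of_memW21Loc isOpen_Ioo ordConnected_Ioo hA hW
  obtain ⟨hB, hBC⟩ := integrableOn_of_hasJetBound hC hb hAA' hA'
  have hBloc : LocallyIntegrable ((Ioo a b).indicator fun x => ∑ i, ∑ j, ‖B x i j‖) :=
    ((integrable_indicator_iff measurableSet_Ioo).mpr (integrable_finsetSum _ fun i _ =>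
      integrable_finsetSum _ fun j _ => (hB i j).norm)).locallyIntegrable
  refine ⟨A', _, isRegularSystem_of_isPrimitiveOn isOpen_Ioo (convex_Ioo a b) hAA' hA' hBloc hev
    fun t ht => hasDerivAt_pi.mpr fun j =>
      ((hd j).differentiableAt (isOpen_Ioo.mem_nhds ht)).hasDerivAt, fun s hs t ht hst => ?_⟩
  exact (intervalIntegral.integral_congr fun x hx => indicator_of_mem
    (ordConnected_Ioo.uIcc_subset hs ht hx) _).trans_le (hBC s hs t ht hst)

theorem eigenvalue_bounds_of_hasJetBound (hab : a < b) (hC : 0 ≤ C)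
    (hH : ∀ t ∈ Icc a b, (A t).IsHermitian)
    (hA : Componentwise (fun f => ContinuousOn f (Ioo a b)) A)
    (hW : Componentwise (MemW21Loc (Ioo a b)) A)
    (hb : Componentwise (HasJetBound (Ioo a b) (Icc a b) C) A)
    (hev : ∀ t ∈ Icc a b, IsEigenvalueTuple (A t) fun j => ev j t)
    (hd : ∀ j, ContDiffOn ℝ 1 (ev j) (Icc a b)) (j : Fin d) :
    (∀ t ∈ Icc a b, |ev j t| ≤ d * d * (2 * C)) ∧
    (∀ t ∈ Icc a b, |derivWithin (ev j) (Icc a b) t| ≤ d * d * (2 * C)) ∧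
    W21norm (Ioo a b) (ev j) ≤
      ENNReal.ofReal (d * d * (2 * C) * (2 * (b - a) + d * (6 * d + 1))) := by
  have hsub : Ioo a b ⊆ Icc a b := Ioo_subset_Icc_self
  have hdiag t (ht : t ∈ Icc a b) := (hev t ht).exists_diagonalizes (hH t ht)
  obtain ⟨A', W, hreg, hWC⟩ := exists_isRegularSystem_of_hasJetBound hC hA hW hb
    (fun t ht => hdiag t (hsub ht)) fun j => ((hd j).differentiableOn one_ne_zero).mono hsub
  have hv t (ht : t ∈ Icc a b) : ‖fun j => ev j t‖ ≤ d * d * (2 * C) :=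
    let ⟨_, hU⟩ := hdiag t ht
    hU.norm_le.trans (sum_norm_le_of_hasJetBound hb ht)
  have hv' t (ht : t ∈ Ioo a b) : ‖fun j => deriv (ev j) t‖ ≤ d * d * (2 * C) :=
    (hreg.norm_derivative_le ht).trans
      (sum_norm_derivative_le_of_hasJetBound hb ⟨ht, hsub ht⟩ (hreg.hasDerivAt_curve t ht))
  have hnorm := hreg.w21norm_le (by positivity) hab.le (fun t ht => hv t (hsub ht)) hv' hWC j
  rw [Fintype.card_fin] at hnorm
  exact ⟨fun t ht => (norm_le_pi_norm _ j).trans (hv t ht), abs_derivWithin_Icc_le hab (hd j)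
    fun t ht => (norm_le_pi_norm _ j).trans (hv' t ht), hnorm⟩

end

theorem exists_uniform_hasJetBound {F : Type*} [NormedAddCommGroup F] [NormedSpace ℝ F]
    [FiniteDimensional ℝ F] {U : Set (ℝ × F)} {K : Set F} (hU : IsOpen U) (hK : IsCompact K)
    (hKU : Icc a b ×ˢ K ⊆ U) {A : ℝ × F → Matrix (Fin d) (Fin d) ℂ}
    (hA : Componentwise (LocallyDCOn U) A) :
    ∃ C, 0 ≤ C ∧
      ∀ r ∈ K, Componentwise (HasJetBound (Ioo a b) (Icc a b) C) fun t => A (t, r) := by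
  have hslice {r : F} (hr : r ∈ K) : Icc a b ⊆ (·, r) ⁻¹' (Icc a b ×ˢ K) :=
    (mk_preimage_prod_left hr).ge
  have hcomp : IsCompact (Icc a b ×ˢ K) := isCompact_Icc.prod hK
  choose Cre hCre hre using fun i j => (hA i j).1.exists_slice_hasJetBound hU hcomp hKU
  choose Cim hCim him using fun i j => (hA i j).2.exists_slice_hasJetBound hU hcomp hKU
  have hle i j := le_sum_sum (fun i j => add_nonneg (hCre i j) (hCim i j)) i j
  refine ⟨∑ i, ∑ j, (Cre i j + Cim i j), Finset.sum_nonneg fun i _ => Finset.sum_nonneg fun j _ =>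
    add_nonneg (hCre i j) (hCim i j), fun r hr i j => ⟨(hre i j r).mono (hslice hr) ?_,
    (him i j r).mono (hslice hr) ?_⟩⟩
  · linarith [hle i j, hCim i j]
  · linarith [hle i j, hCre i j]

end

theorem MemW21.memW21Loc {Ω : Set ℝ} {u : ℝ → ℝ} (h : MemW21 Ω u) : MemW21Loc Ω u :=
  let ⟨v, w, hv, hw, _⟩ := h
  ⟨v, w, hv, hw⟩

theorem exists_integrableOn_bound_of_forall_le {α : Type*} [MeasurableSpace α] {μ : Measure α}
    {S : Set α} (hS : MeasurableSet S) (hfin : μ S ≠ ⊤) {F : α → ENNReal} {c : ENNReal} (hc : c ≠ ⊤)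
    (hF : ∀ r ∈ S, F r ≤ c) :
    ∃ m : α → ℝ, (∀ r, 0 ≤ m r) ∧ IntegrableOn m S μ ∧
      ∀ᵐ r ∂μ.restrict S, F r ≤ ENNReal.ofReal (m r) :=
  ⟨fun _ => c.toReal, fun _ => ENNReal.toReal_nonneg, integrableOn_const hfin,
    ae_restrict_of_forall_mem hS fun r hr => (hF r hr).trans_eq (ENNReal.ofReal_toReal hc).symm⟩

end UniformSystems

theorem mainTheorem2 (d : ℕ) :
    (∀ A : ℝ → Matrix (Fin d) (Fin d) ℂ, (∀ t, (A t).IsHermitian) →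
      Componentwise (DCOn Set.univ) A → Componentwise (MemW21Loc Set.univ) A →
        (∀ ev : Fin d → ℝ → ℝ, (∀ t, IsEigenvalueTuple (A t) (fun j => ev j t)) →
          (∀ j, Differentiable ℝ (ev j)) →
            ∀ j, ContDiff ℝ 1 (ev j) ∧ DCOn Set.univ (ev j) ∧ MemW21Loc Set.univ (ev j)) ∧
        (Componentwise (ContDiff ℝ 1) A →
          ∃ ev : Fin d → ℝ → ℝ, (∀ t, IsEigenvalueTuple (A t) (fun j => ev j t)) ∧
            ∀ j, ContDiff ℝ 1 (ev j))) ∧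
    (∀ (k : ℕ) (a b : ℝ), a < b →
      ∀ U : Set (ℝ × (Fin k → ℝ)), IsOpen U →
        Set.Icc a b ×ˢ Set.univ.pi (fun _ => Set.Icc a b) ⊆ U →
      ∀ A : ℝ × (Fin k → ℝ) → Matrix (Fin d) (Fin d) ℂ, (∀ p ∈ U, (A p).IsHermitian) →
        Componentwise (LocallyDCOn U) A →
        (∀ r ∈ Set.univ.pi (fun _ : Fin k => Set.Icc a b),
          Componentwise (fun f => ContDiffOn ℝ 1 f (Set.Icc a b)) (fun t => A (t, r)) ∧
          Componentwise (MemW21 (Set.Ioo a b)) (fun t => A (t, r))) →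
      ∀ ev : Fin d → ℝ → (Fin k → ℝ) → ℝ,
        (∀ r ∈ Set.univ.pi (fun _ : Fin k => Set.Icc a b),
          (∀ t ∈ Set.Icc a b, IsEigenvalueTuple (A (t, r)) (fun j => ev j t r)) ∧
          ∀ j, ContDiffOn ℝ 1 (fun t => ev j t r) (Set.Icc a b)) →
      (∃ C : ℝ, ∀ r ∈ Set.univ.pi (fun _ : Fin k => Set.Icc a b), ∀ t ∈ Set.Icc a b, ∀ j,
        |ev j t r| ≤ C ∧ |derivWithin (fun s => ev j s r) (Set.Icc a b) t| ≤ C) ∧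
      ∃ m : (Fin k → ℝ) → ℝ, (∀ r, 0 ≤ m r) ∧
        MeasureTheory.IntegrableOn m (Set.univ.pi (fun _ : Fin k => Set.Ioo a b)) ∧
        ∀ᵐ r ∂(MeasureTheory.volume.restrict (Set.univ.pi (fun _ : Fin k => Set.Ioo a b))),
          ∑ j, W21norm (Set.Ioo a b) (fun t => ev j t r) ≤ ENNReal.ofReal (m r)) := by
  refine ⟨fun A hH hDC hW => ⟨fun ev hev hd => regularity_of_differentiable_system hH hDC hW hev hd,
    fun hA => ?_⟩, fun k a b hab U hU hKU A hH hDC hA ev hev => ?_⟩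
  · obtain ⟨A', hAA', hA'⟩ := exists_hasDerivAt_continuous_of_contDiff hA
    obtain ⟨v, hv, hv'⟩ := exists_contDiff_system hH hAA' hA'
    exact ⟨fun j t => v t j, hv, contDiff_pi.mp hv'⟩
  obtain ⟨C, hC, hb⟩ :=
    exists_uniform_hasJetBound hU (isCompact_univ_pi fun _ => isCompact_Icc) hKU hDC
  have hcont r hr : Componentwise (ContinuousOn · (Set.Ioo a b)) fun t => A (t, r) := fun i j =>
    ⟨((hA r hr).1 i j).1.continuousOn.mono Set.Ioo_subset_Icc_self,
      ((hA r hr).1 i j).2.continuousOn.mono Set.Ioo_subset_Icc_self⟩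
  have hbound r hr := eigenvalue_bounds_of_hasJetBound hab hC
    (fun t ht => hH (t, r) (hKU ⟨ht, hr⟩)) (hcont r hr)
    (fun i j => ⟨((hA r hr).2 i j).1.memW21Loc, ((hA r hr).2 i j).2.memW21Loc⟩) (hb r hr)
    (ev := fun j t => ev j t r) (hev r hr).1 (hev r hr).2
  refine ⟨⟨d * d * (2 * C), fun r hr t ht j =>
    ⟨(hbound r hr j).1 t ht, (hbound r hr j).2.1 t ht⟩⟩, ?_⟩
  refine exists_integrableOn_bound_of_forall_le (MeasurableSet.univ_pi fun _ => measurableSet_Ioo)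
    (Bornology.IsBounded.pi fun _ => Metric.isBounded_Ioo a b).measure_lt_top.ne
    (ENNReal.sum_ne_top.mpr fun j _ => ENNReal.ofReal_ne_top) fun r hr =>
      Finset.sum_le_sum fun j _ => (hbound r (fun i hi => Set.Ioo_subset_Icc_self (hr i hi)) j).2.2
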